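/- A temporal graph $\mathcal G=(V,E_1,\dots,E_T)$ consists of a finite vertex set $V$ and edge sets $E_1,\dots,E_T\subseteq\binom V2$; it is a temporal line if its underlying graph $(V,\bigcup_t E_t)$ is a path. A temporal $(s,z)$-walk of length $\ell\ge 0$ is a sequence of transitions $(v_{i-1},v_i,t_i)_{i=1}^{\ell}$ with $v_0=s$, $v_\ell=z$, $\{v_{i-1},v_i\}\in E_{t_i}$ and $t_1<\dots<t_\ell$. It occupies $v_0$ at time $t_1$, $v_\ell$ at time $t_\ell$, and $v_i$ during $[t_i,t_{i+1}]$ for $1\le i<\ell$ (for $\ell=0$ nothing is occupied). Two walks are temporally disjoint if they never occupy a vertex at the same time. In Temporally Disjoint Walks, the input is a temporal graph $\mathcal G$ with a finite multiset $S$ of pairs from $V\times V$, and the question is whether there is a solution, that is, a family containing one temporal $(s,z)$-walk for every $(s,z)\in S$ whose members are pairwise temporally disjoint. **Theorem.** 1. Temporally Disjoint Walks on temporal lines is fixed-parameter tractable with respect to $|S|$: it is decided by an algorithm in time $f(|S|)\cdot|x|^{O(1)}$, where $f$ is a computable function and $|x|$ is the size of the input $(\mathcal G,S)$. 2. More precisely,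 it can be decided in time $|S|^{O(|S|^4)}\cdot|x|^{O(1)}$. 3. Let $\mathcal S$ be a solution of an instance $(\mathcal G,S)$ on a temporal line such that the sum of the lengths of its walks is minimum among all solutions. Then in each walk of $\mathcal S$ there are at most $2|S|$ direction changes, i.e. pairs of consecutive transitions of the form $(a,b,t),(b,a,t')$, and for each of them the vertex $b$ has distance at most $|S|$ in the underlying path from some vertex that is a source or a sink in $S$. (Algorithms are programs for a random access machine with addition and subtraction, under the uniform cost measure; the input is given by $|V|$, $T$, $|S|$, the list of the pairs, and the adjacency matrices of the layers.) -/

import Mathlib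

/-! ### Temporal graphs, temporal walks and temporal disjointness -/

/-- A temporal graph on the vertex set `V` with `T` time steps: one (static, loopless, undirected)
edge set for every time step. -/
structure TemporalGraph (V : Type) (T : ℕ) where
  layer : Fin T → SimpleGraph V

/-- The underlying graph contains all edges that appear in at least one time step. -/
def TemporalGraph.underlying {V : Type} {T : ℕ} (G : TemporalGraph V T) : SimpleGraph V :=
  ⨆ t, G.layer t

/-- A temporal line: the underlying graph is a path (the vertices of the path may be named in any
order). -/
def TemporalGraph.IsLine {n T : ℕ} (G : TemporalGraph (Fin n) T) : Prop :=
  Nonempty (G.underlying ≃g SimpleGraph.pathGraph n)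

/-- A transition `(src, dst, time)`. -/
structure Transition (V : Type) (T : ℕ) where
  src : V
  dst : V
  time : Fin T

/-- The transitions of `W` fit together to a walk from `s` to `z` and each of them uses an edge
that is present at its time step. -/
def TemporalGraph.Follows {V : Type} {T : ℕ} (G : TemporalGraph V T) :
    V → V → List (Transition V T) → Prop
  | s, z, [] => s = z
  | s, z, e :: W => e.src = s ∧ (G.layer e.time).Adj e.src e.dst ∧ G.Follows e.dst z W

/-- `W` is a temporal `(s,z)`-walk: consecutive transitions fit together, and the time steps are
strictly increasing. Its length is `W.length`. -/
def TemporalGraph.IsTemporalWalk {V : Type} {T : ℕ} (G : TemporalGraph V T) (s z : V)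
    (W : List (Transition V T)) : Prop :=
  G.Follows s z W ∧ W.Pairwise (fun e f => e.time < f.time)

/-- `W` occupies the vertex `v` at time `τ`: the first vertex is occupied at the time of the first
transition, the last vertex at the time of the last transition, and a vertex in between from the
transition `e` that enters it up to the next transition `f`, which leaves it. -/
def Occupies {V : Type} {T : ℕ} (W : List (Transition V T)) (v : V) (τ : Fin T) : Prop :=
  (∃ e ∈ W.head?, e.src = v ∧ τ = e.time) ∨
  (∃ e ∈ W.getLast?, e.dst = v ∧ τ = e.time) ∨
  (∃ e f, [e, f] <:+: W ∧ e.dst = v ∧ e.time ≤ τ ∧ τ ≤ f.time)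

/-- Two temporal walks are temporally disjoint if they never occupy a vertex at the same time. -/
def TemporallyDisjoint {V : Type} {T : ℕ} (W W' : List (Transition V T)) : Prop :=
  ∀ v τ, ¬ (Occupies W v τ ∧ Occupies W' v τ)

/-- The vertices at which `W` changes direction, listed in order and with repetition: the middle
vertex `b` of every pair of consecutive transitions of the form `(a, b, t), (b, a, t')`. -/
def directionChanges {V : Type} [DecidableEq V] {T : ℕ} : List (Transition V T) → List V
  | e :: f :: W =>
      if f.src = e.dst ∧ f.dst = e.src then e.dst :: directionChanges (f :: W)
      else directionChanges (f :: W)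
  | _ => []

/-- An instance of Temporally Disjoint Walks: a temporal graph on `n` vertices with `T` time steps
and a multiset of `k` source-sink pairs, given as a family indexed by `Fin k`. -/
structure TDWInstance where
  n : ℕ
  T : ℕ
  graph : TemporalGraph (Fin n) T
  k : ℕ
  source : Fin k → Fin n
  sink : Fin k → Fin n

namespace TDWInstance

/-- A solution: one temporal walk for each source-sink pair, pairwise temporally disjoint. -/
def IsSolution (I : TDWInstance) (W : Fin I.k → List (Transition (Fin I.n) I.T)) : Prop :=
  (∀ i, I.graph.IsTemporalWalk (I.source i) (I.sink i) (W i)) ∧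
  ∀ i j, i ≠ j → TemporallyDisjoint (W i) (W j)

/-- The total length of a family of walks. -/
def totalLength (I : TDWInstance) (W : Fin I.k → List (Transition (Fin I.n) I.T)) : ℕ :=
  ∑ i, (W i).length

/-- A solution whose total length is the smallest among all solutions. -/
def IsMinimalSolution (I : TDWInstance) (W : Fin I.k → List (Transition (Fin I.n) I.T)) : Prop :=
  I.IsSolution W ∧ ∀ W', I.IsSolution W' → I.totalLength W ≤ I.totalLength W'

/-- The set of vertices that appear as sources or sinks. -/
def terminals (I : TDWInstance) : Set (Fin I.n) :=
  Set.range I.source ∪ Set.range I.sink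

open Classical in
/-- The input word of an instance: the numbers `n`, `T`, `k`, then the pairs
`source i, sink i`, then, layer by layer, the adjacency matrix with entries `0` and `1`. -/
noncomputable def encode (I : TDWInstance) : List ℕ :=
  [I.n, I.T, I.k] ++
  (List.finRange I.k).flatMap (fun i => [(I.source i : ℕ), (I.sink i : ℕ)]) ++
  (List.finRange I.T).flatMap (fun t =>
    (List.finRange I.n).flatMap (fun u =>
      (List.finRange I.n).map (fun v => if (I.graph.layer t).Adj u v then 1 else 0)))

end TDWInstance

/-! ### Random access machines with the uniform cost measure

The memory consists of arrays of natural numbers, of which a program uses finitely many. The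
arithmetic operations are addition and truncated subtraction; there is no multiplication, so that
the numbers computed in `t` steps have `O(t)` more bits than those in the input. -/

/-- `σ a i` is the content of cell `i` of array `a`. -/
abbrev RAMState : Type := ℕ → ℕ → ℕ

inductive RAMExpr where
  | const (c : ℕ)
  | read (a : ℕ) (i : RAMExpr)
  | add (e f : RAMExpr)
  | sub (e f : RAMExpr)

namespace RAMExpr

def eval (σ : RAMState) : RAMExpr → ℕ
  | const c => c
  | read a i => σ a (i.eval σ)
  | add e f => e.eval σ + f.eval σ
  | sub e f => e.eval σ - f.eval σ

/-- The number of operations performed to evaluate an expression. -/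
def cost : RAMExpr → ℕ
  | const _ => 1
  | read _ i => i.cost + 1
  | add e f => e.cost + f.cost + 1
  | sub e f => e.cost + f.cost + 1

end RAMExpr

/-- Programs: do nothing, write the value of `e` into cell `i` of array `a`, execute in sequence,
branch on whether `b` is nonzero, and repeat as long as `b` is nonzero. -/
inductive RAMProgram where
  | skip
  | write (a : ℕ) (i e : RAMExpr)
  | seq (p q : RAMProgram)
  | cond (b : RAMExpr) (p q : RAMProgram)
  | loop (b : RAMExpr) (p : RAMProgram)

/-- `RAMExec p σ t σ'`: started in memory state `σ`, the program `p` halts after `t` steps in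
memory state `σ'`. -/
inductive RAMExec : RAMProgram → RAMState → ℕ → RAMState → Prop
  | skip (σ : RAMState) : RAMExec .skip σ 1 σ
  | write (a : ℕ) (i e : RAMExpr) (σ : RAMState) :
      RAMExec (.write a i e) σ (i.cost + e.cost + 1)
        (Function.update σ a (Function.update (σ a) (i.eval σ) (e.eval σ)))
  | seq {p q : RAMProgram} {σ σ' σ'' : RAMState} {t t' : ℕ} :
      RAMExec p σ t σ' → RAMExec q σ' t' σ'' → RAMExec (.seq p q) σ (t + t') σ''
  | condTrue {b : RAMExpr} {p q : RAMProgram} {σ σ' : RAMState} {t : ℕ} :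
      b.eval σ ≠ 0 → RAMExec p σ t σ' → RAMExec (.cond b p q) σ (b.cost + 1 + t) σ'
  | condFalse {b : RAMExpr} {p q : RAMProgram} {σ σ' : RAMState} {t : ℕ} :
      b.eval σ = 0 → RAMExec q σ t σ' → RAMExec (.cond b p q) σ (b.cost + 1 + t) σ'
  | loopTrue {b : RAMExpr} {p : RAMProgram} {σ σ' σ'' : RAMState} {t t' : ℕ} :
      b.eval σ ≠ 0 → RAMExec p σ t σ' → RAMExec (.loop b p) σ' t' σ'' →
      RAMExec (.loop b p) σ (b.cost + 1 + t + t') σ''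
  | loopFalse {b : RAMExpr} {p : RAMProgram} {σ : RAMState} :
      b.eval σ = 0 → RAMExec (.loop b p) σ (b.cost + 1) σ

/-- The initial memory: array `0` holds the input word, all other cells are `0`. -/
def RAMState.init (x : List ℕ) : RAMState := fun a i => if a = 0 then x.getD i 0 else 0

/-! ### Parameterized problems and fixed-parameter tractability -/

/-- A parameterized decision problem: instances with their input words, their parameters, and the
set of yes-instances. -/
structure ParamProblem where
  Instance : Type
  encode : Instance → List ℕ
  param : Instance → ℕ
  yes : Set Instance

namespace ParamProblem

/-- One program, the same for all instances, decides the problem, and on each instance with input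
word `x` and parameter `k` it halts after at most `bound k |x|` steps. The answer is yes if and
only if cell `0` of array `1` is nonzero at the end. -/
def DecidableInTime (P : ParamProblem) (bound : ℕ → ℕ → ℕ) : Prop :=
  ∃ p : RAMProgram, ∀ I : P.Instance, ∃ (t : ℕ) (σ : RAMState),
    RAMExec p (RAMState.init (P.encode I)) t σ ∧
    t ≤ bound (P.param I) (P.encode I).length ∧
    (σ 1 0 ≠ 0 ↔ I ∈ P.yes)

/-- Fixed-parameter tractability: decidable in time `f(k) * |x| ^ O(1)` with `f` computable. -/
def IsFPT (P : ParamProblem) : Prop :=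
  ∃ f : ℕ → ℕ, Computable f ∧ ∃ c : ℕ, P.DecidableInTime (fun k m => f k * m ^ c)

end ParamProblem

/-- Temporally Disjoint Walks on temporal lines, parameterized by the number of source-sink
pairs. -/
noncomputable def temporallyDisjointWalksOnLines : ParamProblem where
  Instance := {I : TDWInstance // I.graph.IsLine}
  encode I := I.1.encode
  param I := I.1.k
  yes := {I | ∃ W, I.1.IsSolution W}

/-! ### Walks without a detour -/

section Walks

variable {V : Type} {T : ℕ}

/-! The structure of minimal solutions comes from an exchange argument. A walk with a detour
$(a,b,t),(b,a,t')$ could wait at $a$ instead, so by minimality another walk occupies $a$ strictly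
between $t$ and $t'$ (`IsMinimalSolution.exists_occupies`). If that walk starts or ends there, $a$
is a terminal. Otherwise it enters and leaves $a$ within the detour while $b$ is occupied all the
time, so on a line it comes from the other neighbour of $a$ and returns to it: a shorter detour,
nested in the first and one vertex further away. Iterating this leads to a start or end of a walk
within the original detour. Each level adds a walk that waits throughout the innermost interval, so
there are at most $|S|$ levels (`IsMinimalSolution.exists_isEndTime`). The detours of one walk have
disjoint open time intervals, and there are at most $2|S|$ starts and ends; this bounds the number
of direction changes.

For the algorithm let $k=|S|$. A walk of a minimal solution goes straight from waypoint to waypoint,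
where at most $2k+1$ waypoints are needed: the turning vertices and the sink. Each lies within
distance $k$ of a terminal, which leaves $2k(2k+1)$ candidates. Two disjoint walks that traverse a
common stretch of the line on straight legs pass all of its vertices in the same order
(`order_propagates`), so one bit per ordered pair of legs tells who goes first everywhere. Hence
waypoints and bits can be guessed in $k^{O(k^4)}$ ways (`TDWInstance.exists_waypoints_and_order`).

For a fixed guess all walks move as early as the prescribed order permits. If the guess stems from a
solution, then by induction on time the greedy walks are never behind it (`RoutePlan.pos_eq_last`).
Conversely, whenever all greedy walks arrive at their sinks they form a solution, however
meaningless the guess (`RoutePlan.exists_isSolution`); so guesses need not be checked for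
consistency. The order of the vertices on the line is found by trying each vertex as the first one.

For the running time, `Runs` couples a postcondition with the bound `RAMProgram.bound Y`, where `Y`
bounds the number of iterations of every loop. This bound is polynomial in `Y`, and the number of
guesses times the fourth power of the input length is an admissible `Y` (`TDWInstance.loopBound`).
-/

theorem List.pair_infix_iff {α : Type} {e f : α} {W : List α} :
    [e, f] <:+: W ↔ ∃ P Q, W = P ++ e :: f :: Q := by
  constructor
  · rintro ⟨P, Q, h⟩
    exact ⟨P, Q, by simp [← h]⟩
  · rintro ⟨P, Q, rfl⟩
    exact ⟨P, Q, by simp⟩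

theorem List.pair_infix_append {α : Type} {g h : α} {P Q : List α} (H : [g, h] <:+: P ++ Q) :
    [g, h] <:+: P ∨ [g, h] <:+: Q ∨ (∃ P', P = P' ++ [g]) ∧ ∃ Q', Q = h :: Q' := by
  rcases List.infix_append_iff.1 H with H | H | ⟨l₁, l₂, h1, h2, h3⟩
  · exact Or.inl H
  · exact Or.inr (Or.inl H)
  · rcases l₁ with _ | ⟨x, _ | ⟨y, l₁⟩⟩
    · simp only [List.nil_append] at h1
      exact Or.inr (Or.inl (h1 ▸ h3.isInfix))
    · simp only [List.cons_append, List.nil_append, List.cons.injEq] at h1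
      obtain ⟨rfl, rfl⟩ := h1
      obtain ⟨P', rfl⟩ := h2
      obtain ⟨Q', rfl⟩ := h3
      exact Or.inr (Or.inr ⟨⟨P', rfl⟩, Q', rfl⟩)
    · simp only [List.cons_append, List.cons.injEq] at h1
      obtain ⟨rfl, rfl, h1⟩ := h1
      have : l₁ = [] := by
        have := h1.symm
        simp at this
        exact this.1
      subst this
      exact Or.inl h2.isInfix

theorem TemporalGraph.follows_append {G : TemporalGraph V T} {s z : V}
    {P Q : List (Transition V T)} :
    G.Follows s z (P ++ Q) ↔ ∃ a, G.Follows s a P ∧ G.Follows a z Q := by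
  induction P generalizing s with
  | nil => simp [TemporalGraph.Follows]
  | cons e P ih => simp [TemporalGraph.Follows, ih, and_assoc]

theorem TemporalGraph.follows_concat {G : TemporalGraph V T} {s z : V}
    {P : List (Transition V T)} {e : Transition V T} :
    G.Follows s z (P ++ [e]) ↔
      G.Follows s e.src P ∧ (G.layer e.time).Adj e.src e.dst ∧ e.dst = z := by
  rw [TemporalGraph.follows_append]
  constructor
  · rintro ⟨a, h1, h2, h3, h4⟩
    exact ⟨h2 ▸ h1, h3, h4⟩
  · rintro ⟨h1, h3, h4⟩
    exact ⟨_, h1, rfl, h3, h4⟩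

theorem TemporalGraph.Follows.adj_of_mem {G : TemporalGraph V T} {s z : V}
    {W : List (Transition V T)} (h : G.Follows s z W) {e : Transition V T} (he : e ∈ W) :
    (G.layer e.time).Adj e.src e.dst := by
  obtain ⟨P, Q, rfl⟩ := List.append_of_mem he
  obtain ⟨a, -, h1⟩ := TemporalGraph.follows_append.1 h
  exact h1.2.1

theorem TemporalGraph.Follows.src_eq {G : TemporalGraph V T} {s z : V}
    {W : List (Transition V T)} (h : G.Follows s z W) {e f : Transition V T}
    (he : [e, f] <:+: W) : f.src = e.dst := by
  obtain ⟨P, Q, rfl⟩ := List.pair_infix_iff.1 he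
  obtain ⟨a, -, h1⟩ := TemporalGraph.follows_append.1 h
  exact h1.2.2.1

theorem TemporalGraph.IsTemporalWalk.time_lt {G : TemporalGraph V T} {s z : V}
    {W : List (Transition V T)} (h : G.IsTemporalWalk s z W) {e f : Transition V T}
    (he : [e, f] <:+: W) : e.time < f.time := by
  have := h.2.sublist he.sublist
  simpa using this

/-- Between two consecutive transitions there is no further transition. -/
theorem TemporalGraph.IsTemporalWalk.not_between {G : TemporalGraph V T} {s z : V}
    {W : List (Transition V T)} (h : G.IsTemporalWalk s z W) {e f g : Transition V T}
    (he : [e, f] <:+: W) (hg : g ∈ W) : ¬ (e.time < g.time ∧ g.time < f.time) := by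
  obtain ⟨P, Q, rfl⟩ := List.pair_infix_iff.1 he
  have h2 := h.2
  simp only [List.pairwise_append, List.pairwise_cons, List.mem_cons] at h2
  simp only [List.mem_append, List.mem_cons] at hg
  rintro ⟨h3, h4⟩
  rcases hg with hg | rfl | rfl | hg
  · exact absurd (h2.2.2 g hg e (Or.inl rfl)) (by order)
  · exact lt_irrefl _ h3
  · exact lt_irrefl _ h4
  · exact absurd (h2.2.1.2.1 g hg) (by order)

theorem TemporalGraph.Follows.occupies_src {G : TemporalGraph V T} {s z : V}
    {W : List (Transition V T)} (h : G.IsTemporalWalk s z W) {e : Transition V T} (he : e ∈ W) :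
    Occupies W e.src e.time := by
  obtain ⟨P, Q, rfl⟩ := List.append_of_mem he
  rcases List.eq_nil_or_concat P with rfl | ⟨P', g, rfl⟩
  · exact Or.inl ⟨e, by simp, rfl, rfl⟩
  · have hi : [g, e] <:+: P'.concat g ++ e :: Q := ⟨P', Q, by simp⟩
    exact Or.inr (Or.inr ⟨g, e, hi, (h.1.src_eq hi).symm, (h.time_lt hi).le, le_rfl⟩)

theorem TemporalGraph.Follows.occupies_dst {G : TemporalGraph V T} {s z : V}
    {W : List (Transition V T)} (h : G.IsTemporalWalk s z W) {e : Transition V T} (he : e ∈ W) :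
    Occupies W e.dst e.time := by
  obtain ⟨P, Q, rfl⟩ := List.append_of_mem he
  rcases Q with _ | ⟨f, Q⟩
  · exact Or.inr (Or.inl ⟨e, by simp, rfl, rfl⟩)
  · have hi : [e, f] <:+: P ++ e :: f :: Q := ⟨P, Q, by simp⟩
    exact Or.inr (Or.inr ⟨e, f, hi, rfl, le_rfl, (h.time_lt hi).le⟩)

/-- Removing a detour `(a, b, t), (b, a, t')` from a temporal walk leaves a temporal walk. -/
theorem TemporalGraph.IsTemporalWalk.remove_detour {G : TemporalGraph V T} {s z : V}
    {P Q : List (Transition V T)} {e f : Transition V T}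
    (h : G.IsTemporalWalk s z (P ++ e :: f :: Q)) (hef : f.dst = e.src) :
    G.IsTemporalWalk s z (P ++ Q) := by
  obtain ⟨h1, h2⟩ := h
  refine ⟨?_, h2.sublist ?_⟩
  · obtain ⟨a, h3, h4, -, -, -, h5⟩ := TemporalGraph.follows_append.1 h1
    exact TemporalGraph.follows_append.2 ⟨a, h3, by rwa [← h4, ← hef]⟩
  · exact List.Sublist.append_left (((List.Sublist.refl Q).cons f).cons e) P

/-- After removing a detour, the walk occupies nothing new, except for the vertex where the
detour starts while the detour takes place. -/
theorem TemporalGraph.IsTemporalWalk.occupies_remove_detour {G : TemporalGraph V T} {s z : V}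
    {P Q : List (Transition V T)} {e f : Transition V T}
    (h : G.IsTemporalWalk s z (P ++ e :: f :: Q)) (hef : f.dst = e.src) {v : V} {τ : Fin T}
    (ho : Occupies (P ++ Q) v τ) :
    Occupies (P ++ e :: f :: Q) v τ ∨ (v = e.src ∧ e.time < τ ∧ τ < f.time) := by
  have hfQ : ∀ g Q', Q = g :: Q' → [f, g] <:+: P ++ e :: f :: Q := by
    rintro g Q' rfl
    exact ⟨P ++ [e], Q', by simp⟩
  have hPe : ∀ g P', P = P' ++ [g] → [g, e] <:+: P ++ e :: f :: Q := by
    rintro g P' rfl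
    exact ⟨P', f :: Q, by simp⟩
  have key : ∀ g, g ∈ P ++ e :: f :: Q → g.src = v → τ = g.time →
      Occupies (P ++ e :: f :: Q) v τ := by
    rintro g hg rfl rfl
    exact TemporalGraph.Follows.occupies_src h hg
  have key' : ∀ g, g ∈ P ++ e :: f :: Q → g.dst = v → τ = g.time →
      Occupies (P ++ e :: f :: Q) v τ := by
    rintro g hg rfl rfl
    exact TemporalGraph.Follows.occupies_dst h hg
  rcases ho with ⟨g, hg, h1, h2⟩ | ⟨g, hg, h1, h2⟩ | ⟨g, g', hg, h1, h2, h3⟩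
  · left
    have : g ∈ P ++ Q := List.mem_of_mem_head? hg
    exact key g (by simp only [List.mem_append, List.mem_cons] at this ⊢; tauto) h1 h2
  · left
    have : g ∈ P ++ Q := List.mem_of_mem_getLast? hg
    exact key' g (by simp only [List.mem_append, List.mem_cons] at this ⊢; tauto) h1 h2
  · rcases List.pair_infix_append hg with hg | hg | ⟨⟨P', hP⟩, Q', hQ⟩
    · exact Or.inl (Or.inr (Or.inr ⟨g, g', hg.trans List.infix_append_left, h1, h2, h3⟩))
    · exact Or.inl (Or.inr (Or.inr ⟨g, g',
        hg.trans ⟨P ++ [e, f], [], by simp⟩, h1, h2, h3⟩))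
    -- The pair straddles the seam: the shortened walk waits at the start of the detour from `g` to
    -- `g'`. Up to `e` and from `f` on, the old walk stood there as well.
    · have hv : e.src = v := by rw [← h1]; exact h.1.src_eq (hPe g P' hP)
      rcases le_or_gt τ e.time with h4 | h4
      · exact Or.inl (Or.inr (Or.inr ⟨g, e, hPe g P' hP, h1, h2, h4⟩))
      rcases le_or_gt f.time τ with h5 | h5
      · exact Or.inl (Or.inr (Or.inr ⟨f, g', hfQ g' Q' hQ, hef.trans hv, h5, h3⟩))
      · exact Or.inr ⟨hv.symm, h4, h5⟩

theorem mem_directionChanges [DecidableEq V] {W : List (Transition V T)} {b : V} :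
    b ∈ directionChanges W ↔
      ∃ e f, [e, f] <:+: W ∧ f.src = e.dst ∧ f.dst = e.src ∧ e.dst = b := by
  induction W with
  | nil => simp [directionChanges]
  | cons e W ih =>
    cases W with
    | nil =>
      simp only [directionChanges, List.not_mem_nil, false_iff, not_exists]
      rintro e' f' ⟨h, -⟩
      simpa using h.length_le
    | cons f W =>
      have h1 : ∀ e' f', [e', f'] <:+: e :: f :: W ↔
          (e' = e ∧ f' = f) ∨ [e', f'] <:+: f :: W := by
        intro e' f'
        rw [List.infix_cons_iff]
        simp [List.cons_prefix_cons]
      simp only [h1, or_and_right, exists_or]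
      rw [← ih, directionChanges]
      split_ifs with h2
      · simp only [List.mem_cons]
        refine or_congr ⟨?_, ?_⟩ Iff.rfl
        · rintro rfl
          exact ⟨e, f, ⟨rfl, rfl⟩, h2.1, h2.2, rfl⟩
        · rintro ⟨e', f', ⟨rfl, rfl⟩, -, -, rfl⟩
          rfl
      · refine (or_iff_right ?_).symm
        rintro ⟨e', f', ⟨rfl, rfl⟩, h3, h4, -⟩
        exact h2 ⟨h3, h4⟩

/-- If an event happens during each detour, then there are at most as many direction changes
as events. -/
theorem length_directionChanges_le [DecidableEq V] {ι : Type} [DecidableEq ι] (E : Finset ι)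
    (τ : ι → Fin T) {W : List (Transition V T)} (hW : W.Pairwise (fun e f => e.time < f.time))
    (h : ∀ e f, [e, f] <:+: W → f.src = e.dst → f.dst = e.src →
      ∃ i ∈ E, e.time < τ i ∧ τ i < f.time) :
    (directionChanges W).length ≤ (E.filter fun i => ∀ e ∈ W.head?, e.time < τ i).card := by
  induction W with
  | nil => simp [directionChanges]
  | cons e W ih =>
    cases W with
    | nil => simp [directionChanges]
    | cons f W =>
      have ih := ih hW.of_cons fun e' f' h' => h e' f' (List.infix_cons h')
      have hlt : e.time < f.time := by
        simp only [List.pairwise_cons, List.mem_cons] at hW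
        exact hW.1 f (Or.inl rfl)
      have hsub : (E.filter fun i => ∀ g ∈ (f :: W).head?, g.time < τ i) ⊆
          (E.filter fun i => ∀ g ∈ (e :: f :: W).head?, g.time < τ i) := by
        intro i hi
        simp only [Finset.mem_filter, List.head?_cons, Option.mem_def, Option.some.injEq,
          forall_eq'] at hi ⊢
        exact ⟨hi.1, hlt.trans hi.2⟩
      rw [directionChanges]
      split_ifs with h2
      · obtain ⟨i, hi, h3, h4⟩ := h e f ⟨[], W, by simp⟩ h2.1 h2.2
        -- The event within the detour is later than `e` but not later than `f`, so it is counted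
        -- for the whole list and not for the tail.
        have : (E.filter fun i => ∀ g ∈ (f :: W).head?, g.time < τ i).card <
            (E.filter fun i => ∀ g ∈ (e :: f :: W).head?, g.time < τ i).card := by
          refine Finset.card_lt_card ⟨hsub, fun hs => ?_⟩
          have := @hs i (by simpa [hi] using h3)
          simp only [Finset.mem_filter, List.head?_cons, Option.mem_def, Option.some.injEq,
            forall_eq'] at this
          exact absurd this.2 (not_lt.2 h4.le)
        simp only [List.length_cons]
        omega
      · exact ih.trans (Finset.card_le_card hsub)

end Walks

/-! ### Minimal solutions -/

/-- A vertex of a path has at most two neighbours. This is all that the analysis of minimal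
solutions uses about lines. -/
theorem TemporalGraph.IsLine.eq_of_adj {n T : ℕ} {G : TemporalGraph (Fin n) T} (hG : G.IsLine)
    {a b x y : Fin n} (hb : G.underlying.Adj a b) (hx : G.underlying.Adj a x)
    (hy : G.underlying.Adj a y) (hxb : x ≠ b) (hyb : y ≠ b) : x = y := by
  obtain ⟨φ⟩ := hG
  rw [← φ.map_adj_iff, SimpleGraph.pathGraph_adj] at hb hx hy
  have h1 : (φ x : ℕ) ≠ φ b := fun h => hxb (φ.injective (Fin.ext h))
  have h2 : (φ y : ℕ) ≠ φ b := fun h => hyb (φ.injective (Fin.ext h))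
  exact φ.injective (Fin.ext (by omega))

theorem TemporalGraph.underlying_adj {V : Type} {T : ℕ} {G : TemporalGraph V T} {t : Fin T}
    {a b : V} (h : (G.layer t).Adj a b) : G.underlying.Adj a b := by
  rw [TemporalGraph.underlying, SimpleGraph.iSup_adj]
  exact ⟨t, h⟩

namespace TDWInstance

variable {I : TDWInstance} {W : Fin I.k → List (Transition (Fin I.n) I.T)}

/-- During each detour of a minimal solution, another walk occupies the vertex where the detour
starts. -/
theorem IsMinimalSolution.exists_occupies (hW : I.IsMinimalSolution W) {i : Fin I.k}
    {e f : Transition (Fin I.n) I.T} (hef : [e, f] <:+: W i) (hd : f.dst = e.src) :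
    ∃ j ≠ i, ∃ τ, e.time < τ ∧ τ < f.time ∧ Occupies (W j) e.src τ := by
  by_contra hcon
  push Not at hcon
  obtain ⟨P, Q, hPQ⟩ := List.pair_infix_iff.1 hef
  obtain ⟨⟨hwalk, hdisj⟩, hmin⟩ := hW
  have hi := hwalk i
  rw [hPQ] at hi
  have hnew : ∀ j ≠ i, TemporallyDisjoint (P ++ Q) (W j) := by
    rintro j hj v τ ⟨h1, h2⟩
    rcases hi.occupies_remove_detour hd h1 with h3 | ⟨rfl, h3, h4⟩
    · exact hdisj i j hj.symm v τ ⟨hPQ ▸ h3, h2⟩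
    · exact hcon j hj τ h3 h4 h2
  have hsol : I.IsSolution (Function.update W i (P ++ Q)) := by
    refine ⟨fun j => ?_, fun j j' hj => ?_⟩
    · rcases eq_or_ne j i with rfl | hj
      · rw [Function.update_self]
        exact hi.remove_detour hd
      · rw [Function.update_of_ne hj]
        exact hwalk j
    · rcases eq_or_ne j i with rfl | hji
      · rw [Function.update_self, Function.update_of_ne hj.symm]
        exact hnew j' hj.symm
      · rw [Function.update_of_ne hji]
        rcases eq_or_ne j' i with rfl | hji'
        · rw [Function.update_self]
          exact fun v τ h => hnew j hji v τ h.symm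
        · rw [Function.update_of_ne hji']
          exact hdisj j j' hj
  refine absurd (hmin _ hsol) (not_le.2 ?_)
  refine Finset.sum_lt_sum (fun j _ => ?_) ⟨i, Finset.mem_univ i, ?_⟩
  · rcases eq_or_ne j i with rfl | hj
    · rw [Function.update_self, hPQ]
      simp only [List.length_append, List.length_cons]
      omega
    · rw [Function.update_of_ne hj]
  · rw [Function.update_self, hPQ]
    simp

open Classical in
/-- The number of walks that wait at a vertex from `t` to `t'`. -/
noncomputable def waiting (W : Fin I.k → List (Transition (Fin I.n) I.T)) (t t' : Fin I.T) : ℕ :=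
  (Finset.univ.filter fun j => ∃ e f, [e, f] <:+: W j ∧ e.time ≤ t ∧ t' ≤ f.time).card

/-- The time at which the walk `W j` starts (for `false`) or ends (for `true`). -/
def IsEndTime (W : Fin I.k → List (Transition (Fin I.n) I.T)) (p : Fin I.k × Bool)
    (τ : Fin I.T) : Prop :=
  if p.2 then ∃ e ∈ (W p.1).getLast?, τ = e.time else ∃ e ∈ (W p.1).head?, τ = e.time

theorem IsSolution.head_src (hW : I.IsSolution W) {j : Fin I.k}
    {e : Transition (Fin I.n) I.T} (he : e ∈ (W j).head?) : e.src = I.source j := by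
  have := (hW.1 j).1
  obtain ⟨Q, hQ⟩ : ∃ Q, W j = e :: Q := by
    cases h : W j with
    | nil => simp [h] at he
    | cons a l => simp [h] at he; exact ⟨l, by rw [he]⟩
  rw [hQ] at this
  exact this.1

theorem IsSolution.getLast_dst (hW : I.IsSolution W) {j : Fin I.k}
    {e : Transition (Fin I.n) I.T} (he : e ∈ (W j).getLast?) : e.dst = I.sink j := by
  have := (hW.1 j).1
  obtain ⟨Q, hQ⟩ : ∃ Q, W j = Q ++ [e] := by
    rcases List.eq_nil_or_concat (W j) with h | ⟨Q, a, h⟩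
    · simp [h] at he
    · simp [h] at he; exact ⟨Q, by rw [h, he]; simp⟩
  rw [hQ, TemporalGraph.follows_concat] at this
  exact this.2.2

/-- During each detour of a minimal solution on a line, a walk starts or ends, and it does so
close to the detour. -/
theorem IsMinimalSolution.exists_isEndTime (hG : I.graph.IsLine) (hW : I.IsMinimalSolution W)
    {i : Fin I.k} {e f : Transition (Fin I.n) I.T} (hef : [e, f] <:+: W i)
    (hd : f.dst = e.src) :
    ∃ p τ, IsEndTime W p τ ∧ e.time < τ ∧ τ < f.time ∧
      ∃ v ∈ I.terminals, ∃ q : I.graph.underlying.Walk e.dst v,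
        q.length + waiting W e.time f.time ≤ I.k + 1 := by
  classical
  -- The descent is on the duration: a walk that passes through `e.src` meanwhile makes a detour
  -- strictly inside this one.
  induction hm : (f.time : ℕ) - e.time using Nat.strong_induction_on generalizing i e f with
  | _ m ih =>
  have hwi := hW.1.1 i
  have hsrc := hwi.1.src_eq hef
  have hei : e ∈ W i := hef.subset (by simp)
  have hfi : f ∈ W i := hef.subset (by simp)
  have hadj := TemporalGraph.underlying_adj (hwi.1.adj_of_mem hei)
  have hcard : waiting W e.time f.time ≤ I.k := by
    refine (Finset.card_filter_le _ _).trans ?_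
    simp
  have hbase : ∀ v : Fin I.n, e.src = v → v ∈ I.terminals →
      ∃ v ∈ I.terminals, ∃ q : I.graph.underlying.Walk e.dst v,
        q.length + waiting W e.time f.time ≤ I.k + 1 := by
    rintro v rfl hv
    exact ⟨_, hv, SimpleGraph.Walk.cons hadj.symm .nil, by simp; omega⟩
  obtain ⟨j, hji, τ, h1, h2, hocc⟩ := hW.exists_occupies hef hd
  have hwj := hW.1.1 j
  have hdis := hW.1.2 i j hji.symm
  rcases hocc with ⟨g, hg, h3, h4⟩ | ⟨g, hg, h3, h4⟩ | ⟨e', f', hg, h3, h4, h5⟩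
  · refine ⟨(j, false), τ, ?_, h1, h2, hbase (I.source j) ?_ (Or.inl ⟨j, rfl⟩)⟩
    · simpa [IsEndTime] using ⟨g, hg, h4⟩
    · rw [← h3]; exact hW.1.head_src hg
  · refine ⟨(j, true), τ, ?_, h1, h2, hbase (I.sink j) ?_ (Or.inr ⟨j, rfl⟩)⟩
    · simpa [IsEndTime] using ⟨g, hg, h4⟩
    · rw [← h3]; exact hW.1.getLast_dst hg
  · have he'j : e' ∈ W j := hg.subset (by simp)
    have hf'j : f' ∈ W j := hg.subset (by simp)
    have hsrc' := hwj.1.src_eq hg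
    have hparked : ∀ σ, e'.time ≤ σ → σ ≤ f'.time → Occupies (W j) e.src σ := fun σ ha hb =>
      Or.inr (Or.inr ⟨e', f', hg, h3, ha, hb⟩)
    have hparked' : ∀ σ, e.time ≤ σ → σ ≤ f.time → Occupies (W i) e.dst σ := fun σ ha hb =>
      Or.inr (Or.inr ⟨e, f, hef, rfl, ha, hb⟩)
    -- Walk `i` itself occupies `e.src` at both ends of its detour, so walk `j` comes and goes
    -- strictly in between.
    have h6 : e.time < e'.time := by
      by_contra h
      exact hdis _ _ ⟨TemporalGraph.Follows.occupies_src hwi hei,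
        hparked e.time (not_lt.1 h) (h1.le.trans h5)⟩
    have h7 : f'.time < f.time := by
      by_contra h
      refine hdis _ _ ⟨TemporalGraph.Follows.occupies_dst hwi hfi, ?_⟩
      rw [hd]
      exact hparked f.time (h4.trans h2.le) (not_lt.1 h)
    have h8 := hwj.time_lt hg
    -- All this time walk `i` stands at `e.dst`, so walk `j` can neither come from there nor go
    -- there. Both its transitions use the other neighbour of `e.src`.
    have h9 : e'.src ≠ e.dst := fun h =>
      hdis e.dst e'.time ⟨hparked' _ h6.le (h8.trans h7).le,
        h ▸ TemporalGraph.Follows.occupies_src hwj he'j⟩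
    have h10 : f'.dst ≠ e.dst := fun h =>
      hdis e.dst f'.time ⟨hparked' _ (h6.trans h8).le h7.le,
        h ▸ TemporalGraph.Follows.occupies_dst hwj hf'j⟩
    have hadj1 := TemporalGraph.underlying_adj (hwj.1.adj_of_mem he'j)
    have hadj2 := TemporalGraph.underlying_adj (hwj.1.adj_of_mem hf'j)
    rw [hsrc', h3] at hadj2
    rw [h3] at hadj1
    have hd' : f'.dst = e'.src := hG.eq_of_adj hadj hadj2 hadj1.symm h10 h9
    obtain ⟨p, σ, hp, h11, h12, v, hv, q, hq⟩ :=
      ih _ (by rw [← hm]; simp only [Fin.lt_def] at *; omega) hg hd' rfl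
    refine ⟨p, σ, hp, h6.trans h11, h12.trans h7, v, hv,
      SimpleGraph.Walk.cons hadj.symm (q.copy h3 rfl), ?_⟩
    have hlt : waiting W e.time f.time < waiting W e'.time f'.time := by
      refine Finset.card_lt_card ⟨fun l hl => ?_, fun hs => ?_⟩
      · simp only [Finset.mem_filter, Finset.mem_univ, true_and] at hl ⊢
        obtain ⟨x, y, hxy, hx, hy⟩ := hl
        exact ⟨x, y, hxy, hx.trans h6.le, h7.le.trans hy⟩
      · have := @hs j (by
          simp only [Finset.mem_filter, Finset.mem_univ, true_and]
          exact ⟨e', f', hg, le_rfl, le_rfl⟩)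
        simp only [Finset.mem_filter, Finset.mem_univ, true_and] at this
        obtain ⟨x, y, hxy, hx, hy⟩ := this
        exact hwj.not_between hxy he'j
          ⟨hx.trans_lt h6, (h8.trans h7).trans_le hy⟩
    simp only [SimpleGraph.Walk.length_cons, SimpleGraph.Walk.length_copy]
    omega

theorem isEndTime_unique {p : Fin I.k × Bool} {τ σ : Fin I.T} (h : IsEndTime W p τ)
    (h' : IsEndTime W p σ) : τ = σ := by
  unfold IsEndTime at h h'
  split_ifs at h h' <;>
  · obtain ⟨e, he, rfl⟩ := h
    obtain ⟨f, hf, rfl⟩ := h'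
    rw [Option.mem_unique he hf]

/-- In a minimal solution on a line, each walk has few direction changes. -/
theorem IsMinimalSolution.length_directionChanges_le (hG : I.graph.IsLine)
    (hW : I.IsMinimalSolution W) (i : Fin I.k) :
    (directionChanges (W i)).length ≤ 2 * I.k := by
  classical
  -- Without time steps all walks are empty, and there would be no default time for `τ` below.
  rcases Nat.eq_zero_or_pos I.T with hT | hT
  · cases h : W i with
    | nil => simp [directionChanges]
    | cons e _ => exact absurd e.time.2 (by omega)
  -- The events are the two ends of each walk. An empty walk has no end times; the default is
  -- harmless because only the total number `2 * k` of events matters.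
  let τ : Fin I.k × Bool → Fin I.T := fun p =>
    if h : ∃ σ, IsEndTime W p σ then h.choose else ⟨0, hT⟩
  have hτ : ∀ p σ, IsEndTime W p σ → τ p = σ := fun p σ h => by
    have hex : ∃ σ, IsEndTime W p σ := ⟨σ, h⟩
    simp only [τ, dif_pos hex]
    exact isEndTime_unique hex.choose_spec h
  refine (_root_.length_directionChanges_le Finset.univ τ (hW.1.1 i).2 ?_).trans ?_
  · intro e f hef _ hd
    obtain ⟨p, σ, hp, h1, h2, -⟩ := hW.exists_isEndTime hG hef hd
    exact ⟨p, Finset.mem_univ p, by rwa [hτ p σ hp], by rwa [hτ p σ hp]⟩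
  · refine (Finset.card_filter_le _ _).trans ?_
    simp [mul_comm]

/-- In a minimal solution on a line, direction changes happen close to terminals. -/
theorem IsMinimalSolution.exists_walk_terminal (hG : I.graph.IsLine)
    (hW : I.IsMinimalSolution W) (i : Fin I.k) {b : Fin I.n} (hb : b ∈ directionChanges (W i)) :
    ∃ v ∈ I.terminals, ∃ q : I.graph.underlying.Walk b v, q.length ≤ I.k := by
  classical
  obtain ⟨e, f, hef, _, hd, rfl⟩ := mem_directionChanges.1 hb
  obtain ⟨-, -, -, -, -, v, hv, q, hq⟩ := hW.exists_isEndTime hG hef hd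
  refine ⟨v, hv, q, ?_⟩
  -- Walk `i` itself waits during its detour, which improves `k + 1` to `k`.
  have : 0 < waiting W e.time f.time := by
    refine Finset.card_pos.2 ⟨i, ?_⟩
    simp only [Finset.mem_filter, Finset.mem_univ, true_and]
    exact ⟨e, f, hef, le_rfl, le_rfl⟩
  omega

end TDWInstance

/-! ### Walks in terms of their sequences of vertices and times -/

section Schedules

variable {V : Type} {T : ℕ}

/-- The walk `W` visits the vertices `q 0, q 1, …`, and it moves from `q j` to `q (j + 1)` at
time `x j`. -/
def HasSchedule (W : List (Transition V T)) (q : ℕ → V) (x : ℕ → ℕ) : Prop :=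
  ∀ j (h : j < W.length), W[j].src = q j ∧ W[j].dst = q (j + 1) ∧ (W[j].time : ℕ) = x j

/-- The truncations treat all visits alike: visit `j` lasts from the move that enters it to the move
that leaves it. For the first visit `j - 1` falls back to the first move, and for the last visit the
minimum falls back to the last move, so that these two visits shrink to a single time. -/
theorem HasSchedule.occupies_iff {W : List (Transition V T)} {q : ℕ → V} {x : ℕ → ℕ}
    (h : HasSchedule W q x) {v : V} {τ : Fin T} :
    Occupies W v τ ↔ 0 < W.length ∧
      ∃ j ≤ W.length, q j = v ∧ x (j - 1) ≤ τ ∧ (τ : ℕ) ≤ x (min j (W.length - 1)) := by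
  constructor
  · rintro (⟨e, he, h1, h2⟩ | ⟨e, he, h1, h2⟩ | ⟨e, f, he, h1, h2, h3⟩)
    · rw [List.head?_eq_getElem?, Option.mem_def, List.getElem?_eq_some_iff] at he
      obtain ⟨h0, rfl⟩ := he
      obtain ⟨h4, -, h5⟩ := h 0 h0
      refine ⟨h0, 0, h0.le, h4.symm.trans h1, ?_, ?_⟩ <;> simp [h2, h5]
    · rw [List.getLast?_eq_getElem?, Option.mem_def, List.getElem?_eq_some_iff] at he
      obtain ⟨h0, rfl⟩ := he
      obtain ⟨-, h4, h5⟩ := h _ h0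
      have h6 : W.length - 1 + 1 = W.length := by omega
      rw [h6] at h4
      refine ⟨by omega, W.length, le_rfl, h4.symm.trans h1, ?_, ?_⟩ <;> simp [h2, h5]
    · obtain ⟨P, Q, rfl⟩ := List.pair_infix_iff.1 he
      obtain ⟨-, h4, h5⟩ := h P.length (by simp)
      obtain ⟨-, -, h6⟩ := h (P.length + 1) (by simp)
      simp only [List.getElem_append_right le_rfl, Nat.sub_self, List.getElem_cons_zero] at h4 h5
      rw [List.getElem_append_right (by omega)] at h6
      simp only [Nat.add_sub_cancel_left, List.getElem_cons_succ, List.getElem_cons_zero] at h6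
      refine ⟨by simp, P.length + 1, by simp, h4.symm.trans h1, ?_, ?_⟩
      · simpa [← h5] using h2
      · have : min (P.length + 1) ((P ++ e :: f :: Q).length - 1) = P.length + 1 := by
          simp
        rw [this, ← h6]
        exact h3
  · rintro ⟨h0, j, hj, rfl, h1, h2⟩
    rcases Nat.eq_zero_or_pos j with rfl | hj0
    · obtain ⟨h3, -, h5⟩ := h 0 h0
      refine Or.inl ⟨W[0], by simp [List.head?_eq_getElem?, h0], h3, ?_⟩
      simp at h1 h2
      exact Fin.ext (by omega)
    rcases hj.eq_or_lt with rfl | hj1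
    · obtain ⟨-, h4, h5⟩ := h (W.length - 1) (by omega)
      have h6 : W.length - 1 + 1 = W.length := by omega
      rw [h6] at h4
      refine Or.inr (Or.inl ⟨W[W.length - 1], ?_, h4, ?_⟩)
      · rw [List.getLast?_eq_getElem?, Option.mem_def, List.getElem?_eq_getElem]
      · simp at h2
        exact Fin.ext (by omega)
    · obtain ⟨-, h4, h5⟩ := h (j - 1) (by omega)
      obtain ⟨-, -, h6⟩ := h j hj1
      have h7 : j - 1 + 1 = j := by omega
      rw [h7] at h4
      have h8 : min j (W.length - 1) = j := by omega
      rw [h8] at h2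
      refine Or.inr (Or.inr ⟨W[j - 1], W[j], ?_, h4, ?_, ?_⟩)
      · refine ⟨W.take (j - 1), W.drop (j + 1), ?_⟩
        have h9 : W.drop (j - 1) = W[j - 1] :: W[j] :: W.drop (j + 1) := by
          rw [List.drop_eq_getElem_cons (by omega)]
          congr 1
          rw [h7, List.drop_eq_getElem_cons hj1]
        conv_rhs => rw [← List.take_append_drop (j - 1) W, h9]
        simp
      · exact Fin.le_def.2 (by omega)
      · exact Fin.le_def.2 (by omega)

theorem TemporalGraph.Follows.getElem {G : TemporalGraph V T} {s z : V}
    {W : List (Transition V T)} (h : G.Follows s z W) (j : ℕ) (hj : j < W.length) :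
    W[j].src = ((s :: W.map Transition.dst)[j]'(by simp; omega)) := by
  induction W generalizing s j with
  | nil => simp at hj
  | cons e W ih =>
    cases j with
    | zero => exact h.1
    | succ j => exact ih h.2.2 j (by simpa using hj)

theorem TemporalGraph.Follows.getLast {G : TemporalGraph V T} {s z : V}
    {W : List (Transition V T)} (h : G.Follows s z W) :
    (s :: W.map Transition.dst).getLast (by simp) = z := by
  induction W generalizing s with
  | nil => exact h
  | cons e W ih => simpa using ih h.2.2

theorem TemporalGraph.IsTemporalWalk.hasSchedule {G : TemporalGraph V T} {s z : V}
    {W : List (Transition V T)} (h : G.IsTemporalWalk s z W) :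
    HasSchedule W (fun j => (s :: W.map Transition.dst).getD j s)
      (fun j => (W.map fun e => (e.time : ℕ)).getD j 0) := by
  intro j hj
  refine ⟨?_, ?_, ?_⟩
  · rw [h.1.getElem j hj]
    exact (List.getD_eq_getElem _ _ _).symm
  · simp [hj]
  · simp [hj]

theorem HasSchedule.lt {G : TemporalGraph V T} {s z : V} {W : List (Transition V T)}
    {q : ℕ → V} {x : ℕ → ℕ} (h : HasSchedule W q x) (hW : G.IsTemporalWalk s z W) {i j : ℕ}
    (hij : i < j) (hj : j < W.length) : x i < x j := by
  have := (List.pairwise_iff_getElem.1 hW.2) i j (hij.trans hj) hj hij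
  rw [Fin.lt_def, (h i _).2.2, (h j _).2.2] at this
  exact this

theorem HasSchedule.le {G : TemporalGraph V T} {s z : V} {W : List (Transition V T)}
    {q : ℕ → V} {x : ℕ → ℕ} (h : HasSchedule W q x) (hW : G.IsTemporalWalk s z W) {i j : ℕ}
    (hij : i ≤ j) (hj : j < W.length) : x i ≤ x j := by
  rcases hij.eq_or_lt with rfl | hij
  · exact le_rfl
  · exact (h.lt hW hij hj).le

end Schedules

/-! ### Greedy simulation of prescribed routes -/

/-- Adjacency in the layers, for vertices and times given as natural numbers. -/
def TDWInstance.NatAdj (I : TDWInstance) (t u v : ℕ) : Prop :=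
  ∃ (ht : t < I.T) (hu : u < I.n) (hv : v < I.n), (I.graph.layer ⟨t, ht⟩).Adj ⟨u, hu⟩ ⟨v, hv⟩

/-- Routes for several walks: the `i`-th walk makes the visits `first i, …, last i`, the visit
`y` takes place at `vertex y`, and if `blocks y y'` then the visit `y'` has to wait until the
visit `y` is over. -/
structure RoutePlan where
  vertex : ℕ → ℕ
  first : ℕ → ℕ
  last : ℕ → ℕ
  blocks : ℕ → ℕ → Prop

namespace RoutePlan

variable (P : RoutePlan) (I : TDWInstance)

/-- Whether the `i`-th walk can make its next move at time `t`. -/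
def CanMove (cur : ℕ → ℕ) (t i : ℕ) : Prop :=
  cur i < P.last i ∧ I.NatAdj t (P.vertex (cur i)) (P.vertex (cur i + 1)) ∧
    ∀ i' < I.k, i' ≠ i → cur i' < P.last i' → ∀ y, cur i' ≤ y → y ≤ P.last i' →
      ¬ P.blocks y (cur i) ∧ ¬ P.blocks y (cur i + 1)

open Classical in
/-- The visits that the walks have reached before time `t`, if they move as early as possible. -/
noncomputable def pos : ℕ → ℕ → ℕ
  | 0, i => P.first i
  | t + 1, i => if P.CanMove I (pos t) t i then pos t i + 1 else pos t i

variable {P I}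

theorem pos_succ_of_canMove {t i : ℕ} (h : P.CanMove I (P.pos I t) t i) :
    P.pos I (t + 1) i = P.pos I t i + 1 := by
  rw [pos, if_pos h]

theorem pos_succ_of_not {t i : ℕ} (h : ¬ P.CanMove I (P.pos I t) t i) :
    P.pos I (t + 1) i = P.pos I t i := by
  rw [pos, if_neg h]

theorem pos_mono {s t i : ℕ} (h : s ≤ t) : P.pos I s i ≤ P.pos I t i := by
  induction t, h using Nat.le_induction with
  | base => exact le_rfl
  | succ t _ ih =>
    refine ih.trans ?_
    by_cases h : P.CanMove I (P.pos I t) t i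
    · rw [pos_succ_of_canMove h]; omega
    · rw [pos_succ_of_not h]

theorem pos_le_last {t i : ℕ} (h : P.first i ≤ P.last i) : P.pos I t i ≤ P.last i := by
  induction t with
  | zero => exact h
  | succ t ih =>
    by_cases h : P.CanMove I (P.pos I t) t i
    · rw [pos_succ_of_canMove h]; exact h.1
    · rwa [pos_succ_of_not h]

/-- A walk moves at most once per time step, so its moves have increasing times. The schedule is
kept together with the fact that each move was permitted, from which disjointness is derived later.
-/
theorem exists_walk (hR : ∀ y, P.vertex y < I.n) (i t : ℕ) :
    ∃ W : List (Transition (Fin I.n) I.T),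
      I.graph.IsTemporalWalk ⟨P.vertex (P.first i), hR _⟩ ⟨P.vertex (P.pos I t i), hR _⟩ W ∧
      P.first i + W.length = P.pos I t i ∧ (∀ e ∈ W, (e.time : ℕ) < t) ∧
      ∃ x, HasSchedule W (fun j => ⟨P.vertex (P.first i + j), hR _⟩) x ∧
        ∀ j < W.length, P.pos I (x j) i = P.first i + j ∧ P.CanMove I (P.pos I (x j)) (x j) i := by
  induction t with
  | zero =>
    refine ⟨[], ⟨rfl, List.Pairwise.nil⟩, rfl, by simp, fun _ => 0, ?_, ?_⟩
    · intro j hj; simp at hj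
    · intro j hj; simp at hj
  | succ t ih =>
    obtain ⟨W, h1, h2, h3, x, h4, h5⟩ := ih
    by_cases h : P.CanMove I (P.pos I t) t i
    · obtain ⟨ht, hu, hv, hadj⟩ := h.2.1
      refine ⟨W ++ [⟨⟨_, hu⟩, ⟨_, hv⟩, ⟨t, ht⟩⟩], ⟨?_, ?_⟩, ?_, ?_,
        fun j => if j < W.length then x j else t, ?_, ?_⟩
      · rw [TemporalGraph.follows_concat]
        exact ⟨h1.1, hadj, Fin.ext (by rw [pos_succ_of_canMove h])⟩
      · rw [List.pairwise_append]
        refine ⟨h1.2, List.pairwise_singleton _ _, fun e he f hf => ?_⟩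
        rw [List.mem_singleton] at hf
        subst hf
        exact Fin.lt_def.2 (h3 e he)
      · rw [pos_succ_of_canMove h, List.length_append, List.length_singleton]; omega
      · intro e he
        rw [List.mem_append, List.mem_singleton] at he
        rcases he with he | rfl
        · exact (h3 e he).trans (Nat.lt_succ_self t)
        · exact Nat.lt_succ_self t
      · intro j hj
        rcases Nat.lt_or_ge j W.length with hj' | hj'
        · rw [List.getElem_append_left hj']
          simpa only [if_pos hj'] using h4 j hj'
        · have : j = W.length := by simp at hj; omega
          subst this
          simp [h2, ← add_assoc]
      · intro j hj
        dsimp only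
        rcases Nat.lt_or_ge j W.length with hj' | hj'
        · rw [if_pos hj']
          exact h5 j hj'
        · have : j = W.length := by simp at hj; omega
          subst this
          simp only [lt_irrefl, if_false]
          exact ⟨h2.symm, h⟩
    · refine ⟨W, ?_, ?_, fun e he => (h3 e he).trans (Nat.lt_succ_self t), x, h4, h5⟩
      · simp only [pos_succ_of_not h]
        exact h1
      · rw [h2, pos_succ_of_not h]

/-- If all walks reach the ends of their routes, then there is a solution. -/
theorem exists_isSolution (hR : ∀ y, P.vertex y < I.n)
    (hsource : ∀ i : Fin I.k, P.vertex (P.first i) = I.source i)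
    (hsink : ∀ i : Fin I.k, P.vertex (P.last i) = I.sink i)
    (htotal : ∀ y y', P.vertex y = P.vertex y' → P.blocks y y' ∨ P.blocks y' y)
    (hpos : ∀ i < I.k, P.pos I I.T i = P.last i) :
    ∃ W, I.IsSolution W := by
  choose W h1 h2 _ x h3 h4 using fun i : Fin I.k => exists_walk (I := I) hR (i : ℕ) I.T
  refine ⟨W, fun i => ?_, ?_⟩
  · have e1 : I.source i = ⟨P.vertex (P.first i), hR _⟩ := Fin.ext (hsource i).symm
    have e2 : I.sink i = ⟨P.vertex (P.pos I I.T i), hR _⟩ :=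
      Fin.ext (by simp only [hpos i i.2, hsink i])
    rw [e1, e2]
    exact h1 i
  -- Visit `j` of walk `i` begins with the move at time `x i (j - 1)`. If visit `j'` of walk `i'` is
  -- not over by then, this walk is still under way and `j'` is among its remaining visits, so
  -- `CanMove` excludes that it blocks.
  · have key : ∀ i i' : Fin I.k, i ≠ i' → ∀ (τ : Fin I.T) (j j' : ℕ), 0 < (W i).length →
        0 < (W i').length → j ≤ (W i).length → j' ≤ (W i').length →
        x i (j - 1) ≤ τ → (τ : ℕ) ≤ x i' (min j' ((W i').length - 1)) →
        ¬ P.blocks (P.first i' + j') (P.first i + j) := by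
      intro i i' hii τ j j' h5 h6 hj hj' h7 h8 hb
      obtain ⟨h9, -, -, h10⟩ := h4 i (j - 1) (by omega)
      have h11 := (h4 i' (min j' ((W i').length - 1)) (by omega)).1
      have h12 : P.pos I (x i (j - 1)) i' ≤ _ := pos_mono (h7.trans h8)
      rw [h11] at h12
      have h13 := h2 i'
      rw [hpos i' i'.2] at h13
      obtain ⟨h14, h15⟩ := h10 i' i'.2 (fun h => hii (Fin.ext h).symm) (by omega)
        (P.first i' + j') (by omega) (by omega)
      rw [h9] at h14 h15
      -- The first visit is the origin of a move and every other visit is the target of one; this is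
      -- why `CanMove` tests both ends.
      rcases Nat.eq_zero_or_pos j with rfl | hj0
      · exact h14 hb
      · apply h15
        convert hb using 1
        omega
    rintro i i' hii v τ ⟨ho, ho'⟩
    obtain ⟨h5, j, hj, hjv, h6, h7⟩ := (h3 i).occupies_iff.1 ho
    obtain ⟨h5', j', hj', hjv', h6', h7'⟩ := (h3 i').occupies_iff.1 ho'
    have hv : P.vertex (P.first i + j) = P.vertex (P.first i' + j') := by
      have := hjv.trans hjv'.symm
      simpa using this
    rcases htotal _ _ hv with hb | hb
    · exact key i' i hii.symm τ j' j h5' h5 hj' hj h6' h7 hb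
    · exact key i i' hii τ j j' h5 h5' hj hj' h6 h7' hb

/-- If the routes and the order of the visits are those of a solution, then all walks reach the
ends of their routes. -/
theorem pos_eq_last {W : Fin I.k → List (Transition (Fin I.n) I.T)} (hW : I.IsSolution W)
    {q : Fin I.k → ℕ → Fin I.n} {x : Fin I.k → ℕ → ℕ} (hx : ∀ i, HasSchedule (W i) (q i) (x i))
    (hlast : ∀ i : Fin I.k, P.last i = P.first i + (W i).length)
    (hvertex : ∀ (i : Fin I.k), ∀ j ≤ (W i).length, P.vertex (P.first i + j) = q i j)
    (hblocks : ∀ i i' : Fin I.k, i' ≠ i → 0 < (W i).length → 0 < (W i').length →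
      ∀ j ≤ (W i).length, ∀ j' ≤ (W i').length, P.blocks (P.first i' + j') (P.first i + j) →
        x i' (min j' ((W i').length - 1)) < x i (j - 1)) (i : Fin I.k) :
    P.pos I I.T i = P.last i := by
  -- The greedy walks are never behind the solution, by induction on time.
  have key : ∀ t, ∀ i : Fin I.k, ∀ j < (W i).length, x i j < t →
      P.first i + j < P.pos I t i := by
    intro t
    induction t with
    | zero => intro i j _ h; omega
    | succ t ih =>
      intro i j hj hjt
      rcases Nat.lt_or_ge (x i j) t with h1 | h1
      · exact (ih i j hj h1).trans_le (pos_mono (Nat.le_succ t))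
      have hxt : x i j = t := by omega
      have h2 : P.first i + j ≤ P.pos I t i := by
        rcases Nat.eq_zero_or_pos j with rfl | hj0
        · exact pos_mono (Nat.zero_le t)
        · have := ih i (j - 1) (by omega)
            (by rw [← hxt]; exact (hx i).lt (hW.1 i) (by omega) hj)
          omega
      rcases h2.eq_or_lt with h2 | h2
      · have hcan : P.CanMove I (P.pos I t) t i := by
          refine ⟨by rw [← h2, hlast]; omega, ?_, ?_⟩
          · obtain ⟨h3, h4, h5⟩ := hx i j hj
            have h6 := (hW.1 i).1.adj_of_mem (List.getElem_mem hj)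
            rw [← h2, add_assoc, hvertex i j hj.le, hvertex i (j + 1) hj]
            refine ⟨by rw [← hxt, ← h5]; exact Fin.isLt _, Fin.isLt _, Fin.isLt _, ?_⟩
            rw [h3, h4] at h6
            convert h6 using 2
            exact Fin.ext (hxt.symm.trans h5.symm)
          · intro i' hi' hne hlt y hy1 hy2
            have h3 := hlast ⟨i', hi'⟩
            have hf : P.first i' ≤ P.pos I t i' := pos_mono (Nat.zero_le t)
            obtain ⟨j', rfl⟩ := Nat.exists_eq_add_of_le (hf.trans hy1)
            dsimp only at h3
            -- Suppose that visit `j'` of walk `i'` blocks. In the solution this visit is over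
            -- before walk `i` enters its visit `m`, hence before time `t`. By induction the greedy
            -- walk `i'` has then either passed visit `j'` or, if `j'` is its last visit, arrived;
            -- both contradict the choice of `i'` and `j'`.
            have main : ∀ m, m - 1 ≤ j → m ≤ (W i).length →
                ¬ P.blocks (P.first i' + j') (P.first i + m) := by
              intro m hm hm' hb
              have h4 := hblocks i ⟨i', hi'⟩ (fun h => hne (by rw [← h]))
                (by omega) (by omega) m hm'
                j' (by omega) hb
              have h5 := (hx i).le (hW.1 i) hm hj
              have h6 := ih ⟨i', hi'⟩ _ (by omega) (h4.trans_le (h5.trans hxt.le))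
              dsimp only at h6
              omega
            rw [← h2]
            exact ⟨main j (by omega) hj.le, main (j + 1) (by omega) hj⟩
        rw [pos_succ_of_canMove hcan]
        omega
      · exact h2.trans_le (pos_mono (Nat.le_succ t))
  refine le_antisymm (pos_le_last (by rw [hlast]; omega)) ?_
  rw [hlast]
  rcases Nat.eq_zero_or_pos (W i).length with h | h
  · rw [h]
    exact pos_mono (Nat.zero_le _)
  · have := key I.T i ((W i).length - 1) (by omega) (by
      rw [← (hx i _ (by omega)).2.2]
      exact Fin.isLt _)
    omega

end RoutePlan

/-! ### Routes on a line that are given by waypoints -/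

/-- One step from position `p` towards position `w`. -/
def stepTo (w p : ℕ) : ℕ := if p < w then p + 1 else if w < p then p - 1 else p

/-- The positions that are visited on the way from `p` to `w`, excluding `p`, for a walk that
makes at most `fuel` steps. -/
def legPositions (w : ℕ) : ℕ → ℕ → List ℕ
  | 0, _ => []
  | fuel + 1, p => if p = w then [] else stepTo w p :: legPositions w fuel (stepTo w p)

/-- The positions that are visited on a route that starts at `p` and goes straight from one
waypoint to the next; the leg to the `i`-th waypoint has the number `c + i`. -/
def routeVisits (fuel : ℕ) : List ℕ → ℕ → ℕ → List (ℕ × ℕ)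
  | [], _, _ => []
  | w :: ws, c, p =>
    (legPositions w fuel p).map (·, c) ++ routeVisits fuel ws (c + 1) ((stepTo w)^[fuel] p)

/-- The entries `b` of a list that stand between two equal entries. -/
def turns : List ℕ → List ℕ
  | a :: b :: c :: l => if a = c then b :: turns (b :: c :: l) else turns (b :: c :: l)
  | _ => []

/-- Any two consecutive steps on the same leg go in the same direction. -/
def UniformSteps : List (ℕ × ℕ) → Prop
  | a :: b :: c :: l =>
    (a.2 = b.2 → b.2 = c.2 → a.1 + c.1 = 2 * b.1) ∧ UniformSteps (b :: c :: l)
  | _ => True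

theorem stepTo_self (w : ℕ) : stepTo w w = w := by simp [stepTo]

theorem legPositions_self (w fuel : ℕ) : legPositions w fuel w = [] := by
  cases fuel <;> simp [legPositions]

/-- The walk stops at `w`, so fuel beyond the distance has no effect. All positions are below `n`,
so fuel `n` always suffices, and it can serve as a fixed number of loop iterations. -/
theorem legPositions_succ_fuel {w p fuel : ℕ} (h1 : w ≤ p + fuel) (h2 : p ≤ w + fuel) :
    legPositions w (fuel + 1) p = legPositions w fuel p := by
  induction fuel generalizing p with
  | zero =>
    obtain rfl : p = w := by omega
    simp [legPositions]
  | succ fuel ih =>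
    rcases eq_or_ne p w with rfl | h
    · rw [legPositions_self, legPositions_self]
    · have e (f : ℕ) : legPositions w (f + 1) p = stepTo w p :: legPositions w f (stepTo w p) := by
        rw [legPositions, if_neg h]
      rw [e, e, ih] <;> · unfold stepTo; split_ifs <;> omega

theorem legPositions_eq_cons {w p fuel : ℕ} (h : p ≠ w) (h1 : w ≤ p + fuel) (h2 : p ≤ w + fuel) :
    legPositions w fuel p = stepTo w p :: legPositions w fuel (stepTo w p) := by
  cases fuel with
  | zero => omega
  | succ fuel =>
    rw [legPositions_succ_fuel (p := stepTo w p), legPositions, if_neg h] <;>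
    · unfold stepTo; split_ifs <;> omega

theorem iterate_stepTo {w p fuel : ℕ} (h1 : w ≤ p + fuel) (h2 : p ≤ w + fuel) :
    (stepTo w)^[fuel] p = w := by
  induction fuel generalizing p with
  | zero => simp; omega
  | succ fuel ih =>
    rw [Function.iterate_succ_apply, ih] <;> · unfold stepTo; split_ifs <;> omega

/-- Repetitions of the final waypoint add no visits. They pad the waypoints of every walk to the
same number. -/
theorem routeVisits_replicate (fuel m c w : ℕ) :
    routeVisits fuel (List.replicate m w) c w = [] := by
  induction m generalizing c with
  | zero => rfl
  | succ m ih =>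
    have : (stepTo w)^[fuel] w = w := Function.iterate_fixed (stepTo_self w) _
    rw [List.replicate_succ, routeVisits, legPositions_self, this, ih]
    rfl

theorem cls_mem_routeVisits {fuel : ℕ} {ws : List ℕ} {c p : ℕ} {v : ℕ × ℕ}
    (h : v ∈ routeVisits fuel ws c p) : c ≤ v.2 ∧ v.2 < c + ws.length := by
  induction ws generalizing c p with
  | nil => simp [routeVisits] at h
  | cons w ws ih =>
    rw [routeVisits, List.mem_append, List.mem_map] at h
    rcases h with ⟨x, -, rfl⟩ | h
    · simp
    · have := ih h
      simp only [List.length_cons]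
      omega

theorem pairwise_routeVisits (fuel : ℕ) (ws : List ℕ) (c p : ℕ) :
    (routeVisits fuel ws c p).Pairwise fun v v' => v.2 ≤ v'.2 := by
  induction ws generalizing c p with
  | nil => simp [routeVisits]
  | cons w ws ih =>
    rw [routeVisits, List.pairwise_append]
    refine ⟨?_, ih _ _, ?_⟩
    · rw [List.pairwise_map]
      exact List.pairwise_of_forall fun _ _ => le_rfl
    · intro v hv v' hv'
      rw [List.mem_map] at hv
      obtain ⟨x, -, rfl⟩ := hv
      have := (cls_mem_routeVisits hv').1
      dsimp only
      omega

theorem UniformSteps.cons_of_ne {a b : ℕ × ℕ} {l : List (ℕ × ℕ)} (h : UniformSteps (b :: l))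
    (hl : ∀ c ∈ l.head?, a.2 = b.2 → b.2 = c.2 → a.1 + c.1 = 2 * b.1) :
    UniformSteps (a :: b :: l) := by
  cases l with
  | nil => trivial
  | cons c l => exact ⟨hl c (by simp), h⟩

/-- Only three visits with equal labels are constrained, so the first label may change if the second
visit is on another leg. At a turn, the turning vertex is thereby moved from the leg that it opens
to the leg that it closes. -/
theorem UniformSteps.congr_head {a a' : ℕ × ℕ} {l : List (ℕ × ℕ)} (h : UniformSteps (a :: l))
    (ha : ∀ b ∈ l.head?, a'.2 ≠ b.2) : UniformSteps (a' :: l) := by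
  match l, h, ha with
  | [], _, _ => trivial
  | [b], _, _ => trivial
  | b :: c :: l, h, ha => exact ⟨fun h' => absurd h' (ha b (by simp)), h.2⟩

/-- Every walk on a line is a route whose waypoints are the turning points and the end. -/
theorem exists_waypoints {n : ℕ} {z : ℕ} {l : List ℕ} {p : ℕ}
    (hchain : (p :: l).IsChain fun a b => a + 1 = b ∨ b + 1 = a)
    (hn : ∀ a ∈ p :: l, a < n) (hz : z ∈ l.getLast?) :
    ∃ w ws, (ws.length ≤ (turns (p :: l)).length) ∧
      (∀ w' ∈ w :: ws, w' < n ∧ (w' ∈ turns (p :: l) ∨ w' = z)) ∧ w ≠ p ∧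
      stepTo w p ∈ l.head? ∧
      ∀ c m, ∃ V, routeVisits n (w :: ws ++ List.replicate m z) c p = V ∧
        V.map Prod.fst = l ∧ UniformSteps ((p, c) :: V) ∧ ∀ v ∈ V.head?, v.2 = c := by
  induction l generalizing p with
  | nil => simp at hz
  | cons q l ih =>
    have hpn : p < n := hn p (by simp)
    have hqn : q < n := hn q (by simp)
    have hpq : p + 1 = q ∨ q + 1 = p := by
      cases l <;> · simp at hchain; tauto
    have hstep : stepTo q p = q := by unfold stepTo; split_ifs <;> omega
    cases l with
    | nil =>
      simp at hz
      subst hz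
      refine ⟨q, [], by simp, by simp [hqn], by omega, by simp [hstep], fun c m => ⟨_, rfl, ?_⟩⟩
      rw [List.cons_append, routeVisits, legPositions_eq_cons (by omega) (by omega) (by omega),
        hstep, legPositions_self, iterate_stepTo (by omega) (by omega), List.nil_append,
        routeVisits_replicate]
      simp [UniformSteps]
    | cons r l =>
      have hrn : r < n := hn r (by simp)
      obtain ⟨w, ws, h1, h2, h3, h4, h5⟩ := ih (p := q) (by
        rw [List.isChain_cons_cons] at hchain; exact hchain.2)
        (fun a ha => hn a (List.mem_cons_of_mem _ ha)) (by simpa using hz)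
      have hqr : q + 1 = r ∨ r + 1 = q := by
        rw [List.isChain_cons_cons, List.isChain_cons_cons] at hchain; exact hchain.2.1
      simp only [List.head?_cons, Option.mem_def, Option.some.injEq] at h4
      -- If the walk turns at `q`, then `q` is a new first waypoint and the numbers of all later
      -- legs grow by one. Otherwise the first leg of the tail is extended backwards to `p`.
      by_cases hpr : p = r
      · refine ⟨q, w :: ws, ?_, ?_, by omega, by simp [hstep], fun c m => ⟨_, rfl, ?_⟩⟩
        · rw [turns, if_pos hpr]
          simpa using h1
        · intro w' hw'
          rw [turns, if_pos hpr]
          rw [List.mem_cons] at hw'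
          rcases hw' with rfl | hw'
          · exact ⟨hqn, by simp⟩
          · have := h2 w' hw'
            exact ⟨this.1, this.2.imp_left (List.mem_cons_of_mem _)⟩
        · obtain ⟨V, hV, h6, h7, h8⟩ := h5 (c + 1) m
          rw [List.cons_append, routeVisits, legPositions_eq_cons (by omega) (by omega) (by omega),
            hstep, legPositions_self, iterate_stepTo (by omega) (by omega), hV]
          refine ⟨by simp [h6], ?_, by simp⟩
          refine (h7.congr_head (a' := (q, c)) fun b hb => ?_).cons_of_ne fun b hb => ?_
          · have := h8 b hb
            dsimp only
            omega
          · have : b.2 = c + 1 := h8 b hb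
            dsimp only
            omega
      · have hwn := (h2 w (by simp)).1
        -- The step from `q` towards `w` leads to `r`, away from `p`; so `w` lies beyond `q` as seen
        -- from `p`.
        have hdir : w ≠ p ∧ stepTo w p = q := by
          revert h4
          unfold stepTo
          split_ifs <;> omega
        refine ⟨w, ws, ?_, ?_, hdir.1, by simp [hdir.2], fun c m => ⟨_, rfl, ?_⟩⟩
        · rwa [turns, if_neg hpr]
        · rwa [turns, if_neg hpr]
        · obtain ⟨V, hV, h6, h7, h8⟩ := h5 c m
          rw [List.cons_append, routeVisits, iterate_stepTo (by omega) (by omega)] at hV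
          rw [List.cons_append, routeVisits, iterate_stepTo (by omega) (by omega),
            legPositions_eq_cons hdir.1.symm (by omega) (by omega), hdir.2, List.map_cons,
            List.cons_append,
            hV]
          refine ⟨by simp [h6], ?_, by simp⟩
          refine h7.cons_of_ne fun b hb _ _ => ?_
          have : b.1 = r := by
            cases V with
            | nil => simp at hb
            | cons v V => simp at hb h6; rw [← hb, h6.1]
          dsimp only
          omega

/-! ### Stretches of a walk without direction change -/

/-- The position on the way from `a` to `b` after `m` steps. -/
def posBetween (a b m : ℕ) : ℕ := if a ≤ b then a + m else a - m

/-- Leg numbers never decrease, so they are constant between two equal ones. On a single leg no step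
reverses the preceding one, hence the direction of the first step persists. -/
theorem monotone_stretch {pos cls : ℕ → ℕ} {len a d : ℕ}
    (hstep : ∀ j < len, pos j + 1 = pos (j + 1) ∨ pos (j + 1) + 1 = pos j)
    (hcls : ∀ j < len, cls j ≤ cls (j + 1))
    (huni : ∀ j, j + 1 < len → cls j = cls (j + 1) → cls (j + 1) = cls (j + 2) →
      pos j + pos (j + 2) = 2 * pos (j + 1))
    (had : a + d ≤ len) (h : cls a = cls (a + d)) :
    (∀ m ≤ d, pos (a + m) = pos a + m) ∨ (∀ m ≤ d, pos (a + m) + m = pos a) := by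
  have hmono : ∀ i j, i ≤ j → j ≤ len → cls i ≤ cls j := by
    intro i j hij
    induction j, hij using Nat.le_induction with
    | base => exact fun _ => le_rfl
    | succ j _ ih => exact fun hj => (ih (by omega)).trans (hcls j hj)
  have hconst : ∀ m ≤ d, cls (a + m) = cls a := fun m hm =>
    le_antisymm (h ▸ hmono _ _ (by omega) had) (hmono _ _ (by omega) (by omega))
  induction d with
  | zero => left; intro m hm; simp [Nat.le_zero.1 hm]
  | succ d ih =>
    have ih := ih (by omega) (hconst d (by omega)).symm fun m hm => hconst m (by omega)
    have h1 := hstep (a + d) (by omega)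
    rcases Nat.eq_zero_or_pos d with rfl | hd
    · rcases h1 with h1 | h1
      · left
        intro m hm
        obtain rfl | rfl : m = 0 ∨ m = 1 := by omega
        · rfl
        · exact h1.symm
      · right
        intro m hm
        obtain rfl | rfl : m = 0 ∨ m = 1 := by omega
        · rfl
        · exact h1
    · have h2 := huni (a + (d - 1)) (by omega)
        (by rw [hconst _ (by omega), add_assoc, hconst _ (by omega)])
        (by rw [add_assoc, hconst _ (by omega), add_assoc, hconst _ (by omega)])
      have e1 : a + (d - 1) + 1 = a + d := by omega
      have e2 : a + (d - 1) + 2 = a + (d + 1) := by omega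
      rw [e1, e2] at h2
      refine ih.imp (fun ih m hm => ?_) (fun ih m hm => ?_)
      · rcases hm.eq_or_lt with rfl | hm
        · have := ih d le_rfl
          have := ih (d - 1) (by omega)
          omega
        · exact ih m (by omega)
      · rcases hm.eq_or_lt with rfl | hm
        · have := ih d le_rfl
          have := ih (d - 1) (by omega)
          omega
        · exact ih m (by omega)

/-- Between two visits on the same leg, there is exactly one visit for each position in
between. -/
theorem exists_visits_between {pos cls : ℕ → ℕ} {len a b : ℕ}
    (hstep : ∀ j < len, pos j + 1 = pos (j + 1) ∨ pos (j + 1) + 1 = pos j)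
    (hcls : ∀ j < len, cls j ≤ cls (j + 1))
    (huni : ∀ j, j + 1 < len → cls j = cls (j + 1) → cls (j + 1) = cls (j + 2) →
      pos j + pos (j + 2) = 2 * pos (j + 1))
    (ha : a ≤ len) (hb : b ≤ len) (h : cls a = cls b) :
    ∃ α : ℕ → ℕ, α 0 = a ∧ α (pos b - pos a + (pos a - pos b)) = b ∧
      ∀ m ≤ pos b - pos a + (pos a - pos b), α m ≤ len ∧
        pos (α m) = posBetween (pos a) (pos b) m ∧
        (m < pos b - pos a + (pos a - pos b) → α (m + 1) = α m + 1 ∨ α m = α (m + 1) + 1) := by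
  unfold posBetween
  rcases le_total a b with hab | hab
  · obtain ⟨d, rfl⟩ := Nat.exists_eq_add_of_le hab
    rcases monotone_stretch hstep hcls huni hb h with h1 | h1
    · have h2 := h1 d le_rfl
      refine ⟨fun m => a + m, rfl, by dsimp only; omega, fun m hm =>
        ⟨by dsimp only; omega, ?_, by dsimp only; omega⟩⟩
      rw [if_pos (by omega), h1 m (by omega)]
    · have h2 := h1 d le_rfl
      refine ⟨fun m => a + m, rfl, by dsimp only; omega, fun m hm =>
        ⟨by dsimp only; omega, ?_, by dsimp only; omega⟩⟩
      have := h1 m (by omega)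
      dsimp only
      split_ifs <;> omega
  · obtain ⟨d, rfl⟩ := Nat.exists_eq_add_of_le hab
    rcases monotone_stretch hstep hcls huni ha h.symm with h1 | h1
    · have h2 := h1 d le_rfl
      refine ⟨fun m => b + d - m, rfl, by dsimp only; omega,
        fun m hm =>
        ⟨by dsimp only; omega, ?_, by dsimp only; omega⟩⟩
      have := h1 (d - m) (by omega)
      have e : b + d - m = b + (d - m) := by omega
      dsimp only
      rw [e]
      split_ifs <;> omega
    · have h2 := h1 d le_rfl
      refine ⟨fun m => b + d - m, rfl, by dsimp only; omega,
        fun m hm =>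
        ⟨by dsimp only; omega, ?_, by dsimp only; omega⟩⟩
      have := h1 (d - m) (by omega)
      have e : b + d - m = b + (d - m) := by omega
      dsimp only
      rw [e]
      split_ifs <;> omega

/-- Two disjoint walks that traverse the same positions, in the same or in opposite directions,
do so in the same order at every position. -/
theorem order_propagates {len₁ len₂ : ℕ} {pos₁ pos₂ x₁ x₂ : ℕ → ℕ}
    (hx₁ : ∀ i j, i ≤ j → j < len₁ → x₁ i ≤ x₁ j) (hx₂ : ∀ i j, i ≤ j → j < len₂ → x₂ i ≤ x₂ j)
    (hdisj : ∀ a ≤ len₁, ∀ b ≤ len₂, pos₁ a = pos₂ b →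
      x₁ (min a (len₁ - 1)) < x₂ (b - 1) ∨ x₂ (min b (len₂ - 1)) < x₁ (a - 1))
    {α β : ℕ → ℕ} {d : ℕ} (hα : ∀ m ≤ d, α m ≤ len₁) (hβ : ∀ m ≤ d, β m ≤ len₂)
    (hα' : ∀ m < d, α (m + 1) = α m + 1 ∨ α m = α (m + 1) + 1)
    (hβ' : ∀ m < d, β (m + 1) = β m + 1 ∨ β m = β (m + 1) + 1)
    (hp : ∀ m ≤ d, pos₁ (α m) = pos₂ (β m))
    (h : x₁ (min (α 0) (len₁ - 1)) < x₂ (β 0 - 1)) :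
    x₁ (min (α d) (len₁ - 1)) < x₂ (β d - 1) := by
  induction d with
  | zero => exact h
  | succ d ih =>
    have ih := ih (fun m hm => hα m (by omega)) (fun m hm => hβ m (by omega))
      (fun m hm => hα' m (by omega)) (fun m hm => hβ' m (by omega)) (fun m hm => hp m (by omega))
    -- Suppose that the order flips between two neighbouring positions. A walk that goes forwards
    -- leaves the old position and enters the new one with the same move; a walk that goes backwards
    -- does the converse. For each of the four combinations of directions, the two strict
    -- inequalities and the monotonicity of the schedules contradict each other.
    refine (hdisj _ (hα _ le_rfl) _ (hβ _ le_rfl) (hp _ le_rfl)).resolve_right fun hcon => ?_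
    have h1 := hα d (by omega)
    have h2 := hα (d + 1) le_rfl
    have h3 := hβ d (by omega)
    have h4 := hβ (d + 1) le_rfl
    rcases hα' d (by omega) with ha | ha <;> rcases hβ' d (by omega) with hb | hb
    · have e1 : min (α d) (len₁ - 1) = α d := by omega
      have e2 : α (d + 1) - 1 = α d := by omega
      rw [e1] at ih
      rw [e2] at hcon
      have := hx₂ (β d - 1) (min (β (d + 1)) (len₂ - 1)) (by omega) (by omega)
      omega
    · have e1 : min (α d) (len₁ - 1) = α d := by omega
      have e2 : α (d + 1) - 1 = α d := by omega
      have e3 : min (β (d + 1)) (len₂ - 1) = β d - 1 := by omega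
      rw [e1] at ih
      rw [e2, e3] at hcon
      omega
    · have := hx₁ (α (d + 1) - 1) (min (α d) (len₁ - 1)) (by omega) (by omega)
      have := hx₂ (β d - 1) (min (β (d + 1)) (len₂ - 1)) (by omega) (by omega)
      omega
    · have := hx₁ (α (d + 1) - 1) (min (α d) (len₁ - 1)) (by omega) (by omega)
      have := hx₂ (β d - 1) (min (β (d + 1)) (len₂ - 1)) (by omega) (by omega)
      omega

/-! ### The routes of a minimal solution -/

theorem UniformSteps.getD {l : List (ℕ × ℕ)} (h : UniformSteps l) (d : ℕ × ℕ) {j : ℕ}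
    (hj : j + 2 < l.length) (h1 : (l.getD j d).2 = (l.getD (j + 1) d).2)
    (h2 : (l.getD (j + 1) d).2 = (l.getD (j + 2) d).2) :
    (l.getD j d).1 + (l.getD (j + 2) d).1 = 2 * (l.getD (j + 1) d).1 := by
  induction l generalizing j with
  | nil => simp at hj
  | cons a l ih =>
    match l, h, hj with
    | b :: c :: l, h, hj =>
      cases j with
      | zero => exact h.1 h1 h2
      | succ j => exact ih h.2 (by simpa using hj) h1 h2

section Positions

variable {n T : ℕ} {G : TemporalGraph (Fin n) T}
  (φ : G.underlying ≃g SimpleGraph.pathGraph n)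

theorem adj_position {t : Fin T} {a b : Fin n} (h : (G.layer t).Adj a b) :
    (φ a : ℕ) + 1 = φ b ∨ (φ b : ℕ) + 1 = φ a := by
  have := TemporalGraph.underlying_adj h
  rwa [← φ.map_adj_iff, SimpleGraph.pathGraph_adj] at this

theorem walk_position {a b : Fin n} (q : G.underlying.Walk a b) :
    (φ a : ℕ) ≤ φ b + q.length ∧ (φ b : ℕ) ≤ φ a + q.length := by
  induction q with
  | nil => simp
  | cons h q ih =>
    rw [← φ.map_adj_iff, SimpleGraph.pathGraph_adj] at h
    rw [SimpleGraph.Walk.length_cons]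
    omega

theorem turns_position {s z : Fin n} {W : List (Transition (Fin n) T)} (h : G.Follows s z W) :
    turns ((φ s : ℕ) :: W.map fun e => (φ e.dst : ℕ)) =
      (directionChanges W).map fun b => (φ b : ℕ) := by
  induction W generalizing s with
  | nil => rfl
  | cons e W ih =>
    cases W with
    | nil => rfl
    | cons f W =>
      have ih := ih h.2.2
      rw [directionChanges]
      simp only [List.map_cons] at ih ⊢
      rw [turns]
      have h1 : ((φ s : ℕ) = φ f.dst) ↔ (f.src = e.dst ∧ f.dst = e.src) := by
        rw [h.1, ← Fin.ext_iff, φ.injective.eq_iff]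
        exact ⟨fun h' => ⟨h.2.2.1, h'.symm⟩, fun h' => h'.2.symm⟩
      simp only [h1]
      split_ifs <;> simp [ih]

theorem isChain_position {s z : Fin n} {W : List (Transition (Fin n) T)}
    (h : G.Follows s z W) :
    ((φ s : ℕ) :: W.map fun e => (φ e.dst : ℕ)).IsChain fun a b => a + 1 = b ∨ b + 1 = a := by
  induction W generalizing s with
  | nil => simp
  | cons e W ih =>
    rw [List.map_cons, List.isChain_cons_cons]
    exact ⟨h.1 ▸ adj_position φ h.2.1, ih h.2.2⟩

/-- A walk on a line with few direction changes is a route with a given number of waypoints. -/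
theorem exists_route {s z : Fin n} {W : List (Transition (Fin n) T)} (h : G.Follows s z W)
    {A : ℕ} (hA : (directionChanges W).length < A) :
    ∃ ws : List ℕ, ws.length = A ∧
      (∀ w ∈ ws, w < n ∧ ((∃ b ∈ directionChanges W, (φ b : ℕ) = w) ∨ w = φ z)) ∧
      ∀ c, (routeVisits n ws c (φ s)).map Prod.fst = W.map (fun e => (φ e.dst : ℕ)) ∧
        UniformSteps (((φ s : ℕ), c) :: routeVisits n ws c (φ s)) := by
  cases W with
  | nil =>
    have : s = z := h
    subst this
    refine ⟨List.replicate A (φ s : ℕ), by simp, ?_, fun c => ?_⟩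
    · intro w hw
      rw [List.eq_of_mem_replicate hw]
      exact ⟨Fin.isLt _, Or.inr rfl⟩
    · rw [routeVisits_replicate]
      simp [UniformSteps]
  | cons e W =>
    have hlast : (φ z : ℕ) ∈ ((e :: W).map fun e => (φ e.dst : ℕ)).getLast? := by
      have h1 := h.getLast
      rw [List.getLast_cons (by simp)] at h1
      have h2 : ((e :: W).map fun e => (φ e.dst : ℕ)) =
          ((e :: W).map Transition.dst).map fun v => (φ v : ℕ) := by
        simp
      rw [Option.mem_def, h2, List.getLast?_map, List.getLast?_eq_some_getLast (by simp), h1]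
      rfl
    obtain ⟨w, ws, h1, h2, -, -, h3⟩ := exists_waypoints (isChain_position φ h)
      (n := n) (by
        intro a ha
        rw [List.mem_cons, List.mem_map] at ha
        rcases ha with rfl | ⟨x, -, rfl⟩ <;> exact Fin.isLt _) hlast
    rw [turns_position φ h] at h1 h2
    rw [List.length_map] at h1
    refine ⟨w :: ws ++ List.replicate (A - (ws.length + 1)) (φ z : ℕ), ?_, ?_, fun c => ?_⟩
    · simp; omega
    · intro w' hw'
      rw [List.mem_append] at hw'
      rcases hw' with hw' | hw'
      · obtain ⟨h4, h5⟩ := h2 w' hw'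
        exact ⟨h4, h5.imp_left fun h5 => by simpa using h5⟩
      · rw [List.eq_of_mem_replicate hw']
        exact ⟨Fin.isLt _, Or.inr rfl⟩
    · obtain ⟨V, rfl, h4, h5, -⟩ := h3 c (A - (ws.length + 1))
      exact ⟨h4, h5⟩

end Positions

/-- Two intervals either meet, and then they share the later of their two starting points, or one of
them ends before the other starts. -/
theorem TemporallyDisjoint.lt_or_lt {V : Type} {T : ℕ} {G : TemporalGraph V T}
    {s z s' z' : V} {W W' : List (Transition V T)} (hd : TemporallyDisjoint W W')
    (hW : G.IsTemporalWalk s z W) (hW' : G.IsTemporalWalk s' z' W')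
    {q q' : ℕ → V} {x x' : ℕ → ℕ} (hx : HasSchedule W q x) (hx' : HasSchedule W' q' x')
    (h0 : 0 < W.length) (h0' : 0 < W'.length) {a b : ℕ} (ha : a ≤ W.length)
    (hb : b ≤ W'.length) (hab : q a = q' b) :
    x (min a (W.length - 1)) < x' (b - 1) ∨ x' (min b (W'.length - 1)) < x (a - 1) := by
  by_contra hcon
  push Not at hcon
  have h1 := hx.le hW (i := a - 1) (j := min a (W.length - 1)) (by omega) (by omega)
  have h2 := hx'.le hW' (i := b - 1) (j := min b (W'.length - 1)) (by omega) (by omega)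
  have h3 : x (a - 1) < T := by
    rw [← (hx (a - 1) (by omega)).2.2]; exact Fin.isLt _
  have h4 : x' (b - 1) < T := by
    rw [← (hx' (b - 1) (by omega)).2.2]; exact Fin.isLt _
  refine hd (q a) ⟨max (x (a - 1)) (x' (b - 1)), max_lt h3 h4⟩
    ⟨hx.occupies_iff.2 ⟨h0, a, ha, rfl, le_max_left _ _, max_le h1 hcon.1⟩,
      hx'.occupies_iff.2 ⟨h0', b, hb, hab.symm, le_max_right _ _, max_le hcon.2 h2⟩⟩

/-- The visits of a route, as pairs of a vertex and the number of a leg; `ord p` is the vertex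
at position `p`. -/
def visitList (ord : ℕ → ℕ) (n s p : ℕ) (ws : List ℕ) (c : ℕ) : List (ℕ × ℕ) :=
  (s, c) :: (routeVisits n ws c p).map fun v => (ord v.1, v.2)

/-- With the waypoints `ws i` for the `i`-th walk, and if the order of two legs is given by
`bit`, all walks reach their sinks. -/
def TDWInstance.ReachSinks (I : TDWInstance)
    (φ : I.graph.underlying ≃g SimpleGraph.pathGraph I.n) (ws : Fin I.k → List ℕ)
    (bit : ℕ → ℕ → ℕ) : Prop :=
  ∀ ord : ℕ → ℕ, (∀ v, ord (φ v) = v) → ∀ (P : RoutePlan) (cls : ℕ → ℕ),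
    (∀ i : Fin I.k, ∀ V, V = visitList ord I.n (I.source i) (φ (I.source i)) (ws i)
        (i * (2 * I.k + 1)) →
      P.last i + 1 = P.first i + V.length ∧
      ∀ j < V.length, (P.vertex (P.first i + j), cls (P.first i + j)) = V.getD j (0, 0)) →
    (∀ y y', cls y < I.k * (2 * I.k + 1) → cls y' < I.k * (2 * I.k + 1) →
      P.blocks y y' → P.vertex y = P.vertex y' ∧
      bit (cls y) (cls y') ≤ bit (cls y') (cls y)) →
    ∀ i : Fin I.k, P.vertex (P.last i) = I.sink i ∧ P.pos I I.T i = P.last i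

/-- If there is a solution, then there are waypoints close to terminals and an order of the
legs for which all walks reach their sinks. -/
theorem TDWInstance.exists_waypoints_and_order (I : TDWInstance)
    (φ : I.graph.underlying ≃g SimpleGraph.pathGraph I.n) (hsol : ∃ W, I.IsSolution W) :
    ∃ (ws : Fin I.k → List ℕ) (bit : ℕ → ℕ → ℕ),
      (∀ i, (ws i).length = 2 * I.k + 1) ∧
      (∀ i, ∀ w ∈ ws i, ∃ v ∈ I.terminals, w ≤ φ v + I.k ∧ φ v ≤ w + I.k) ∧
      (∀ x y, bit x y ≤ 1) ∧ I.ReachSinks φ ws bit := by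
  classical
  obtain ⟨W, hW⟩ : ∃ W, I.IsMinimalSolution W := by
    have hex : ∃ m, ∃ W, I.IsSolution W ∧ I.totalLength W = m :=
      ⟨_, hsol.choose, hsol.choose_spec, rfl⟩
    obtain ⟨W, h1, h2⟩ := Nat.find_spec hex
    exact ⟨W, h1, fun W' h' => h2 ▸ Nat.find_min' hex ⟨W', h', rfl⟩⟩
  have hG : I.graph.IsLine := ⟨φ⟩
  have hwalk := hW.1.1
  -- At most `2 * k` turning points and the sink make `2 * k + 1` waypoints.
  choose ws hlen hws hroute using fun i => exists_route φ (hwalk i).1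
    (Nat.lt_succ_of_le (hW.length_directionChanges_le hG i))
  choose q x hx hq using fun i => show ∃ q x, HasSchedule (W i) q x ∧
      ∀ j ≤ (W i).length, ((I.source i :: (W i).map Transition.dst))[j]? = some (q j) from
    ⟨_, _, (hwalk i).hasSchedule, fun j hj => by
      rw [List.getD_eq_getElem?_getD, List.getElem?_eq_getElem (by simp; omega)]; rfl⟩
  -- The legs of walk `i` get numbers in a block of length `2 * k + 1`, so the number of a leg
  -- determines the walk (`hcl_inj`).
  let F : Fin I.k → List (ℕ × ℕ) := fun i =>
    ((φ (I.source i) : ℕ), (i : ℕ) * (2 * I.k + 1)) ::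
      routeVisits I.n (ws i) (i * (2 * I.k + 1)) (φ (I.source i))
  have hFlen : ∀ i, (F i).length = (W i).length + 1 := fun i => by
    have := congrArg List.length (hroute i (i * (2 * I.k + 1))).1
    simpa [F] using this
  let pos : Fin I.k → ℕ → ℕ := fun i j => ((F i).getD j (0, 0)).1
  let cl : Fin I.k → ℕ → ℕ := fun i j => ((F i).getD j (0, 0)).2
  have hpos : ∀ i, ∀ j ≤ (W i).length, pos i j = φ (q i j) := by
    intro i j hj
    have h1 : (F i).map Prod.fst =
        ((I.source i :: (W i).map Transition.dst)).map fun v => (φ v : ℕ) := by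
      simp only [F, List.map_cons, (hroute i _).1, List.map_map, Function.comp_def]
    have h2 := congrArg (fun l => l[j]?) h1
    simp only [List.getElem?_map, hq i j hj] at h2
    rw [List.getElem?_eq_getElem (by rw [hFlen]; omega)] at h2
    simp only [pos, List.getD_eq_getElem?_getD]
    rw [List.getElem?_eq_getElem (by rw [hFlen]; omega)]
    simpa using h2
  have hmemF : ∀ i, ∀ j ≤ (W i).length, (F i).getD j (0, 0) ∈ F i := by
    intro i j hj
    rw [List.getD_eq_getElem _ _ (by rw [hFlen]; omega)]
    exact List.getElem_mem _
  have hclF : ∀ i, ∀ v ∈ F i, (i : ℕ) * (2 * I.k + 1) ≤ v.2 ∧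
      v.2 < (i : ℕ) * (2 * I.k + 1) + (2 * I.k + 1) := by
    intro i v hv
    rw [List.mem_cons] at hv
    rcases hv with rfl | hv
    · simp
    · have := cls_mem_routeVisits hv
      rwa [hlen] at this
  have hcl_inj : ∀ i i' j j', j ≤ (W i).length → j' ≤ (W i').length → cl i j = cl i' j' →
      i = i' := by
    intro i i' j j' hj hj' h
    have h1 := hclF i _ (hmemF i j hj)
    have h2 := hclF i' _ (hmemF i' j' hj')
    change _ ≤ cl i j ∧ cl i j < _ at h1
    change _ ≤ cl i' j' ∧ cl i' j' < _ at h2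
    rw [h] at h1
    have h3 : (i : ℕ) < i' + 1 := by
      by_contra hc
      have := Nat.mul_le_mul_right (2 * I.k + 1) (not_lt.1 hc)
      rw [add_mul] at this
      omega
    have h4 : (i' : ℕ) < i + 1 := by
      by_contra hc
      have := Nat.mul_le_mul_right (2 * I.k + 1) (not_lt.1 hc)
      rw [add_mul] at this
      omega
    exact Fin.ext (by omega)
  have hstep : ∀ i, ∀ j < (W i).length, pos i j + 1 = pos i (j + 1) ∨
      pos i (j + 1) + 1 = pos i j := by
    intro i j hj
    rw [hpos i j hj.le, hpos i (j + 1) hj]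
    have h1 := (hwalk i).1.adj_of_mem (List.getElem_mem hj)
    rw [(hx i j hj).1, (hx i j hj).2.1] at h1
    exact adj_position φ h1
  have hcls : ∀ i, ∀ j < (W i).length, cl i j ≤ cl i (j + 1) := by
    intro i j hj
    have h1 : (F i).Pairwise fun v v' => v.2 ≤ v'.2 := by
      rw [List.pairwise_cons]
      exact ⟨fun v hv => (cls_mem_routeVisits hv).1, pairwise_routeVisits _ _ _ _⟩
    have h2 := (List.pairwise_iff_getElem.1 h1) j (j + 1) (by rw [hFlen]; omega)
      (by rw [hFlen]; omega) (Nat.lt_succ_self j)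
    simp only [cl]
    rwa [List.getD_eq_getElem _ _ (by rw [hFlen]; omega),
      List.getD_eq_getElem _ _ (by rw [hFlen]; omega)]
  have huni : ∀ i, ∀ j, j + 1 < (W i).length → cl i j = cl i (j + 1) →
      cl i (j + 1) = cl i (j + 2) → pos i j + pos i (j + 2) = 2 * pos i (j + 1) :=
    fun i j hj => (hroute i (i * (2 * I.k + 1))).2.getD (0, 0) (by
      have := hFlen i
      simp only [F] at this
      omega)
  -- It is enough to ask for one common vertex where leg `a` comes first, since by
  -- `order_propagates` the same then holds at all common vertices.
  let Prec : ℕ → ℕ → Prop := fun a b => ∃ i i' j j', i ≠ i' ∧ j ≤ (W i).length ∧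
    j' ≤ (W i').length ∧ 0 < (W i).length ∧ 0 < (W i').length ∧ cl i j = a ∧ cl i' j' = b ∧
    q i j = q i' j' ∧ x i (min j ((W i).length - 1)) < x i' (j' - 1)
  refine ⟨ws, fun a b => if Prec a b then 0 else 1, hlen, ?_, ?_, ?_⟩
  · intro i w hw
    obtain ⟨-, ⟨b, hb, rfl⟩ | rfl⟩ := hws i w hw
    · obtain ⟨v, hv, p, hp⟩ := hW.exists_walk_terminal hG i hb
      have := walk_position φ p
      exact ⟨v, hv, by omega, by omega⟩
    · exact ⟨I.sink i, Or.inr ⟨i, rfl⟩, by omega, by omega⟩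
  · intro a b
    dsimp only
    split_ifs <;> omega
  -- Nothing is assumed about the plan outside the listed visits, since it will be read off a memory
  -- with arbitrary contents elsewhere.
  intro ord hord P cls hP hblocks
  have hVF : ∀ i, ∀ j ≤ (W i).length, (visitList ord I.n (I.source i) (φ (I.source i)) (ws i)
      (i * (2 * I.k + 1))).getD j (0, 0) = ((q i j : ℕ), cl i j) := by
    intro i j hj
    have h1 : visitList ord I.n (I.source i) (φ (I.source i)) (ws i) (i * (2 * I.k + 1)) =
        (F i).map fun v => (ord v.1, v.2) := by
      simp only [visitList, F, List.map_cons, hord]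
    rw [h1, List.getD_eq_getElem _ _ (by rw [List.length_map, hFlen]; omega), List.getElem_map]
    have h2 := hpos i j hj
    simp only [pos, cl] at h2 ⊢
    rw [List.getD_eq_getElem _ _ (by rw [hFlen]; omega)] at h2 ⊢
    rw [h2, hord]
  have hVlen : ∀ i, (visitList ord I.n (I.source i) (φ (I.source i)) (ws i)
      (i * (2 * I.k + 1))).length = (W i).length + 1 := by
    intro i
    rw [← hFlen]
    simp [visitList, F]
  have hlast : ∀ i : Fin I.k, P.last i = P.first i + (W i).length := by
    intro i
    have := (hP i _ rfl).1
    rw [hVlen] at this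
    omega
  have hvisit : ∀ i : Fin I.k, ∀ j ≤ (W i).length, P.vertex (P.first i + j) = q i j ∧
      cls (P.first i + j) = cl i j := by
    intro i j hj
    have := (hP i _ rfl).2 j (by rw [hVlen]; omega)
    rw [hVF i j hj, Prod.mk.injEq] at this
    exact this
  intro i
  constructor
  · rw [hlast, (hvisit i _ le_rfl).1]
    have h1 := hq i _ le_rfl
    have h2 := (hwalk i).1.getLast
    rw [List.getLast_eq_getElem] at h2
    rw [← h2]
    rw [List.getElem?_eq_getElem (by simp)] at h1
    simp only [Option.some.injEq] at h1
    rw [← h1]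
    simp
  refine P.pos_eq_last hW.1 hx hlast (fun i j hj => (hvisit i j hj).1) ?_ i
  intro i i' hii h0 h0' j hj j' hj' hb
  have hclC : ∀ i : Fin I.k, ∀ j ≤ (W i).length,
      cls (P.first i + j) < I.k * (2 * I.k + 1) := by
    intro i j hj
    have h1 := (hclF i _ (hmemF i j hj)).2
    have h2 := Nat.mul_le_mul_right (2 * I.k + 1) (Nat.succ_le_of_lt i.2)
    rw [(hvisit i j hj).2]
    rw [Nat.succ_mul] at h2
    exact h1.trans_le h2
  obtain ⟨hb1, hb2⟩ := hblocks _ _ (hclC i' j' hj') (hclC i j hj) hb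
  rw [(hvisit i' j' hj').1, (hvisit i j hj).1] at hb1
  rw [(hvisit i' j' hj').2, (hvisit i j hj).2] at hb2
  have hb1 := Fin.ext hb1
  refine ((hW.1.2 i' i hii).lt_or_lt (hwalk i') (hwalk i) (hx i') (hx i) h0' h0 hj' hj
    hb1).elim id fun hlt => ?_
  -- In the remaining case `i` precedes `i'` at this vertex, so the bit for its leg against the
  -- other is `0`. As visit `j'` blocks visit `j`, the opposite bit is `0` too, and somewhere the
  -- leg of `i'` precedes that of `i`.
  have hprec : Prec (cl i' j') (cl i j) := by
    have : Prec (cl i j) (cl i' j') :=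
      ⟨i, i', j, j', hii.symm, hj, hj', h0, h0', rfl, rfl, hb1.symm, hlt⟩
    by_contra hc
    simp only [if_pos this, if_neg hc] at hb2
    omega
  obtain ⟨a, b, m', m, hab, hm', hm, -, -, h1, h2, h3, h4⟩ := hprec
  obtain rfl := hcl_inj _ _ _ _ hm' hj' h1
  obtain rfl := hcl_inj _ _ _ _ hm hj h2
  -- Both legs are followed from the vertex that witnesses `Prec` to the vertex in question, one
  -- position at a time.
  obtain ⟨α, hα0, hα1, hα⟩ := exists_visits_between (hstep a) (hcls a) (huni a) hm' hj' h1
  obtain ⟨β, hβ0, hβ1, hβ⟩ := exists_visits_between (hstep b) (hcls b) (huni b) hm hj h2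
  have e1 : pos a m' = pos b m := by rw [hpos a m' hm', hpos b m hm, h3]
  have e2 : pos a j' = pos b j := by rw [hpos a j' hj', hpos b j hj, hb1]
  rw [e1, e2] at hα hα1
  have := order_propagates (pos₁ := pos a) (pos₂ := pos b) (x₁ := x a) (x₂ := x b)
    (fun i j hij hj => (hx a).le (hwalk a) hij hj) (fun i j hij hj => (hx b).le (hwalk b) hij hj)
    (fun c hc d hd hcd => (hW.1.2 a b hii).lt_or_lt (hwalk a) (hwalk b) (hx a) (hx b) h0' h0 hc hd
      (φ.injective (Fin.ext (by rw [← hpos a c hc, ← hpos b d hd, hcd]))))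
    (fun m hm => (hα m hm).1) (fun m hm => (hβ m hm).1)
    (fun m hm => (hα m hm.le).2.2 hm) (fun m hm => (hβ m hm.le).2.2 hm)
    (fun m hm => by rw [(hα m hm).2.1, (hβ m hm).2.1])
    (by rw [hα0, hβ0]; exact h4)
  rwa [hα1, hβ1] at this

/-! ### Program logic for random access machines -/

namespace RAMProgram

/-- The arrays that a program writes to. -/
def targets : RAMProgram → List ℕ
  | skip => []
  | write a _ _ => [a]
  | seq p q => p.targets ++ q.targets
  | cond _ p q => p.targets ++ q.targets
  | loop _ p => p.targets

/-- A bound on the running time, if no loop is iterated more than `Y` times. -/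
def bound (Y : ℕ) : RAMProgram → ℕ
  | skip => 1
  | write _ i e => i.cost + e.cost + 1
  | seq p q => p.bound Y + q.bound Y
  | cond b p q => b.cost + 1 + (p.bound Y + q.bound Y)
  | loop b p => (Y + 1) * (b.cost + 1 + p.bound Y)

/-- The running time is polynomial in the number of iterations of the loops. -/
theorem exists_bound_le (p : RAMProgram) : ∃ c, ∀ Y, p.bound Y ≤ c * (Y + 1) ^ c := by
  have mono : ∀ {c d Y : ℕ}, c ≤ d → c * (Y + 1) ^ c ≤ d * (Y + 1) ^ d := fun h =>
    Nat.mul_le_mul h (Nat.pow_le_pow_right (Nat.succ_pos _) h)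
  have const : ∀ {c Y : ℕ}, c ≤ c * (Y + 1) ^ c := fun {c Y} =>
    Nat.le_mul_of_pos_right _ (pow_pos (Nat.succ_pos _) _)
  have add : ∀ {b c d Y : ℕ}, b + (c * (Y + 1) ^ c + d * (Y + 1) ^ d) ≤
      (b + c + d) * (Y + 1) ^ (b + c + d) := by
    intro b c d Y
    have h1 : b ≤ b * (Y + 1) ^ (b + c + d) :=
      Nat.le_mul_of_pos_right _ (pow_pos (Nat.succ_pos _) _)
    have h2 : c * (Y + 1) ^ c ≤ c * (Y + 1) ^ (b + c + d) :=
      Nat.mul_le_mul_left _ (Nat.pow_le_pow_right (Nat.succ_pos _) (by omega))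
    have h3 : d * (Y + 1) ^ d ≤ d * (Y + 1) ^ (b + c + d) :=
      Nat.mul_le_mul_left _ (Nat.pow_le_pow_right (Nat.succ_pos _) (by omega))
    rw [add_mul, add_mul]
    omega
  induction p with
  | skip => exact ⟨1, fun Y => const⟩
  | write a i e => exact ⟨_, fun Y => const⟩
  | seq p q ihp ihq =>
    obtain ⟨c, hc⟩ := ihp
    obtain ⟨d, hd⟩ := ihq
    refine ⟨0 + c + d, fun Y => le_trans ?_ add⟩
    have := hc Y
    have := hd Y
    simp only [bound]
    omega
  | cond b p q ihp ihq =>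
    obtain ⟨c, hc⟩ := ihp
    obtain ⟨d, hd⟩ := ihq
    refine ⟨b.cost + 1 + c + d, fun Y => le_trans ?_ add⟩
    have := hc Y
    have := hd Y
    simp only [bound]
    omega
  | loop b p ih =>
    obtain ⟨c, hc⟩ := ih
    refine ⟨b.cost + 1 + c + 1, fun Y => ?_⟩
    have h1 : b.cost + 1 + p.bound Y ≤ (b.cost + 1 + c + 1) * (Y + 1) ^ (b.cost + 1 + c) := by
      refine le_trans ?_ (Nat.mul_le_mul_right _ (Nat.le_succ _))
      refine le_trans ?_ (add (b := b.cost + 1) (c := c) (d := 0))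
      have := hc Y
      omega
    calc bound Y (loop b p) ≤ (Y + 1) * ((b.cost + 1 + c + 1) * (Y + 1) ^ (b.cost + 1 + c)) :=
          Nat.mul_le_mul_left _ h1
      _ = _ := by ring

end RAMProgram

/-- Only arrays that occur as targets are written. Membership in `targets` is decidable, so the
frame conditions below are settled by evaluation. -/
theorem RAMExec.frame {p : RAMProgram} {σ σ' : RAMState} {t : ℕ} (h : RAMExec p σ t σ') {a : ℕ}
    (ha : a ∉ p.targets) : σ' a = σ a := by
  induction h with
  | skip => rfl
  | write b i e σ =>
    simp only [RAMProgram.targets, List.mem_singleton] at ha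
    rw [Function.update_of_ne ha]
  | seq _ _ ih1 ih2 =>
    simp only [RAMProgram.targets, List.mem_append, not_or] at ha
    rw [ih2 ha.2, ih1 ha.1]
  | condTrue _ _ ih =>
    simp only [RAMProgram.targets, List.mem_append, not_or] at ha
    exact ih ha.1
  | condFalse _ _ ih =>
    simp only [RAMProgram.targets, List.mem_append, not_or] at ha
    exact ih ha.2
  | loopTrue _ _ _ ih1 ih2 => rw [ih2 ha, ih1 ha]
  | loopFalse _ => rfl

/-- Started in the state `σ`, the program `p` halts within the time `p.bound Y` in a state that
satisfies `Q`. -/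
def Runs (Y : ℕ) (p : RAMProgram) (σ : RAMState) (Q : RAMState → Prop) : Prop :=
  ∃ t σ', RAMExec p σ t σ' ∧ t ≤ p.bound Y ∧ Q σ'

namespace Runs

variable {Y : ℕ} {p q : RAMProgram} {σ : RAMState} {Q Q' : RAMState → Prop}

/-- The frame property is supplied on the way, so specifications need to mention only the arrays
that change. -/
theorem conseq (h : Runs Y p σ Q')
    (hQ : ∀ σ', (∀ a, a ∉ p.targets → σ' a = σ a) → Q' σ' → Q σ') : Runs Y p σ Q := by
  obtain ⟨t, σ', h1, h2, h3⟩ := h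
  exact ⟨t, σ', h1, h2, hQ σ' (fun a ha => h1.frame ha) h3⟩

theorem skip (h : Q σ) : Runs Y .skip σ Q := ⟨1, σ, .skip σ, le_rfl, h⟩

theorem write {a : ℕ} {i e : RAMExpr}
    (h : Q (Function.update σ a (Function.update (σ a) (i.eval σ) (e.eval σ)))) :
    Runs Y (.write a i e) σ Q := ⟨_, _, .write a i e σ, le_rfl, h⟩

theorem seq (h : Runs Y p σ fun σ' => Runs Y q σ' Q) : Runs Y (.seq p q) σ Q := by
  obtain ⟨t, σ', h1, h2, t', σ'', h3, h4, h5⟩ := h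
  exact ⟨_, _, .seq h1 h3, Nat.add_le_add h2 h4, h5⟩

theorem cond {b : RAMExpr} (hp : b.eval σ ≠ 0 → Runs Y p σ Q) (hq : b.eval σ = 0 → Runs Y q σ Q) :
    Runs Y (.cond b p q) σ Q := by
  by_cases hb : b.eval σ = 0
  · obtain ⟨t, σ', h1, h2, h3⟩ := hq hb
    refine ⟨_, _, .condFalse hb h1, ?_, h3⟩
    simp only [RAMProgram.bound]
    omega
  · obtain ⟨t, σ', h1, h2, h3⟩ := hp hb
    refine ⟨_, _, .condTrue hb h1, ?_, h3⟩
    simp only [RAMProgram.bound]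
    omega

end Runs

/-- Repeat `p` as often as the value of `e` says; the counter is in cell `0` of the array `x`, and
the number of repetitions in cell `1`. -/
def RAMProgram.forLoop (x : ℕ) (e : RAMExpr) (p : RAMProgram) : RAMProgram :=
  .seq (.write x (.const 1) e) (.seq (.write x (.const 0) (.const 0))
    (.loop (.sub (.read x (.const 1)) (.read x (.const 0)))
      (.seq p (.write x (.const 0) (.add (.read x (.const 0)) (.const 1))))))

/-- Rule for loops: `J i` is an invariant that holds after `i` iterations. -/
theorem Runs.forLoop {Y : ℕ} {x : ℕ} {e : RAMExpr} {p : RAMProgram} {σ : RAMState}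
    {Q : RAMState → Prop} (J : ℕ → RAMState → Prop) (hx : x ∉ p.targets) (hY : e.eval σ ≤ Y)
    (hJ : ∀ i σ₁ σ₂, (∀ a, a ≠ x → σ₂ a = σ₁ a) → J i σ₁ → J i σ₂)
    (h0 : J 0 σ)
    (hstep : ∀ i < e.eval σ, ∀ σ', σ' x 0 = i → (∀ a, a ≠ x → a ∉ p.targets → σ' a = σ a) →
      J i σ' → Runs Y p σ' (J (i + 1)))
    (hQ : ∀ σ', (∀ a, a ≠ x → a ∉ p.targets → σ' a = σ a) → J (e.eval σ) σ' → Q σ') :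
    Runs Y (.forLoop x e p) σ Q := by
  set N := e.eval σ with hN
  -- Here `m` iterations remain. Besides the body, a round costs `6` for evaluating and testing the
  -- guard and `6` for increasing the counter.
  have key : ∀ m i σ', i + m = N → σ' x 0 = i → σ' x 1 = N →
      (∀ a, a ≠ x → a ∉ p.targets → σ' a = σ a) → J i σ' →
      ∃ t σ'', RAMExec (.loop (.sub (.read x (.const 1)) (.read x (.const 0)))
        (.seq p (.write x (.const 0) (.add (.read x (.const 0)) (.const 1))))) σ' t σ'' ∧
        t ≤ (m + 1) * (6 + (p.bound Y + 6)) ∧ Q σ'' := by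
    intro m
    induction m with
    | zero =>
      intro i σ' hi h1 h2 h3 h4
      refine ⟨_, σ', .loopFalse ?_, ?_, hQ σ' h3 ?_⟩
      · simp [RAMExpr.eval, h1, h2, ← hi]
      · simp [RAMExpr.cost]
      · rwa [← hi]
    | succ m ih =>
      intro i σ' hi h1 h2 h3 h4
      obtain ⟨t, τ, h5, h6, h7⟩ := hstep i (by omega) σ' h1 h3 h4
      have h8 := h5.frame hx
      obtain ⟨t', τ', h9, h10, h11⟩ := ih (i + 1)
        (Function.update τ x (Function.update (τ x) 0 (i + 1))) (by omega) (by simp)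
        (by simp [h8, h2])
        (fun a ha ha' => by
          rw [Function.update_of_ne ha, h5.frame ha', h3 a ha ha'])
        (hJ _ τ _ (fun a ha => Function.update_of_ne ha _ _) h7)
      have h12 := RAMExec.write x (.const 0) (.add (.read x (.const 0)) (.const 1)) τ
      simp only [RAMExpr.eval, h8, h1] at h12
      rw [← h8] at h12
      refine ⟨_, τ', .loopTrue ?_ (.seq h5 h12) h9, ?_, h11⟩
      · simp [RAMExpr.eval, h1, h2]; omega
      · simp only [RAMExpr.cost]
        rw [Nat.succ_mul]
        omega
  obtain ⟨t, σ', h1, h2, h3⟩ := key N 0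
    (Function.update (Function.update σ x (Function.update (σ x) 1 N)) x
      (Function.update (Function.update σ x (Function.update (σ x) 1 N) x) 0 0))
    (by omega) (by simp) (by simp)
    (fun a ha _ => by rw [Function.update_of_ne ha, Function.update_of_ne ha])
    (hJ 0 σ _ (fun a ha => by rw [Function.update_of_ne ha, Function.update_of_ne ha]) h0)
  refine ⟨_, σ', .seq (.write x (.const 1) e σ) (.seq (.write x (.const 0) (.const 0) _) h1),
    ?_, h3⟩
  simp only [RAMProgram.bound, RAMProgram.forLoop, RAMExpr.cost]
  have h4 : (N + 1) * (6 + (p.bound Y + 6)) ≤ (Y + 1) * (6 + (p.bound Y + 6)) :=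
    Nat.mul_le_mul_right _ (by omega)
  have h5 : (Y + 1) * (6 + (p.bound Y + 6)) =
      (Y + 1) * (1 + 1 + (1 + 1) + 1 + 1 + (p.bound Y + (1 + (1 + 1 + 1 + 1) + 1))) := by
    ring
  omega

namespace RAMExpr

/-- The content of cell `0` of the array `a`. -/
abbrev var (a : ℕ) : RAMExpr := .read a (.const 0)

/-- Whether two numbers differ. -/
def ne (e f : RAMExpr) : RAMExpr := .add (.sub e f) (.sub f e)

theorem eval_ne_eq_zero {e f : RAMExpr} {σ : RAMState} :
    (ne e f).eval σ = 0 ↔ e.eval σ = f.eval σ := by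
  simp only [ne, eval]
  omega

end RAMExpr

attribute [simp] RAMExpr.eval RAMExpr.eval_ne_eq_zero

/-! ### Simulating the walks

The arrays of the program for Temporally Disjoint Walks hold

* `0`: the input, `1`: the answer,
* `2, 3, 4`: the numbers `n, T, k`,
* `5`: the number `2 * k + 1` of legs per walk, `6`: the number `k * (2 * k + 1)` of all legs,
* `7, 8`: the base and the number of the digits that are guessed, `9`: the number of all guesses,
* `10, 11, 12, 13`: multiples of `n`, of `n * n` (plus an offset), of the content of `5`, and
  of the content of `6`,
* `15`: the vertices in the order of the line, `16`: their positions,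
* `17`: the positions that are close to terminals, `18`: the guessed digits,
* `30, 31`: the vertices and the legs of all visits, `32`: the last visits of the walks,
  `33`: their current visits,

and arrays `20` to `29` and from `34` on are used for counters and intermediate results. -/

open RAMExpr RAMProgram

/-- The new state stays a variable known through two equations, so that consecutive writes do not
pile up into nested updates. -/
theorem Runs.writeSeq {Y : ℕ} {q : RAMProgram} {σ : RAMState} {Q : RAMState → Prop} {a : ℕ}
    {i e : RAMExpr} (h : ∀ σ', (∀ b, b ≠ a → σ' b = σ b) →
      σ' a = Function.update (σ a) (i.eval σ) (e.eval σ) → Runs Y q σ' Q) :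
    Runs Y (.seq (.write a i e) q) σ Q :=
  Runs.seq (Runs.write (h _ (fun _ hb => Function.update_of_ne hb _ _)
    (Function.update_self _ _ _)))

/-- The names of sources and sinks, for arbitrary indices. -/
def TDWInstance.sourceNat (I : TDWInstance) (i : ℕ) : ℕ :=
  if h : i < I.k then I.source ⟨i, h⟩ else 0

def TDWInstance.sinkNat (I : TDWInstance) (i : ℕ) : ℕ :=
  if h : i < I.k then I.sink ⟨i, h⟩ else 0

/-- The memory holds an instance and the tables that depend on it. -/
structure HoldsInstance (I : TDWInstance) (σ : RAMState) : Prop where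
  n : σ 2 0 = I.n
  T : σ 3 0 = I.T
  k : σ 4 0 = I.k
  A : σ 5 0 = 2 * I.k + 1
  C : σ 6 0 = I.k * (2 * I.k + 1)
  adj : ∀ t < I.T, ∀ u < I.n, ∀ v < I.n, σ 0 (σ 11 t + σ 10 u + v) ≠ 0 ↔ I.NatAdj t u v
  source : ∀ i < I.k, σ 0 (3 + i + i) = I.sourceNat i
  sink : ∀ i < I.k, σ 0 (4 + i + i) = I.sinkNat i
  mulA : ∀ i ≤ I.k, σ 12 i = i * (2 * I.k + 1)
  mulC : ∀ x ≤ I.k * (2 * I.k + 1) + 1, σ 13 x = x * (I.k * (2 * I.k + 1))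

theorem HoldsInstance.congr {I : TDWInstance} {σ σ' : RAMState} (h : HoldsInstance I σ)
    (hf : ∀ a ∈ [0, 2, 3, 4, 5, 6, 10, 11, 12, 13], σ' a = σ a) : HoldsInstance I σ' := by
  simp only [List.mem_cons, List.not_mem_nil, or_false, forall_eq_or_imp, forall_eq] at hf
  obtain ⟨h0, h2, h3, h4, h5, h6, h10, h11, h12, h13⟩ := hf
  obtain ⟨g1, g2, g3, g4, g5, g6, g7, g8, g9, g10⟩ := h
  constructor <;> simp only [*] <;> assumption

/-- The routes that the memory holds. -/
def RAMState.plan (σ : RAMState) : RoutePlan where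
  vertex := σ 30
  first := σ 33
  last := σ 32
  blocks y y' := σ 30 y = σ 30 y' ∧
    σ 18 (σ 13 (σ 31 y + 1) + σ 31 y') ≤ σ 18 (σ 13 (σ 31 y' + 1) + σ 31 y)

theorem RAMState.plan_congr {σ σ' : RAMState} (hf : ∀ a ∈ [13, 18, 30, 31, 32, 33], σ' a = σ a) :
    σ'.plan = σ.plan := by
  simp only [List.mem_cons, List.not_mem_nil, or_false, forall_eq_or_imp, forall_eq] at hf
  obtain ⟨h0, h2, h3, h4, h5, h6⟩ := hf
  simp only [RAMState.plan, h0, h2, h3, h4, h5, h6]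

/-- Nonzero if and only if the visit `y` blocks the visit `c`. -/
def hitExpr (y c : RAMExpr) : RAMExpr :=
  .sub (.add (.sub (.const 1) (ne (.read 30 y) (.read 30 c)))
    (.sub (.const 1) (.sub
      (.read 18 (.add (.read 13 (.add (.read 31 y) (.const 1))) (.read 31 c)))
      (.read 18 (.add (.read 13 (.add (.read 31 c) (.const 1))) (.read 31 y)))))) (.const 1)

/-- With truncated subtraction, `1 - ne` is `1` exactly for equal vertices, and `1 - (b - b')` is
`1` exactly if `b ≤ b'`. The sum of these two minus `1` is their conjunction. -/
theorem eval_hitExpr {y c : RAMExpr} {σ : RAMState} :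
    (hitExpr y c).eval σ ≠ 0 ↔ σ.plan.blocks (y.eval σ) (c.eval σ) := by
  simp only [hitExpr, ne, eval, RAMState.plan]
  omega

/-- Increase cell `0` of array `41` if the walk in `47` blocks the next move of the walk whose
current visit is in `42`. -/
def scanWalk : RAMProgram :=
  .forLoop 48 (.add (.sub (.read 32 (var 47)) (.read 33 (var 47))) (.const 1))
    (.seq (.write 43 (.const 0) (.add (.read 33 (var 47)) (var 48)))
      (.write 41 (.const 0) (.add (var 41)
        (.add (hitExpr (var 43) (var 42)) (hitExpr (var 43) (.add (var 42) (.const 1)))))))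

theorem scanWalk_spec {Y : ℕ} {σ : RAMState} {i : ℕ} (hi : σ 47 0 = i)
    (hlast : σ 32 i < Y) (hcur : σ 33 i ≤ σ 32 i) :
    Runs Y scanWalk σ fun σ' => σ' 41 0 ≠ 0 ↔ σ 41 0 ≠ 0 ∨
      ∃ y, σ 33 i ≤ y ∧ y ≤ σ 32 i ∧
        (σ.plan.blocks y (σ 42 0) ∨ σ.plan.blocks y (σ 42 0 + 1)) := by
  refine Runs.forLoop (fun m σ' => σ' 41 0 ≠ 0 ↔ σ 41 0 ≠ 0 ∨
      ∃ y, σ 33 i ≤ y ∧ y < σ 33 i + m ∧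
        (σ.plan.blocks y (σ 42 0) ∨ σ.plan.blocks y (σ 42 0 + 1))) (by decide) ?_ ?_ ?_ ?_ ?_
  · simp only [eval, hi]; omega
  · intro m σ₁ σ₂ h; simp only [h 41 (by decide)]; exact id
  · simp only [ne_eq, iff_self_or]
    rintro ⟨y, h1, h2, -⟩
    omega
  · intro m hm σ' h48 hf hJ
    have h47 := hf 47 (by decide) (by decide)
    have h33 := hf 33 (by decide) (by decide)
    have h42 := hf 42 (by decide) (by decide)
    refine Runs.writeSeq fun σ₁ g1 g2 => Runs.write ?_
    have e1 : σ₁.plan = σ.plan := by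
      refine RAMState.plan_congr fun a ha => ?_
      have : a ≠ 43 ∧ a ≠ 48 ∧ a ∉ [43, 41] := by
        revert a; decide
      rw [g1 a this.1, hf a this.2.1 this.2.2]
    have h1 := eval_hitExpr (y := var 43) (c := var 42) (σ := σ₁)
    have h2 := eval_hitExpr (y := var 43) (c := .add (var 42) (.const 1)) (σ := σ₁)
    simp only [eval, g2, e1, g1 42 (by decide), h42, h47, h33, h48, hi, Function.update_self]
      at h1 h2
    have h3 : ∀ a b c : ℕ, a + (b + c) ≠ 0 ↔ a ≠ 0 ∨ b ≠ 0 ∨ c ≠ 0 := by omega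
    simp only [eval, Function.update_self]
    rw [h3, h1, h2, g1 41 (by decide), hJ, or_assoc]
    refine or_congr Iff.rfl ⟨?_, ?_⟩
    · rintro (⟨y, h4, h5, h6⟩ | h6)
      · exact ⟨y, h4, by omega, h6⟩
      · exact ⟨_, by omega, by omega, h6⟩
    · rintro ⟨y, h4, h5, h6⟩
      rcases Nat.lt_or_ge y (σ 33 i + m) with h7 | h7
      · exact Or.inl ⟨y, h4, h7, h6⟩
      · obtain rfl : y = σ 33 i + m := by omega
        exact Or.inr h6
  · intro σ' _ h
    rw [h]
    refine or_congr Iff.rfl (exists_congr fun y => and_congr_right fun h1 =>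
      and_congr_left fun _ => ?_)
    simp only [eval, hi]
    omega

/-- Set array `40` to `1` at the walk in `29`, unless the next move of this walk is blocked. -/
def scanAll : RAMProgram :=
  .seq (.write 41 (.const 0) (.const 0))
    (.seq (.forLoop 47 (var 4) (.cond (ne (var 47) (var 29))
        (.cond (.sub (.read 32 (var 47)) (.read 33 (var 47))) scanWalk .skip) .skip))
      (.write 40 (var 29) (.sub (.const 1) (var 41))))

/-- Array `41` collects the hits of all other walks. A walk at the end of its route is skipped,
since it occupies nothing any more. -/
theorem scanAll_spec {Y : ℕ} {σ : RAMState} {k i : ℕ} (hk : σ 4 0 = k) (hkY : k ≤ Y)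
    (hi : σ 29 0 = i) (hlast : ∀ i' < k, σ 32 i' < Y) :
    Runs Y scanAll σ fun σ' => ∃ b, σ' 40 = Function.update (σ 40) i b ∧ b ≤ 1 ∧
      (b ≠ 0 ↔ ∀ i' < k, i' ≠ i → σ 33 i' < σ 32 i' → ∀ y, σ 33 i' ≤ y → y ≤ σ 32 i' →
        ¬ σ.plan.blocks y (σ 42 0) ∧ ¬ σ.plan.blocks y (σ 42 0 + 1)) := by
  refine Runs.writeSeq fun σ₁ g1 g2 => Runs.seq ?_
  have eplan : ∀ τ : RAMState, (∀ a, a ≠ 47 → a ∉ [43, 41, 48] → τ a = σ₁ a) →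
      τ.plan = σ.plan := by
    intro τ hf
    refine RAMState.plan_congr fun a ha => ?_
    have : a ≠ 41 ∧ a ≠ 47 ∧ a ∉ [43, 41, 48] := by
      revert a; decide
    rw [hf a this.2.1 this.2.2, g1 a this.1]
  refine Runs.forLoop (fun m σ' => σ' 41 0 ≠ 0 ↔ ∃ i' < m, i' ≠ i ∧ σ 33 i' < σ 32 i' ∧
      ∃ y, σ 33 i' ≤ y ∧ y ≤ σ 32 i' ∧
        (σ.plan.blocks y (σ 42 0) ∨ σ.plan.blocks y (σ 42 0 + 1))) (by decide)
    ?_ ?_ ?_ ?_ ?_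
  · simp only [eval, g1 4 (by decide), hk]; exact hkY
  · intro m σ₁ σ₂ h; simp only [h 41 (by decide)]; exact id
  · simp [g2]
  · intro m hm σ' h47 hf hJ
    simp only [eval, g1 4 (by decide), hk] at hm
    have h29 : σ' 29 = σ 29 := by rw [hf 29 (by decide) (by decide), g1 29 (by decide)]
    have h32 : σ' 32 = σ 32 := by rw [hf 32 (by decide) (by decide), g1 32 (by decide)]
    have h33 : σ' 33 = σ 33 := by rw [hf 33 (by decide) (by decide), g1 33 (by decide)]
    have h42 : σ' 42 = σ 42 := by rw [hf 42 (by decide) (by decide), g1 42 (by decide)]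
    have e1 : σ'.plan = σ.plan := eplan σ' fun a h1 h2 => hf a h1 (by
      revert h2
      simp only [targets, scanWalk, RAMProgram.forLoop]
      simp
      omega)
    have key : ∀ {P : ℕ → Prop}, ¬ P m → ((∃ i' < m, P i') ↔ ∃ i' < m + 1, P i') := by
      intro P hP
      refine ⟨fun ⟨j, h1, h2⟩ => ⟨j, by omega, h2⟩, fun ⟨j, h1, h2⟩ => ⟨j, ?_, h2⟩⟩
      rcases Nat.lt_or_ge j m with h3 | h3
      · exact h3
      · obtain rfl : j = m := by omega
        exact absurd h2 hP
    refine Runs.cond (fun hb => Runs.cond (fun hb' => ?_) (fun hb' => Runs.skip ?_))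
      (fun hb => Runs.skip ?_)
    · rw [Ne, eval_ne_eq_zero] at hb
      simp only [eval, h47, h29, hi, h32, h33] at hb hb'
      refine (scanWalk_spec h47 (by rw [h32]; exact hlast m hm) (by rw [h32, h33]; omega)).conseq
        fun σ'' _ h => ?_
      rw [h, hJ, h32, h33, h42, e1]
      constructor
      · rintro (⟨j, h1, h2⟩ | h2)
        · exact ⟨j, by omega, h2⟩
        · exact ⟨m, by omega, hb, by omega, h2⟩
      · rintro ⟨j, h1, h2⟩
        rcases Nat.lt_or_ge j m with h3 | h3
        · exact Or.inl ⟨j, h3, h2⟩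
        · obtain rfl : j = m := by omega
          exact Or.inr h2.2.2
    · simp only [eval, h47, h32, h33] at hb'
      rw [hJ]
      refine key fun h => ?_
      omega
    · rw [eval_ne_eq_zero] at hb
      simp only [eval, h47, h29, hi] at hb
      rw [hJ]
      exact key fun h => h.1 hb
  · intro σ' hf hJ
    have h29 : σ' 29 = σ 29 := by rw [hf 29 (by decide) (by decide), g1 29 (by decide)]
    have h40 : σ' 40 = σ 40 := by rw [hf 40 (by decide) (by decide), g1 40 (by decide)]
    refine Runs.write ⟨1 - σ' 41 0, by rw [Function.update_self, h40]; simp only [eval, h29, hi],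
      ?_, ?_⟩
    · omega
    · have h3 : ∀ a : ℕ, 1 - a ≠ 0 ↔ ¬ a ≠ 0 := by omega
      simp only [eval, g1 4 (by decide), hk] at hJ ⊢
      rw [h3, hJ]
      push Not
      rfl

/-- Determine whether the walk in `29` can move at the time in `28`. -/
def checkMove : RAMProgram :=
  .seq (.write 40 (var 29) (.const 0)) (.seq (.write 42 (.const 0) (.read 33 (var 29)))
    (.cond (.sub (.read 32 (var 29)) (var 42))
      (.cond (.read 0 (.add (.add (.read 11 (var 28)) (.read 10 (.read 30 (var 42))))
        (.read 30 (.add (var 42) (.const 1))))) scanAll .skip) .skip))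

theorem checkMove_spec {I : TDWInstance} {Y : ℕ} {σ : RAMState} (hσ : HoldsInstance I σ)
    (hkY : I.k ≤ Y) (hR : ∀ y, σ 30 y < I.n) (hlast : ∀ i < I.k, σ 32 i < Y) {t i : ℕ}
    (ht : σ 28 0 = t) (htT : t < I.T) (hi : σ 29 0 = i) :
    Runs Y checkMove σ fun σ' => ∃ b, σ' 40 = Function.update (σ 40) i b ∧ b ≤ 1 ∧
      (b ≠ 0 ↔ σ.plan.CanMove I (σ 33) t i) := by
  refine Runs.writeSeq fun σ₁ g1 g2 => Runs.writeSeq fun σ₂ g3 g4 => ?_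
  have hf : ∀ a, a ≠ 40 → a ≠ 42 → σ₂ a = σ a := fun a h1 h2 => by rw [g3 a h2, g1 a h1]
  have h0 := hf 0 (by decide) (by decide)
  have h10 := hf 10 (by decide) (by decide)
  have h11 := hf 11 (by decide) (by decide)
  have h28 := hf 28 (by decide) (by decide)
  have h29 := hf 29 (by decide) (by decide)
  have h30 := hf 30 (by decide) (by decide)
  have h32 := hf 32 (by decide) (by decide)
  have h42 : σ₂ 42 0 = σ 33 i := by
    simp only [g4, Function.update_self, eval, g1 29 (by decide), g1 33 (by decide), hi]
  have h40 : σ₂ 40 = Function.update (σ 40) i 0 := by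
    rw [g3 40 (by decide), g2]
    simp only [eval, hi]
  have e1 : σ₂.plan = σ.plan := RAMState.plan_congr fun a ha => by
    have : a ≠ 40 ∧ a ≠ 42 := by revert a; decide
    exact hf a this.1 this.2
  refine Runs.cond (fun hb => Runs.cond (fun hb' => ?_) (fun hb' => Runs.skip ?_))
    (fun hb => Runs.skip ?_)
  · simp only [eval, h42, h29, hi, h0, h10, h11, h28, h30, h32, ht] at hb hb'
    rw [hσ.adj t htT _ (hR _) _ (hR _)] at hb'
    refine (scanAll_spec (k := I.k) (i := i) (by rw [hf 4 (by decide) (by decide), hσ.k]) hkY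
      (by rw [h29, hi]) (by rw [hf 32 (by decide) (by decide)]; exact hlast)).conseq
        fun σ' _ ⟨b, h1, h2, h3⟩ => ⟨b, by rw [h1, h40, Function.update_idem], h2, ?_⟩
    rw [h3, hf 32 (by decide) (by decide), hf 33 (by decide) (by decide), h42, e1]
    exact ⟨fun h => ⟨by change σ 33 i < σ 32 i; omega, hb', h⟩, fun h => h.2.2⟩
  · simp only [eval, h42, h29, hi, h0, h10, h11, h28, h30, h32, ht] at hb hb'
    refine ⟨0, h40, by omega, by omega, fun h => ?_⟩
    exact absurd hb' ((hσ.adj t htT _ (hR _) _ (hR _)).2 h.2.1)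
  · simp only [eval, h42, h29, hi, hf 32, ne_eq, not_false_eq_true,
      Nat.reduceEqDiff] at hb
    refine ⟨0, h40, by omega, by omega, fun h => ?_⟩
    have : σ 33 i < σ 32 i := h.1
    omega

/-- Let all walks move as early as possible. -/
def simulate : RAMProgram :=
  .forLoop 28 (var 3) (.seq (.forLoop 29 (var 4) checkMove)
    (.forLoop 29 (var 4)
      (.write 33 (var 29) (.add (.read 33 (var 29)) (.read 40 (var 29))))))

/-- The cells of array `33` beyond the `k` walks are not controlled, and moves do not depend on
them. -/
theorem RoutePlan.canMove_congr {P : RoutePlan} {I : TDWInstance} {cur cur' : ℕ → ℕ}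
    (h : ∀ i < I.k, cur' i = cur i) {t i : ℕ} (hi : i < I.k) :
    P.CanMove I cur' t i ↔ P.CanMove I cur t i := by
  unfold RoutePlan.CanMove
  rw [h i hi]
  refine and_congr_right fun _ => and_congr_right fun _ =>
    forall_congr' fun i' => forall_congr' fun hi' => ?_
  rw [h i' hi']

/-- All decisions of a time step are made from the positions before that step. They are therefore
tabulated in array `40` by one inner loop before a second one moves the walks. -/
theorem simulate_spec {I : TDWInstance} {Y : ℕ} {σ : RAMState} (hσ : HoldsInstance I σ)
    (hTY : I.T ≤ Y) (hkY : I.k ≤ Y) (hR : ∀ y, σ 30 y < I.n) (hlast : ∀ i < I.k, σ 32 i < Y) :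
    Runs Y simulate σ fun σ' => ∀ i < I.k, σ' 33 i = σ.plan.pos I I.T i := by
  refine Runs.forLoop (fun t σ' => ∀ i < I.k, σ' 33 i = σ.plan.pos I t i) (by decide) ?_ ?_ ?_ ?_ ?_
  · simp only [eval, hσ.T]; exact hTY
  · intro t σ₁ σ₂ h; simp only [h 33 (by decide)]; exact id
  · intro i _; rfl
  · intro t ht σ' h28 hf hJ
    simp only [eval, hσ.T] at ht
    have hσ' : HoldsInstance I σ' := hσ.congr fun a ha => by
      have : a ≠ 28 ∧ a ∉ [40, 42, 41, 43, 48, 47, 29, 33] := by revert a; decide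
      refine hf a this.1 fun h => this.2 ?_
      revert h
      simp only [targets, scanWalk, scanAll, checkMove, RAMProgram.forLoop]
      simp
      omega
    have h30 := hf 30 (by decide) (by decide)
    have h32 := hf 32 (by decide) (by decide)
    -- Array `33` is both `first` of the plan and the current visits, so the plan changes during the
    -- simulation. `CanMove` does not involve `first`.
    have hb : ∀ τ : RAMState, (∀ a ∈ [13, 18, 30, 31, 32], τ a = σ a) →
        τ.plan.CanMove = σ.plan.CanMove := by
      intro τ h
      simp only [List.mem_cons, List.not_mem_nil, or_false, forall_eq_or_imp, forall_eq] at h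
      obtain ⟨h0, h2, h3, h4, h5⟩ := h
      unfold RoutePlan.CanMove RAMState.plan
      simp only [h0, h2, h3, h4, h5]
    refine Runs.seq ?_
    refine Runs.forLoop (fun m τ => ∀ i < m, τ 40 i ≤ 1 ∧
      (τ 40 i ≠ 0 ↔ σ.plan.CanMove I (σ.plan.pos I t) t i)) (by decide) ?_ ?_ ?_ ?_ ?_
    · simp only [eval, hσ'.k]; exact hkY
    · intro t σ₁ σ₂ h; simp only [h 40 (by decide)]; exact id
    · intro i hi; omega
    · intro m hm τ h29 hf' hJ'
      simp only [eval, hσ'.k] at hm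
      have hτ : HoldsInstance I τ := hσ'.congr fun a ha => by
        have : a ≠ 29 ∧ a ∉ checkMove.targets := by revert a; decide
        exact hf' a this.1 this.2
      refine (checkMove_spec hτ hkY (by rw [hf' 30 (by decide) (by decide), h30]; exact hR)
        (by rw [hf' 32 (by decide) (by decide), h32]; exact hlast) (t := t)
        (by rw [hf' 28 (by decide) (by decide), h28]) ht h29).conseq ?_
      rintro σ'' - ⟨b, h1, h2, h3⟩ i hi
      rw [h1]
      rcases eq_or_ne i m with rfl | him
      · rw [Function.update_self]
        refine ⟨h2, ?_⟩
        rw [h3, hf' 33 (by decide) (by decide), hb τ]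
        · exact RoutePlan.canMove_congr hJ hm
        · intro a ha
          have : a ≠ 29 ∧ a ∉ checkMove.targets ∧ a ≠ 28 ∧ a ∉ (RAMProgram.seq
            (.forLoop 29 (var 4) checkMove) (.forLoop 29 (var 4)
              (.write 33 (var 29) (.add (.read 33 (var 29)) (.read 40 (var 29)))))).targets := by
            revert a; decide
          rw [hf' a this.1 this.2.1, hf a this.2.2.1 this.2.2.2]
      · rw [Function.update_of_ne him]
        exact hJ' i (by omega)
    · intro τ hf' hJ'
      have h33 := hf' 33 (by decide) (by decide)
      have h4 := hf' 4 (by decide) (by decide)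
      simp only [eval, hσ'.k] at hJ'
      refine Runs.forLoop (fun m τ' => ∀ i < I.k, τ' 33 i =
        if i < m then σ.plan.pos I (t + 1) i else σ.plan.pos I t i) (by decide) ?_ ?_ ?_ ?_ ?_
      · simp only [eval, h4, hσ'.k]; exact hkY
      · intro t σ₁ σ₂ h; simp only [h 33 (by decide)]; exact id
      · intro i hi; rw [h33]; simpa using hJ i hi
      · intro m hm τ' h29 hf'' hJ''
        simp only [eval, h4, hσ'.k] at hm
        refine Runs.write fun i hi => ?_
        simp only [eval, Function.update_self, h29]
        rcases eq_or_ne i m with rfl | him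
        · rw [Function.update_self, hJ'' i hi, if_neg (lt_irrefl _), if_pos (Nat.lt_succ_self _),
            hf'' 40 (by decide) (by decide)]
          obtain ⟨h5, h6⟩ := hJ' i hi
          by_cases h7 : τ 40 i = 0
          · rw [RoutePlan.pos_succ_of_not (fun h => h6.2 h h7), h7, add_zero]
          · rw [RoutePlan.pos_succ_of_canMove (h6.1 h7)]
            omega
        · rw [Function.update_of_ne him, hJ'' i hi]
          have : i < m + 1 ↔ i < m := by omega
          simp only [this]
      · intro τ' _ hJ'' i hi
        rw [hJ'' i hi, if_pos]
        simpa only [eval, h4, hσ'.k] using hi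
  · intro σ' _ hJ
    simpa only [eval, hσ.T] using hJ

/-! ### Decoding a guess and building the routes -/

/-- Divide the content of `44` by that of `7`, with the remainder in `45` and the quotient
in `46`. -/
def divide : RAMProgram :=
  .seq (.write 45 (.const 0) (var 44)) (.seq (.write 46 (.const 0) (.const 0))
    (.forLoop 29 (var 44) (.cond (.sub (.add (var 45) (.const 1)) (var 7))
      (.seq (.write 45 (.const 0) (.sub (var 45) (var 7)))
        (.write 46 (.const 0) (.add (var 46) (.const 1)))) .skip)))

theorem divide_spec {Y B : ℕ} {σ : RAMState} (hB : σ 7 0 = B) (hB0 : 0 < B) (hY : σ 44 0 ≤ Y) :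
    Runs Y divide σ fun σ' => σ' 45 0 = σ 44 0 % B ∧ σ' 46 0 = σ 44 0 / B := by
  refine Runs.writeSeq fun σ₁ g1 g2 => Runs.writeSeq fun σ₂ g3 g4 => ?_
  have h7 : σ₂ 7 = σ 7 := by rw [g3 7 (by decide), g1 7 (by decide)]
  have h44 : σ₂ 44 = σ 44 := by rw [g3 44 (by decide), g1 44 (by decide)]
  -- As many rounds as the dividend are enough: if every round subtracted, the quotient would equal
  -- the dividend, and as `B > 0` no remainder of size `B` could be left.
  refine Runs.forLoop (fun m τ => σ 44 0 = τ 46 0 * B + τ 45 0 ∧ (τ 45 0 < B ∨ τ 46 0 = m))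
    (by decide) ?_ ?_ ?_ ?_ ?_
  · simpa only [eval, h44] using hY
  · intro m σ₁ σ₂ h; simp only [h 45 (by decide), h 46 (by decide)]; exact id
  · simp [g4, g3 45 (by decide), g2]
  · rintro m - σ' - hf ⟨h1, h2⟩
    have e7 : σ' 7 0 = B := by rw [hf 7 (by decide) (by decide), h7, hB]
    refine Runs.cond (fun hb => Runs.writeSeq fun σ₃ g5 g6 => Runs.write ?_)
      (fun hb => Runs.skip ?_)
    · simp only [eval, e7] at hb
      simp only [eval, e7, g5 46 (by decide), g6, Function.update_self, ne_eq,
        Nat.reduceEqDiff, not_false_eq_true, Function.update_of_ne]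
      rw [Nat.succ_mul]
      omega
    · simp only [eval, e7] at hb
      omega
  · rintro σ' - ⟨h1, h2⟩
    simp only [eval, h44] at h2
    have h3 : σ' 45 0 < B := by
      rcases h2 with h2 | h2
      · exact h2
      · by_contra h
        have : σ' 46 0 ≤ σ' 46 0 * B := Nat.le_mul_of_pos_right _ hB0
        omega
    rw [h1]
    constructor
    · rw [mul_comm, Nat.mul_add_mod, Nat.mod_eq_of_lt h3]
    · rw [mul_comm, Nat.mul_add_div hB0, Nat.div_eq_of_lt h3, add_zero]

/-- Write the digits of the content of `27` into array `18`. -/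
def decode : RAMProgram :=
  .seq (.write 44 (.const 0) (var 27))
    (.forLoop 28 (var 8) (.seq divide (.seq (.write 18 (var 28) (var 45))
      (.write 44 (.const 0) (var 46)))))

theorem decode_spec {Y B L g : ℕ} {σ : RAMState} (hB : σ 7 0 = B) (hB0 : 0 < B)
    (hL : σ 8 0 = L) (hLY : L ≤ Y) (hg : σ 27 0 = g) (hgY : g ≤ Y) :
    Runs Y decode σ fun σ' => ∀ j < L, σ' 18 j = g / B ^ j % B := by
  refine Runs.writeSeq fun σ₁ g1 g2 => ?_
  refine Runs.forLoop (fun m τ => τ 44 0 = g / B ^ m ∧ ∀ j < m, τ 18 j = g / B ^ j % B)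
    (by decide) ?_ ?_ ?_ ?_ ?_
  · simpa only [eval, g1 8 (by decide), hL] using hLY
  · intro m σ₁ σ₂ h; simp only [h 18 (by decide), h 44 (by decide)]; exact id
  · simp [g2, hg]
  · rintro m - σ' h28 hf ⟨h1, h2⟩
    have e7 : σ' 7 0 = B := by rw [hf 7 (by decide) (by decide), g1 7 (by decide), hB]
    refine Runs.seq ((divide_spec e7 hB0 (by rw [h1]; exact (Nat.div_le_self _ _).trans hgY)).conseq
      fun σ'' hf' ⟨h3, h4⟩ => Runs.writeSeq fun σ₃ g3 g4 => Runs.write ?_)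
    have e28 : σ'' 28 0 = m := by rw [hf' 28 (by decide), h28]
    have e18 : σ'' 18 = σ' 18 := hf' 18 (by decide)
    simp only [eval, Function.update_self, ne_eq, Nat.reduceEqDiff, not_false_eq_true,
      Function.update_of_ne, g3 46, g4, e28, e18, h3, h4, h1]
    refine ⟨by rw [Nat.div_div_eq_div_mul, ← pow_succ], fun j hj => ?_⟩
    rcases eq_or_ne j m with rfl | hjm
    · rw [Function.update_self]
    · rw [Function.update_of_ne hjm, h2 j (by omega)]
  · rintro σ' - ⟨-, h2⟩
    simpa only [eval, g1 8 (by decide), hL] using h2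

/-- Make one step towards the position in `36`. -/
def buildStep : RAMProgram :=
  .cond (ne (var 35) (var 36))
    (.seq (.cond (.sub (var 36) (var 35)) (.write 35 (.const 0) (.add (var 35) (.const 1)))
        (.write 35 (.const 0) (.sub (var 35) (.const 1))))
      (.seq (.write 34 (.const 0) (.add (var 34) (.const 1)))
        (.seq (.write 30 (var 34) (.read 15 (var 35)))
          (.write 31 (var 34) (.add (.read 12 (var 28)) (var 29)))))) .skip

/-- The visits `l` of a walk are stored from index `b` on, the visits before `b` are those of
the state `ρ`, and all vertices are smaller than `n`. -/
structure Building (ρ : RAMState) (n b : ℕ) (l : List (ℕ × ℕ)) (σ : RAMState) : Prop where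
  next : σ 34 0 + 1 = b + l.length
  visits : ∀ j < l.length, (σ 30 (b + j), σ 31 (b + j)) = l.getD j (0, 0)
  old : ∀ y < b, σ 30 y = ρ 30 y ∧ σ 31 y = ρ 31 y
  lt : ∀ y, σ 30 y < n

theorem Building.congr {ρ σ σ' : RAMState} {n b : ℕ} {l : List (ℕ × ℕ)}
    (h : Building ρ n b l σ) (hf : ∀ a ∈ [30, 31, 34], σ' a = σ a) : Building ρ n b l σ' := by
  simp only [List.mem_cons, List.not_mem_nil, or_false, forall_eq_or_imp, forall_eq] at hf
  obtain ⟨h1, h2, h3⟩ := hf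
  obtain ⟨g1, g2, g3, g4⟩ := h
  constructor <;> simp only [h1, h2, h3] <;> assumption

theorem Building.append {ρ σ σ' : RAMState} {n b v c : ℕ} {l : List (ℕ × ℕ)}
    (h : Building ρ n b l σ) (h34 : σ' 34 0 = σ 34 0 + 1)
    (h30 : σ' 30 = Function.update (σ 30) (σ 34 0 + 1) v)
    (h31 : σ' 31 = Function.update (σ 31) (σ 34 0 + 1) c) (hv : v < n) :
    Building ρ n b (l ++ [(v, c)]) σ' := by
  obtain ⟨g1, g2, g3, g4⟩ := h
  rw [g1] at h30 h31
  refine ⟨by simp; omega, fun j hj => ?_, fun y hy => ?_, fun y => ?_⟩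
  · rw [h30, h31]
    rcases Nat.lt_or_ge j l.length with hj' | hj'
    · rw [Function.update_of_ne (by omega), Function.update_of_ne (by omega), g2 j hj',
        List.getD_append _ _ _ _ hj']
    · obtain rfl : j = l.length := by simp at hj; omega
      simp
  · rw [h30, h31, Function.update_of_ne (by omega), Function.update_of_ne (by omega)]
    exact g3 y hy
  · rw [h30, Function.update_apply]
    split_ifs
    · exact hv
    · exact g4 y

theorem buildStep_spec {Y n b c : ℕ} {ρ σ : RAMState} {l : List (ℕ × ℕ)}
    (hc : σ 12 (σ 28 0) + σ 29 0 = c) (hord : ∀ p, σ 15 p < n) (h : Building ρ n b l σ) :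
    Runs Y buildStep σ fun σ' => σ' 35 0 = stepTo (σ 36 0) (σ 35 0) ∧
      Building ρ n b (l ++ if σ 35 0 = σ 36 0 then [] else
        [(σ 15 (stepTo (σ 36 0) (σ 35 0)), c)]) σ' := by
  refine Runs.cond (fun hb => ?_) (fun hb => Runs.skip ?_)
  · rw [Ne, eval_ne_eq_zero] at hb
    simp only [eval] at hb
    have h1 : Runs Y (.cond (.sub (var 36) (var 35))
        (.write 35 (.const 0) (.add (var 35) (.const 1)))
        (.write 35 (.const 0) (.sub (var 35) (.const 1)))) σ
        fun σ' => σ' 35 0 = stepTo (σ 36 0) (σ 35 0) := by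
      refine Runs.cond (fun hb' => Runs.write ?_) (fun hb' => Runs.write ?_) <;>
      · simp only [eval] at hb'
        simp only [eval, Function.update_self, stepTo]
        split_ifs <;> omega
    refine Runs.seq (h1.conseq fun σ₁ g1 g2 => Runs.writeSeq fun σ₂ g3 g4 =>
      Runs.writeSeq fun σ₃ g5 g6 => Runs.write ?_)
    have e34 : σ₁ 34 = σ 34 := g1 34 (by decide)
    have e30 : σ₁ 30 = σ 30 := g1 30 (by decide)
    have e31 : σ₁ 31 = σ 31 := g1 31 (by decide)
    have e15 : σ₁ 15 = σ 15 := g1 15 (by decide)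
    have e12 : σ₁ 12 = σ 12 := g1 12 (by decide)
    have e28 : σ₁ 28 = σ 28 := g1 28 (by decide)
    have e29 : σ₁ 29 = σ 29 := g1 29 (by decide)
    simp only [eval, e34] at g4
    rw [if_neg hb]
    refine ⟨?_, h.append (v := σ 15 (stepTo (σ 36 0) (σ 35 0))) (c := c) ?_ ?_ ?_ (hord _)⟩
    · simp [g5, g3, g2]
    · simp [g5, g4]
    · simp [g6, g5, g4, g3, e30, e15, g2]
    · simp [g5, g4, g3, e31, e12, e28, e29, hc]
  · rw [eval_ne_eq_zero] at hb
    simp only [eval] at hb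
    rw [if_pos hb, hb, stepTo_self, List.append_nil]
    exact ⟨rfl, h⟩

/-- Walk to the next waypoint. -/
def buildLeg : RAMProgram :=
  .seq (.write 36 (.const 0) (.read 17 (.read 18 (.add (.read 12 (var 28)) (var 29)))))
    (.forLoop 47 (var 2) buildStep)

/-- The invariant is that the stored visits followed by the visits still to come form the fixed list
`V`. The `n` rounds consume the fuel of `legPositions`; rounds after the arrival at the waypoint
store nothing. -/
theorem buildLeg_spec {Y n b c : ℕ} {ρ σ : RAMState} {l V : List (ℕ × ℕ)} {ws : List ℕ}
    (hn : σ 2 0 = n) (hnY : n ≤ Y)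
    (hc : σ 12 (σ 28 0) + σ 29 0 = c) (hord : ∀ p, σ 15 p < n) (h : Building ρ n b l σ)
    (hV : l ++ (routeVisits n (σ 17 (σ 18 c) :: ws) c (σ 35 0)).map
      (fun v => (σ 15 v.1, v.2)) = V) :
    Runs Y buildLeg σ fun σ' => ∃ l', Building ρ n b l' σ' ∧
      l' ++ (routeVisits n ws (c + 1) (σ' 35 0)).map (fun v => (σ 15 v.1, v.2)) = V := by
  set w := σ 17 (σ 18 c) with hw
  refine Runs.writeSeq fun σ₁ g1 g2 => ?_
  have e2 := g1 2 (by decide)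
  have e36 : σ₁ 36 0 = w := by simp [g2, hc, hw]
  refine Runs.forLoop (fun m τ => ∃ l', Building ρ n b l' τ ∧
    l' ++ ((legPositions w (n - m) (τ 35 0)).map (·, c) ++
      routeVisits n ws (c + 1) ((stepTo w)^[n - m] (τ 35 0))).map
        (fun v => (σ 15 v.1, v.2)) = V) (by decide) ?_ ?_ ?_ ?_ ?_
  · simpa only [eval, e2, hn] using hnY
  · rintro m σ₁ σ₂ h ⟨l', h1, h2⟩
    refine ⟨l', h1.congr fun a ha => h a ?_, by rw [h 35 (by decide)]; exact h2⟩
    revert a; decide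
  · refine ⟨l, h.congr fun a ha => g1 a (by revert a; decide), ?_⟩
    rw [g1 35 (by decide), Nat.sub_zero]
    exact hV
  · rintro m hm σ' - hf ⟨l', h1, h2⟩
    simp only [eval, e2, hn] at hm
    have e36' : σ' 36 0 = w := by rw [hf 36 (by decide) (by decide), e36]
    have e12 : σ' 12 = σ 12 := by rw [hf 12 (by decide) (by decide), g1 12 (by decide)]
    have e15 : σ' 15 = σ 15 := by rw [hf 15 (by decide) (by decide), g1 15 (by decide)]
    have e28 : σ' 28 = σ 28 := by rw [hf 28 (by decide) (by decide), g1 28 (by decide)]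
    have e29 : σ' 29 = σ 29 := by rw [hf 29 (by decide) (by decide), g1 29 (by decide)]
    refine (buildStep_spec (c := c) (by rw [e12, e28, e29, hc]) (by rwa [e15]) h1).conseq ?_
    rintro τ - ⟨h3, h4⟩
    refine ⟨_, h4, ?_⟩
    rw [← h2, h3, e36', e15]
    obtain ⟨r, hr⟩ : ∃ r, n - m = r + 1 := ⟨n - m - 1, by omega⟩
    have hr' : n - (m + 1) = r := by omega
    rw [hr, hr', Function.iterate_succ_apply]
    split_ifs with h5
    · rw [h5, stepTo_self, legPositions_self, legPositions_self, List.append_nil]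
    · rw [legPositions, if_neg h5]
      simp
  · rintro σ' - ⟨l', h1, h2⟩
    refine ⟨l', h1, ?_⟩
    simpa [e2, hn, legPositions] using h2

theorem length_legPositions_le (w fuel p : ℕ) : (legPositions w fuel p).length ≤ fuel := by
  induction fuel generalizing p with
  | zero => simp [legPositions]
  | succ fuel ih =>
    rw [legPositions]
    split_ifs
    · simp
    · simpa using ih _

/-- This limits the indices of visits, and thus the iterations of the loop in `scanWalk`. -/
theorem length_routeVisits_le (n : ℕ) (ws : List ℕ) (c p : ℕ) :
    (routeVisits n ws c p).length ≤ ws.length * n := by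
  induction ws generalizing c p with
  | nil => simp [routeVisits]
  | cons w ws ih =>
    have := ih (c + 1) ((stepTo w)^[n] p)
    have := length_legPositions_le w n p
    rw [routeVisits, List.length_append, List.length_map, List.length_cons, Nat.succ_mul]
    omega

/-- Build the route of the walk in `28`. -/
def buildWalk : RAMProgram :=
  .seq (.write 35 (.const 0) (.read 16 (.read 0 (.add (.add (.const 3) (var 28)) (var 28)))))
    (.seq (.write 30 (var 34) (.read 0 (.add (.add (.const 3) (var 28)) (var 28))))
      (.seq (.write 31 (var 34) (.read 12 (var 28)))
        (.seq (.write 33 (var 28) (var 34))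
          (.seq (.forLoop 29 (var 5) buildLeg)
            (.seq (.write 32 (var 28) (var 34))
              (.seq (.write 37 (.const 0) (.add (var 37)
                  (ne (.read 30 (var 34)) (.read 0 (.add (.add (.const 4) (var 28)) (var 28))))))
                (.write 34 (.const 0) (.add (var 34) (.const 1)))))))))

/-- The visits of the `i`-th walk for the waypoints that the memory holds. -/
def RAMState.visits (σ : RAMState) (I : TDWInstance) (i : ℕ) : List (ℕ × ℕ) :=
  visitList (σ 15) I.n (I.sourceNat i) (σ 16 (I.sourceNat i))
    ((List.range (2 * I.k + 1)).map fun a => σ 17 (σ 18 (i * (2 * I.k + 1) + a)))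
    (i * (2 * I.k + 1))

theorem RAMState.visits_congr {σ σ' : RAMState} {I : TDWInstance}
    (hf : ∀ a ∈ [15, 16, 17, 18], σ' a = σ a) : σ'.visits I = σ.visits I := by
  simp only [List.mem_cons, List.not_mem_nil, or_false, forall_eq_or_imp, forall_eq] at hf
  obtain ⟨h1, h2, h3, h4⟩ := hf
  funext i
  simp only [RAMState.visits, h1, h2, h3, h4]

theorem RAMState.length_visits (σ : RAMState) (I : TDWInstance) (i : ℕ) :
    0 < (σ.visits I i).length ∧ (σ.visits I i).length ≤ (2 * I.k + 1) * I.n + 1 := by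
  have := length_routeVisits_le I.n ((List.range (2 * I.k + 1)).map fun a =>
    σ 17 (σ 18 (i * (2 * I.k + 1) + a))) (i * (2 * I.k + 1)) (σ 16 (I.sourceNat i))
  rw [List.length_map, List.length_range] at this
  simp only [RAMState.visits, visitList, List.length_cons, List.length_map]
  omega

theorem TDWInstance.sourceNat_lt (I : TDWInstance) {i : ℕ} (hi : i < I.k) :
    I.sourceNat i < I.n := by
  rw [TDWInstance.sourceNat, dif_pos hi]
  exact Fin.isLt _

/-- The last waypoint of an arbitrary guess need not be the sink, so array `37` records whether some
route has a wrong end. -/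
theorem buildWalk_spec {I : TDWInstance} {Y i b : ℕ} {σ : RAMState} (hσ : HoldsInstance I σ)
    (hnY : I.n ≤ Y) (hAY : 2 * I.k + 1 ≤ Y) (hi : σ 28 0 = i) (hik : i < I.k) (hb : σ 34 0 = b)
    (hord : ∀ p, σ 15 p < I.n) (hR : ∀ y, σ 30 y < I.n) :
    Runs Y buildWalk σ fun σ' =>
      σ' 34 0 = b + (σ.visits I i).length ∧ σ' 33 = Function.update (σ 33) i b ∧
      σ' 32 = Function.update (σ 32) i (b + (σ.visits I i).length - 1) ∧
      (∀ j < (σ.visits I i).length, (σ' 30 (b + j), σ' 31 (b + j)) =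
        (σ.visits I i).getD j (0, 0)) ∧
      (∀ y < b, σ' 30 y = σ 30 y ∧ σ' 31 y = σ 31 y) ∧ (∀ y, σ' 30 y < I.n) ∧
      (σ' 37 0 = 0 ↔ σ 37 0 = 0 ∧ σ' 30 (σ' 32 i) = I.sinkNat i) := by
  set V := σ.visits I i with hVdef
  refine Runs.writeSeq fun σ₁ a1 b1 => Runs.writeSeq fun σ₂ a2 b2 => Runs.writeSeq fun σ₃ a3 b3 =>
    Runs.writeSeq fun σ₄ a4 b4 => Runs.seq ?_
  have hs := hσ.source i hik
  have hA := hσ.mulA i hik.le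
  have hf : ∀ a, a ≠ 35 → a ≠ 30 → a ≠ 31 → a ≠ 33 → σ₄ a = σ a := fun a h1 h2 h3 h4 => by
    rw [a4 a h4, a3 a h3, a2 a h2, a1 a h1]
  have e35 : σ₄ 35 0 = σ 16 (I.sourceNat i) := by
    simp [a4, a3, a2, b1, hi, hs]
  have e30 : σ₄ 30 = Function.update (σ 30) b (I.sourceNat i) := by
    simp [a4, a3, b2, a1, hi, hs, hb]
  have e31 : σ₄ 31 = Function.update (σ 31) b (i * (2 * I.k + 1)) := by
    simp [a4, b3, a2, a1, hi, hA, hb]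
  have e33 : σ₄ 33 = Function.update (σ 33) i b := by
    simp [b4, a3, a2, a1, hi, hb]
  have e34 : σ₄ 34 0 = b := by
    rw [hf 34 (by decide) (by decide) (by decide) (by decide), hb]
  have e5 := hf 5 (by decide) (by decide) (by decide) (by decide)
  set f : ℕ → ℕ := fun a => σ 17 (σ 18 (i * (2 * I.k + 1) + a)) with hfdef
  refine Runs.forLoop (fun m τ => ∃ l, Building σ I.n b l τ ∧
    l ++ (routeVisits I.n ((List.range' m (2 * I.k + 1 - m)).map f) (i * (2 * I.k + 1) + m)
      (τ 35 0)).map (fun v => (σ 15 v.1, v.2)) = V) (by decide) ?_ ?_ ?_ ?_ ?_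
  · simpa only [eval, e5, hσ.A] using hAY
  · rintro m σ₁ σ₂ h ⟨l', h1, h2⟩
    refine ⟨l', h1.congr fun a ha => h a ?_, by rw [h 35 (by decide)]; exact h2⟩
    revert a; decide
  · refine ⟨[(I.sourceNat i, i * (2 * I.k + 1))], ⟨by simp [e34], ?_, ?_, ?_⟩, ?_⟩
    · intro j hj
      obtain rfl : j = 0 := by simpa using hj
      simp [e30, e31]
    · intro y hy
      rw [e30, e31, Function.update_of_ne hy.ne, Function.update_of_ne hy.ne]
      exact ⟨rfl, rfl⟩
    · intro y
      rw [e30, Function.update_apply]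
      split_ifs
      · exact I.sourceNat_lt hik
      · exact hR y
    · rw [e35, Nat.sub_zero, ← List.range_eq_range']
      rfl
  · rintro m hm σ' h29 hf' ⟨l, h1, h2⟩
    simp only [eval, e5, hσ.A] at hm
    have hf'' : ∀ a, a ≠ 35 → a ≠ 30 → a ≠ 31 → a ≠ 33 → a ≠ 29 → a ∉ buildLeg.targets →
        σ' a = σ a := fun a h1 h2 h3 h4 h5 h6 => by
      rw [hf' a h5 h6, hf a h1 h2 h3 h4]
    have g2 := hf'' 2 (by decide) (by decide) (by decide) (by decide) (by decide) (by decide)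
    have g12 := hf'' 12 (by decide) (by decide) (by decide) (by decide) (by decide) (by decide)
    have g15 := hf'' 15 (by decide) (by decide) (by decide) (by decide) (by decide) (by decide)
    have g17 := hf'' 17 (by decide) (by decide) (by decide) (by decide) (by decide) (by decide)
    have g18 := hf'' 18 (by decide) (by decide) (by decide) (by decide) (by decide) (by decide)
    have g28 := hf'' 28 (by decide) (by decide) (by decide) (by decide) (by decide) (by decide)
    obtain ⟨r, hr⟩ : ∃ r, 2 * I.k + 1 - m = r + 1 := ⟨2 * I.k + 1 - m - 1, by omega⟩
    have hr' : 2 * I.k + 1 - (m + 1) = r := by omega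
    rw [hr, List.range'_succ, List.map_cons] at h2
    refine (buildLeg_spec (V := V) (ws := (List.range' (m + 1) r).map f)
      (c := i * (2 * I.k + 1) + m) (by rw [g2, hσ.n]) hnY (by rw [g12, g28, hi, hA, h29])
      (by rwa [g15]) h1 (by rw [g15, g17, g18]; exact h2)).conseq ?_
    rintro τ - ⟨l', h3, h4⟩
    rw [g15] at h4
    refine ⟨l', h3, ?_⟩
    rw [hr', ← add_assoc]
    exact h4
  · rintro σ' hf' ⟨l, h1, h2⟩
    simp only [eval, e5, hσ.A, Nat.sub_self, List.range'_zero, List.map_nil, routeVisits,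
      List.append_nil] at h2
    subst h2
    have hlen := (σ.length_visits I i).1
    rw [← hVdef] at hlen
    have hnext := h1.next
    have hf'' : ∀ a, a ≠ 35 → a ≠ 30 → a ≠ 31 → a ≠ 33 → a ≠ 29 → a ∉ buildLeg.targets →
        σ' a = σ a := fun a h1 h2 h3 h4 h5 h6 => by
      rw [hf' a h5 h6, hf a h1 h2 h3 h4]
    have g0 := hf'' 0 (by decide) (by decide) (by decide) (by decide) (by decide) (by decide)
    have g28 := hf'' 28 (by decide) (by decide) (by decide) (by decide) (by decide) (by decide)
    have g32 := hf'' 32 (by decide) (by decide) (by decide) (by decide) (by decide) (by decide)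
    have g37 := hf'' 37 (by decide) (by decide) (by decide) (by decide) (by decide) (by decide)
    have g33 := hf' 33 (by decide) (by decide)
    have hz := hσ.sink i hik
    refine Runs.writeSeq fun σ₅ a5 b5 => Runs.writeSeq fun σ₆ a6 b6 => Runs.write ?_
    have k34 : σ₆ 34 = σ' 34 := by rw [a6 34 (by decide), a5 34 (by decide)]
    have k30 : σ₆ 30 = σ' 30 := by rw [a6 30 (by decide), a5 30 (by decide)]
    have k31 : σ₆ 31 = σ' 31 := by rw [a6 31 (by decide), a5 31 (by decide)]
    have k33 : σ₆ 33 = σ' 33 := by rw [a6 33 (by decide), a5 33 (by decide)]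
    have k32 : σ₆ 32 = Function.update (σ 32) i (σ' 34 0) := by
      rw [a6 32 (by decide), b5, g32]
      simp only [eval, g28, hi]
    have h34 : b + V.length - 1 = σ' 34 0 := by omega
    simp only [ne_eq, Nat.reduceEqDiff, not_false_eq_true, Function.update_of_ne,
      Function.update_self, eval, k34, k30, k31, k33, k32, g33, e33, h34, true_and]
    refine ⟨hnext, h1.visits, h1.old, h1.lt, ?_⟩
    have h37 : σ₆ 37 0 = σ 37 0 + (ne (.read 30 (var 34))
        (.read 0 (.add (.add (.const 4) (var 28)) (var 28)))).eval σ₅ := by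
      rw [b6]
      simp only [eval, Function.update_self, a5 37 (by decide), g37]
    rw [h37, Nat.add_eq_zero_iff, eval_ne_eq_zero]
    simp only [eval, a5 30 (by decide), a5 34 (by decide), a5 0 (by decide), a5 28 (by decide),
      g0, g28, hi, hz]

/-- Build the routes of all walks. -/
def buildRoutes : RAMProgram :=
  .seq (.write 34 (.const 0) (.const 0)) (.seq (.write 37 (.const 0) (.const 0))
    (.forLoop 28 (var 4) buildWalk))

/-- The routes are stored one behind the other. Building a route leaves earlier cells unchanged, and
`RAMState.visits` depends only on arrays that are not written here. -/
theorem buildRoutes_spec {I : TDWInstance} {Y : ℕ} {σ : RAMState} (hσ : HoldsInstance I σ)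
    (hnY : I.n ≤ Y) (hAY : 2 * I.k + 1 ≤ Y)
    (hord : ∀ p, σ 15 p < I.n) (hR : ∀ y, σ 30 y < I.n) :
    Runs Y buildRoutes σ fun σ' => (∀ y, σ' 30 y < I.n) ∧
      (∀ i < I.k, σ' 32 i + 1 = σ' 33 i + (σ.visits I i).length ∧
        σ' 32 i < I.k * ((2 * I.k + 1) * I.n + 1) ∧
        ∀ j < (σ.visits I i).length, (σ' 30 (σ' 33 i + j), σ' 31 (σ' 33 i + j)) =
          (σ.visits I i).getD j (0, 0)) ∧
      (σ' 37 0 = 0 ↔ ∀ i < I.k, σ' 30 (σ' 32 i) = I.sinkNat i) := by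
  refine Runs.writeSeq fun σ₁ a1 b1 => Runs.writeSeq fun σ₂ a2 b2 => ?_
  have hf : ∀ a, a ≠ 34 → a ≠ 37 → σ₂ a = σ a := fun a h1 h2 => by rw [a2 a h2, a1 a h1]
  have e4 := hf 4 (by decide) (by decide)
  refine Runs.forLoop (fun m τ => τ 34 0 ≤ m * ((2 * I.k + 1) * I.n + 1) ∧
      (∀ y, τ 30 y < I.n) ∧
      (∀ i < m, τ 32 i + 1 = τ 33 i + (σ.visits I i).length ∧ τ 32 i < τ 34 0 ∧
        ∀ j < (σ.visits I i).length, (τ 30 (τ 33 i + j), τ 31 (τ 33 i + j)) =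
          (σ.visits I i).getD j (0, 0)) ∧
      (τ 37 0 = 0 ↔ ∀ i < m, τ 30 (τ 32 i) = I.sinkNat i)) (by decide) ?_ ?_ ?_ ?_ ?_
  · simp only [eval, e4, hσ.k]
    omega
  · intro m σ₁ σ₂ h
    simp only [h 34 (by decide), h 30 (by decide), h 31 (by decide), h 32 (by decide),
      h 33 (by decide), h 37 (by decide)]
    exact id
  · refine ⟨by simp [a2, b1], by rwa [hf 30 (by decide) (by decide)], fun i hi => by omega, ?_⟩
    simp [b2]
  · rintro m hm σ' h28 hf' ⟨h1, h2, h3, h4⟩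
    simp only [eval, e4, hσ.k] at hm
    have hf'' : ∀ a, a ≠ 34 ∧ a ≠ 37 ∧ a ≠ 28 ∧ a ∉ buildWalk.targets → σ' a = σ a := fun a h => by
      rw [hf' a h.2.2.1 h.2.2.2, hf a h.1 h.2.1]
    have hvis : σ'.visits I = σ.visits I := RAMState.visits_congr fun a ha =>
      hf'' a (by revert a; decide)
    refine (buildWalk_spec (hσ.congr fun a ha => hf'' a (by revert a; decide)) hnY hAY h28 hm rfl
      (by rwa [hf'' 15 (by decide)]) h2).conseq ?_
    rintro τ - ⟨g1, g2, g3, g4, g5, g6, g7⟩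
    rw [hvis] at g1 g3 g4
    obtain ⟨hl1, hl2⟩ := σ.length_visits I m
    refine ⟨?_, g6, ?_, ?_⟩
    · rw [g1, Nat.succ_mul]; omega
    · intro i hi
      rcases eq_or_ne i m with rfl | him
      · rw [g2, g3, Function.update_self, Function.update_self]
        exact ⟨by omega, by omega, g4⟩
      · obtain ⟨h5, h6, h7⟩ := h3 i (by omega)
        rw [g2, g3, Function.update_of_ne him, Function.update_of_ne him]
        refine ⟨h5, by omega, fun j hj => ?_⟩
        rw [(g5 _ (by omega)).1, (g5 _ (by omega)).2]
        exact h7 j hj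
    · rw [g7, h4]
      have h8 : ∀ i < m, τ 30 (τ 32 i) = σ' 30 (σ' 32 i) := fun i hi => by
        rw [g3, Function.update_of_ne hi.ne, (g5 _ (h3 i hi).2.1).1]
      constructor
      · rintro ⟨h9, h10⟩ i hi
        rcases eq_or_ne i m with rfl | him
        · exact h10
        · rw [h8 i (by omega)]
          exact h9 i (by omega)
      · intro h9
        exact ⟨fun i hi => by rw [← h8 i hi]; exact h9 i (by omega), h9 m (by omega)⟩
  · rintro σ' - ⟨h1, h2, h3, h4⟩
    simp only [eval, e4, hσ.k] at h1 h3 h4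
    exact ⟨h2, fun i hi => ⟨(h3 i hi).1, (h3 i hi).2.1.trans_le h1, (h3 i hi).2.2⟩, h4⟩

/-! ### Trying all guesses -/

/-- Accept if all walks reach their sinks for the guess in `27`. -/
def tryGuess : RAMProgram :=
  .seq decode (.seq buildRoutes (.seq simulate
    (.seq (.forLoop 28 (var 4) (.write 37 (.const 0)
        (.add (var 37) (.sub (.read 32 (var 28)) (.read 33 (var 28))))))
      (.cond (var 37) .skip (.write 1 (.const 0) (.const 1))))))

/-- The number of legs of all walks. -/
abbrev TDWInstance.numLegs (I : TDWInstance) : ℕ := I.k * (2 * I.k + 1)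

/-- The number of digits of a guess. -/
abbrev TDWInstance.numDigits (I : TDWInstance) : ℕ := (I.numLegs + 1) * I.numLegs

/-- The memory holds the parameters of the guesses. -/
structure HoldsGuessing (I : TDWInstance) (σ : RAMState) : Prop where
  base : σ 7 0 = 2 * I.numLegs
  digits : σ 8 0 = I.numDigits
  guesses : σ 9 0 = (2 * I.numLegs) ^ I.numDigits

/-- `Y` exceeds all numbers that bound loops. -/
structure LoopBound (I : TDWInstance) (Y : ℕ) : Prop where
  pos : 0 < I.k
  n : I.n ≤ Y
  T : I.T ≤ Y
  k : I.k ≤ Y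
  A : 2 * I.k + 1 ≤ Y
  C : I.numLegs + 1 ≤ Y
  B : 2 * I.numLegs ≤ Y
  L : I.numDigits ≤ Y
  guesses : (2 * I.numLegs) ^ I.numDigits ≤ Y
  visits : I.k * ((2 * I.k + 1) * I.n + 1) ≤ Y

theorem LoopBound.numLegs_pos {I : TDWInstance} {Y : ℕ} (h : LoopBound I Y) : 0 < I.numLegs :=
  Nat.mul_pos h.pos (Nat.succ_pos _)

/-- The guess `g` yields waypoints and an order for which all walks reach their sinks, where
array `15` holds the vertices in the order of the line, and so on. -/
def IsGoodGuess (I : TDWInstance) (ord pos cand : ℕ → ℕ) (g : ℕ) : Prop :=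
  ∃ φ ws bit, I.ReachSinks φ ws bit ∧ (∀ i, (ws i).length = 2 * I.k + 1) ∧
    (∀ v, ord (φ v) = v) ∧ (∀ v : Fin I.n, pos v = φ v) ∧
    (∀ i : Fin I.k, ∀ a < 2 * I.k + 1,
      cand (g / (2 * I.numLegs) ^ (i * (2 * I.k + 1) + a) % (2 * I.numLegs)) =
        (ws i).getD a 0) ∧
    ∀ x < I.numLegs, ∀ y < I.numLegs,
      g / (2 * I.numLegs) ^ ((x + 1) * I.numLegs + y) % (2 * I.numLegs) = bit x y

theorem TDWInstance.leg_lt (I : TDWInstance) {i a : ℕ} (hi : i < I.k) (ha : a < 2 * I.k + 1) :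
    i * (2 * I.k + 1) + a < I.numLegs := by
  have := Nat.mul_le_mul_right (2 * I.k + 1) (Nat.succ_le_of_lt hi)
  rw [Nat.succ_mul] at this
  unfold TDWInstance.numLegs
  omega

theorem TDWInstance.digit_lt (I : TDWInstance) {x y : ℕ} (hx : x < I.numLegs + 1)
    (hy : y < I.numLegs) : x * I.numLegs + y < I.numDigits := by
  have := Nat.mul_le_mul_right I.numLegs (Nat.succ_le_of_lt hx)
  rw [Nat.succ_mul] at this
  unfold TDWInstance.numDigits
  omega

/-- If a good guess has been decoded, then all walks reach their sinks. -/
theorem IsGoodGuess.reach {I : TDWInstance} {σ τ : RAMState} {g : ℕ}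
    (hg : IsGoodGuess I (σ 15) (σ 16) (σ 17) g)
    (hdig : ∀ j < I.numDigits, σ 18 j = g / (2 * I.numLegs) ^ j % (2 * I.numLegs))
    (h13 : ∀ x ≤ I.numLegs + 1, τ 13 x = x * I.numLegs) (h18 : τ 18 = σ 18)
    (hvis : ∀ i < I.k, τ 32 i + 1 = τ 33 i + (σ.visits I i).length ∧
        ∀ j < (σ.visits I i).length, (τ 30 (τ 33 i + j), τ 31 (τ 33 i + j)) =
          (σ.visits I i).getD j (0, 0)) (i : Fin I.k) :
    τ 30 (τ 32 i) = I.sink i ∧ τ.plan.pos I I.T i = τ 32 i := by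
  obtain ⟨φ, ws, bit, hreach, hlen, hord, hpos, hcand, hbit⟩ := hg
  refine hreach (σ 15) hord τ.plan (τ 31) ?_ ?_ i
  · rintro i V rfl
    have h1 : visitList (σ 15) I.n (I.source i) (φ (I.source i)) (ws i) (i * (2 * I.k + 1)) =
        σ.visits I i := by
      unfold RAMState.visits
      rw [TDWInstance.sourceNat, dif_pos i.2, hpos]
      congr 1
      refine List.ext_getElem (by simp [hlen]) fun a ha ha' => ?_
      have ha2 : a < 2 * I.k + 1 := by simpa using ha'
      have h2 := hcand i a ha2
      rw [← hdig _ ((by simpa using I.digit_lt (x := 0) (by omega) (I.leg_lt i.2 ha2))),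
        List.getD_eq_getElem _ _ ha] at h2
      simp [h2]
    rw [h1]
    exact hvis i i.2
  · intro y y' hy hy' hb
    obtain ⟨h1, h2⟩ : τ 30 y = τ 30 y' ∧
        τ 18 (τ 13 (τ 31 y + 1) + τ 31 y') ≤ τ 18 (τ 13 (τ 31 y' + 1) + τ 31 y) := hb
    refine ⟨h1, ?_⟩
    -- The first `numLegs` digits are the waypoints. The bit for the legs `x` and `y` is digit `(x +
    -- 1) * numLegs + y`.
    rw [h18, h13 _ (by unfold TDWInstance.numLegs; omega),
      h13 _ (by unfold TDWInstance.numLegs; omega),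
      hdig _ (I.digit_lt (by unfold TDWInstance.numLegs; omega) hy'),
      hdig _ (I.digit_lt (by unfold TDWInstance.numLegs; omega) hy),
      hbit _ hy _ hy', hbit _ hy' _ hy] at h2
    exact h2

/-- Acceptance is justified for every guess, but is guaranteed only for a good one. Array `37` adds
up wrong route ends and the numbers of visits that the walks did not reach, so it is zero exactly on
success. -/
theorem tryGuess_spec {I : TDWInstance} {Y g : ℕ} {σ : RAMState} (hσ : HoldsInstance I σ)
    (hσ' : HoldsGuessing I σ) (hY : LoopBound I Y) (hord : ∀ p, σ 15 p < I.n)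
    (hR : ∀ y, σ 30 y < I.n) (hg : σ 27 0 = g) (hgY : g ≤ Y) :
    Runs Y tryGuess σ fun σ' => (∀ y, σ' 30 y < I.n) ∧
      (σ' 1 0 ≠ 0 → σ 1 0 ≠ 0 ∨ ∃ W, I.IsSolution W) ∧ (σ 1 0 ≠ 0 → σ' 1 0 ≠ 0) ∧
      (IsGoodGuess I (σ 15) (σ 16) (σ 17) g → σ' 1 0 ≠ 0) := by
  refine Runs.seq ((decode_spec hσ'.base (Nat.mul_pos two_pos hY.numLegs_pos) hσ'.digits hY.L hg
    hgY).conseq fun σ₁ f1 hdig => ?_)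
  have hσ₁ : HoldsInstance I σ₁ := hσ.congr fun a ha => f1 a (by revert a; decide)
  have e15 := f1 15 (by decide)
  have e30 := f1 30 (by decide)
  refine Runs.seq ((buildRoutes_spec hσ₁ hY.n hY.A (by rwa [e15]) (by rwa [e30])).conseq
    fun σ₂ f2 ⟨hR2, hvis, hbad⟩ => ?_)
  have hσ₂ : HoldsInstance I σ₂ := hσ₁.congr fun a ha => f2 a (by revert a; decide)
  refine Runs.seq ((simulate_spec hσ₂ hY.T hY.k hR2 fun i hi =>
    (hvis i hi).2.1.trans_le hY.visits).conseq fun σ₃ f3 hpos => ?_)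
  have g4 : σ₃ 4 0 = I.k := by rw [f3 4 (by decide), hσ₂.k]
  have g32 := f3 32 (by decide)
  have g37 := f3 37 (by decide)
  have hle : ∀ i < I.k, σ₂.plan.pos I I.T i ≤ σ₂ 32 i := fun i hi =>
    RoutePlan.pos_le_last (P := σ₂.plan) (by
      change σ₂ 33 i ≤ σ₂ 32 i
      have := (hvis i hi).1
      have := (σ₁.length_visits I i).1
      omega)
  refine Runs.seq (Runs.forLoop (fun m τ => τ 37 0 = 0 ↔
    (∀ i < I.k, σ₂ 30 (σ₂ 32 i) = I.sinkNat i) ∧ ∀ i < m, σ₂.plan.pos I I.T i = σ₂ 32 i)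
    (by decide) ?_ ?_ ?_ ?_ ?_)
  · simpa only [eval, g4] using hY.k
  · intro m σ₁ σ₂ h; simp only [h 37 (by decide)]; exact id
  · rw [g37, hbad]
    simp
  · intro m hm τ h28 hf hJ
    simp only [eval, g4] at hm
    refine Runs.write ?_
    simp only [eval, Function.update_self, h28, hf 32 (by decide) (by decide),
      hf 33 (by decide) (by decide), hpos m hm, g32]
    have h1 := hle m hm
    rw [Nat.add_eq_zero_iff, hJ, Nat.sub_eq_zero_iff_le, and_assoc]
    refine and_congr_right fun _ => ⟨fun ⟨h2, h3⟩ i hi => ?_, fun h2 =>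
      ⟨fun i hi => h2 i (by omega), (h2 m (by omega)).ge⟩⟩
    rcases eq_or_ne i m with rfl | him
    · omega
    · exact h2 i (by omega)
  · intro τ hf hJ
    simp only [eval, g4] at hJ
    have k30 : τ 30 = σ₂ 30 := by rw [hf 30 (by decide) (by decide), f3 30 (by decide)]
    have k1 : τ 1 = σ 1 := by
      rw [hf 1 (by decide) (by decide), f3 1 (by decide), f2 1 (by decide), f1 1 (by decide)]
    refine Runs.cond (fun hb => Runs.skip ?_) (fun hb => Runs.write ?_)
    · simp only [eval] at hb
      rw [k30, k1]
      refine ⟨hR2, Or.inl, id, fun hgood => absurd (hJ.2 ?_) hb⟩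
      have hgood' : IsGoodGuess I (σ₁ 15) (σ₁ 16) (σ₁ 17) g := by
        rwa [e15, f1 16 (by decide), f1 17 (by decide)]
      have key := hgood'.reach (τ := σ₂) hdig hσ₂.mulC (f2 18 (by decide))
        fun i hi => ⟨(hvis i hi).1, (hvis i hi).2.2⟩
      refine ⟨fun i hi => ?_, fun i hi => (key ⟨i, hi⟩).2⟩
      rw [TDWInstance.sinkNat, dif_pos hi]
      exact (key ⟨i, hi⟩).1
    · simp only [eval] at hb
      simp only [ne_eq, Nat.reduceEqDiff, not_false_eq_true, Function.update_of_ne,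
        Function.update_self, eval, k30]
      refine ⟨hR2, fun _ => Or.inr ?_, fun _ => trivial, fun _ => trivial⟩
      obtain ⟨h1, h2⟩ := hJ.1 hb
      refine RoutePlan.exists_isSolution (P := σ₂.plan) hR2 (fun i => ?_) (fun i => ?_) ?_ h2
      · have := (hvis i i.2).2.2 0 (σ₁.length_visits I i).1
        simp only [add_zero, RAMState.visits, visitList, List.getD_cons_zero,
          Prod.mk.injEq] at this
        rw [TDWInstance.sourceNat, dif_pos i.2] at this
        exact this.1
      · have := h1 i i.2
        rwa [TDWInstance.sinkNat, dif_pos i.2] at this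
      -- Whatever the digits are, comparing them is total, so of two visits at the same vertex one
      -- blocks the other.
      · intro y y' h
        exact (le_total _ _).imp (fun h' => ⟨h, h'⟩) (fun h' => ⟨h.symm, h'⟩)

/-! ### The order of the vertices on the line -/

/-- Let the vertex in `25` follow the vertex at the position in `24`, if the two are adjacent
at the time in `26`, and if the former has not been visited before. -/
def orderStep : RAMProgram :=
  .cond (.read 0 (.add (.add (.read 11 (var 26)) (.read 10 (.read 15 (var 24)))) (var 25)))
    (.cond (ne (var 25) (.read 15 (.sub (var 24) (.const 1))))
      (.write 15 (.add (var 24) (.const 1)) (var 25)) .skip) .skip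

/-- Order the vertices, starting with the vertex in `23`. -/
def buildOrder : RAMProgram :=
  .seq (.write 15 (.const 0) (var 23))
    (.forLoop 24 (var 2) (.forLoop 25 (var 2) (.forLoop 26 (var 3) orderStep)))

/-- The vertices at positions up to `p` are correct, where the vertex `v₀` is at position `0`. -/
def OrderedUpTo (I : TDWInstance) (v₀ : ℕ) (σ : RAMState) (p : ℕ) (next : ℕ → Prop) : Prop :=
  (∀ q, σ 15 q < I.n) ∧ ∀ φ : I.graph.underlying ≃g SimpleGraph.pathGraph I.n,
    (∀ v : Fin I.n, (v : ℕ) = v₀ → (φ v : ℕ) = 0) →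
      (∀ v, (φ v : ℕ) ≤ p → σ 15 (φ v) = v) ∧
      ∀ v, (φ v : ℕ) = p + 1 → next v → σ 15 (p + 1) = v

theorem OrderedUpTo.congr {I : TDWInstance} {v₀ : ℕ} {σ σ' : RAMState} {p : ℕ}
    {next : ℕ → Prop} (h : OrderedUpTo I v₀ σ p next) (hf : σ' 15 = σ 15) :
    OrderedUpTo I v₀ σ' p next := by
  unfold OrderedUpTo at h ⊢
  rwa [hf]

/-- A neighbour of the vertex at position `p` that is not at position `p - 1` is at position `p +
1`. For `p = 0` the truncated `p - 1` is `0`, and the test compares `u` with the current vertex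
itself, which excludes no neighbour. -/
theorem orderStep_spec {I : TDWInstance} {Y v₀ p u t : ℕ} {σ : RAMState}
    (hσ : HoldsInstance I σ) (hp : σ 24 0 = p) (hpn : p < I.n) (hu : σ 25 0 = u)
    (hun : u < I.n) (ht : σ 26 0 = t) (htT : t < I.T)
    (h : OrderedUpTo I v₀ σ p fun v => v < u ∨ (v = u ∧ ∃ t' < t, I.NatAdj t' (σ 15 p) v)) :
    Runs Y orderStep σ fun σ' => (∀ q ≤ p, σ' 15 q = σ 15 q) ∧
      OrderedUpTo I v₀ σ' p fun v => v < u ∨ (v = u ∧ ∃ t' < t + 1, I.NatAdj t' (σ 15 p) v) := by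
  obtain ⟨h1, h2⟩ := h
  have hadj := hσ.adj t htT _ (h1 p) u hun
  have hvp : ∀ φ : I.graph.underlying ≃g SimpleGraph.pathGraph I.n,
    (∀ v : Fin I.n, (v : ℕ) = v₀ → (φ v : ℕ) = 0) → ∀ q (_ : q ≤ p),
      ∃ v, (φ v : ℕ) = q ∧ σ 15 q = v := by
    intro φ hφ q hq
    have h3 : (φ (φ.symm ⟨q, by omega⟩) : ℕ) = q := by simp
    refine ⟨φ.symm ⟨q, by omega⟩, h3, ?_⟩
    have := (h2 φ hφ).1 (φ.symm ⟨q, by omega⟩) (h3.le.trans hq)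
    rwa [h3] at this
  refine Runs.cond (fun hb => Runs.cond (fun hb' => Runs.write ?_) (fun hb' => Runs.skip ?_))
    (fun hb => Runs.skip ?_)
  · rw [Ne, eval_ne_eq_zero] at hb'
    simp only [eval, hp, hu, ht] at hb hb'
    simp only [eval, hp, hu, OrderedUpTo, Function.update_self]
    refine ⟨fun q hq => Function.update_of_ne (by omega) _ _, fun q => ?_, fun φ hφ => ?_⟩
    · rw [Function.update_apply]
      split_ifs
      · exact hun
      · exact h1 q
    · refine ⟨fun v hv => ?_, fun v hv _ => ?_⟩
      · rw [Function.update_of_ne (by omega)]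
        exact (h2 φ hφ).1 v hv
      · obtain ⟨ht', hp', hu', hadj'⟩ := hadj.1 hb
        obtain ⟨x, hx1, hx2⟩ := hvp φ hφ p le_rfl
        have h4 := adj_position φ hadj'
        have h5 : (⟨σ 15 p, hp'⟩ : Fin I.n) = x := Fin.ext hx2
        rw [h5, hx1] at h4
        have h6 : p + 1 = (φ ⟨u, hu'⟩ : ℕ) := by
          refine h4.resolve_right fun h6 => hb' ?_
          obtain ⟨y, hy1, hy2⟩ := hvp φ hφ (p - 1) (by omega)
          rw [hy2]
          have : y = ⟨u, hu'⟩ := φ.injective (Fin.ext (by omega))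
          rw [this]
        have : v = ⟨u, hu'⟩ := φ.injective (Fin.ext (by omega))
        rw [this]
  · rw [eval_ne_eq_zero] at hb'
    simp only [eval, hp, hu] at hb'
    refine ⟨fun q _ => rfl, h1, fun φ hφ => ⟨(h2 φ hφ).1, fun v hv hn => ?_⟩⟩
    refine (h2 φ hφ).2 v hv (hn.imp_right fun hn => ⟨hn.1, ?_⟩)
    exfalso
    obtain ⟨y, hy1, hy2⟩ := hvp φ hφ (p - 1) (by omega)
    have : y = v := Fin.ext (by rw [← hy2, ← hb', hn.1])
    rw [this] at hy1
    omega
  · simp only [eval, hp, hu, ht] at hb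
    refine ⟨fun q _ => rfl, h1, fun φ hφ => ⟨(h2 φ hφ).1, fun v hv hn => ?_⟩⟩
    refine (h2 φ hφ).2 v hv (hn.imp_right fun ⟨hn1, t', ht', hn2⟩ => ⟨hn1, t', ?_, hn2⟩)
    rcases eq_or_ne t' t with rfl | hne
    · rw [hn1] at hn2
      exact absurd hb (hadj.2 hn2)
    · omega

/-- If `v₀` is not an end of the line, the invariant says nothing about the order, but it still
keeps all entries below `n`. -/
theorem buildOrder_spec {I : TDWInstance} {Y v₀ : ℕ} {σ : RAMState} (hσ : HoldsInstance I σ)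
    (hY : LoopBound I Y) (hv₀ : σ 23 0 = v₀) (hv₀n : v₀ < I.n) (hord : ∀ p, σ 15 p < I.n) :
    Runs Y buildOrder σ fun σ' => OrderedUpTo I v₀ σ' I.n fun _ => False := by
  refine Runs.writeSeq fun σ₁ f1 g1 => ?_
  have hσ₁ : HoldsInstance I σ₁ := hσ.congr fun a ha => f1 a (by revert a; decide)
  refine Runs.forLoop (fun p τ => OrderedUpTo I v₀ τ p fun _ => False) (by decide) ?_ ?_ ?_ ?_ ?_
  · simpa only [eval, hσ₁.n] using hY.n
  · intro m σ₁ σ₂ h h'; exact h'.congr (h 15 (by decide))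
  · simp only [eval, hv₀] at g1
    refine ⟨fun q => ?_, fun φ hφ => ⟨fun v hv => ?_, fun v _ h => h.elim⟩⟩
    · rw [g1, Function.update_apply]
      split_ifs
      · exact hv₀n
      · exact hord q
    · have h1 : (φ v : ℕ) = 0 := by omega
      have h2 := hφ ⟨v₀, hv₀n⟩ rfl
      have h3 : v = ⟨v₀, hv₀n⟩ := φ.injective (Fin.ext (by omega))
      rw [h1, g1, Function.update_self, h3]
  · intro p hp τ h24 hf hJ
    simp only [eval, hσ₁.n] at hp
    have hτ : HoldsInstance I τ := hσ₁.congr fun a ha => by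
      have : a ≠ 24 ∧ a ∉ (RAMProgram.forLoop 25 (var 2)
        (.forLoop 26 (var 3) orderStep)).targets := by revert a; decide
      exact hf a this.1 this.2
    refine Runs.forLoop (fun u τ' => (∀ q ≤ p, τ' 15 q = τ 15 q) ∧
      OrderedUpTo I v₀ τ' p fun v => v < u) (by decide) ?_ ?_ ?_ ?_ ?_
    · simpa only [eval, hτ.n] using hY.n
    · rintro m σ₁ σ₂ h ⟨h', h''⟩
      rw [h 15 (by decide)]
      exact ⟨h', h''.congr (h 15 (by decide))⟩
    · refine ⟨fun q _ => rfl, hJ.1, fun φ hφ => ⟨(hJ.2 φ hφ).1, fun v _ h => absurd h (by simp)⟩⟩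
    · intro u hu τ₂ h25 hf2 hJ2
      simp only [eval, hτ.n] at hu
      have hτ₂ : HoldsInstance I τ₂ := hτ.congr fun a ha => by
        have : a ≠ 25 ∧ a ∉ (RAMProgram.forLoop 26 (var 3) orderStep).targets := by
          revert a; decide
        exact hf2 a this.1 this.2
      refine Runs.forLoop (fun t τ' => (∀ q ≤ p, τ' 15 q = τ 15 q) ∧
        OrderedUpTo I v₀ τ' p fun v => v < u ∨ (v = u ∧ ∃ t' < t, I.NatAdj t' (τ 15 p) v))
        (by decide) ?_ ?_ ?_ ?_ ?_
      · simpa only [eval, hτ₂.T] using hY.T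
      · rintro m σ₁ σ₂ h ⟨h', h''⟩
        rw [h 15 (by decide)]
        exact ⟨h', h''.congr (h 15 (by decide))⟩
      · simpa using hJ2
      · intro t ht τ₃ h26 hf3 hJ3
        simp only [eval, hτ₂.T] at ht
        have hτ₃ : HoldsInstance I τ₃ := hτ₂.congr fun a ha => by
          have : a ≠ 26 ∧ a ∉ orderStep.targets := by revert a; decide
          exact hf3 a this.1 this.2
        have h1 := hJ3.1 p le_rfl
        have h2 := hJ3.2
        rw [← h1] at h2 ⊢
        refine (orderStep_spec hτ₃ (by rw [hf3 24 (by decide) (by decide),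
          hf2 24 (by decide) (by decide), h24]) hp (by rw [hf3 25 (by decide) (by decide), h25])
          hu h26 ht h2).conseq ?_
        rintro τ₄ - ⟨h3, h4⟩
        exact ⟨fun q hq => (h3 q hq).trans (hJ3.1 q hq), h4⟩
      · rintro τ₃ - ⟨h1, h2, h3⟩
        refine ⟨h1, h2, fun φ hφ => ⟨(h3 φ hφ).1, fun v hv hvu => (h3 φ hφ).2 v hv ?_⟩⟩
        rcases Nat.lt_succ_iff_lt_or_eq.1 hvu with h4 | h4
        · exact Or.inl h4
        · refine Or.inr ⟨h4, ?_⟩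
          have h5 : (φ (φ.symm ⟨p, hp⟩) : ℕ) = p := by simp
          have h6 := (hJ.2 φ hφ).1 (φ.symm ⟨p, hp⟩) h5.le
          rw [h5] at h6
          -- All time steps have been scanned for `u`, and consecutive vertices of the line are
          -- adjacent in at least one layer; so a neighbour cannot have been missed.
          have h7 : I.graph.underlying.Adj (φ.symm ⟨p, hp⟩) v := by
            rw [← φ.map_adj_iff, SimpleGraph.pathGraph_adj]
            left
            rw [h5, hv]
          obtain ⟨t, h8⟩ := SimpleGraph.iSup_adj.1 h7
          refine ⟨t, by simp only [eval, hτ₂.T]; exact t.2, t.2,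
            by rw [h6]; exact Fin.isLt _, v.2, ?_⟩
          have h9 : (⟨τ 15 p, by rw [h6]; exact Fin.isLt _⟩ : Fin I.n) = φ.symm ⟨p, hp⟩ :=
            Fin.ext h6
          rw [h9]
          exact h8
    · rintro τ₂ - ⟨h1, h2, h3⟩
      refine ⟨h2, fun φ hφ => ⟨fun v hv => ?_, fun v _ h => h.elim⟩⟩
      rcases Nat.le_succ_iff.1 hv with h4 | h4
      · exact (h3 φ hφ).1 v h4
      · rw [h4]
        exact (h3 φ hφ).2 v h4 (by simp only [eval, hτ.n]; exact v.2)
  · intro τ _ hJ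
    simpa only [eval, hσ₁.n] using hJ

/-- Compute the positions of the vertices. -/
def buildPositions : RAMProgram :=
  .forLoop 24 (var 2) (.write 16 (.read 15 (var 24)) (var 24))

theorem buildPositions_spec {I : TDWInstance} {Y : ℕ} {σ : RAMState} (hσ : HoldsInstance I σ)
    (hY : LoopBound I Y) :
    Runs Y buildPositions σ fun σ' =>
      ∀ φ : I.graph.underlying ≃g SimpleGraph.pathGraph I.n, (∀ v, σ 15 (φ v) = v) →
        ∀ v : Fin I.n, σ' 16 v = φ v := by
  refine Runs.forLoop (fun m τ => ∀ φ : I.graph.underlying ≃g SimpleGraph.pathGraph I.n,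
    (∀ v, σ 15 (φ v) = v) → ∀ v : Fin I.n, (φ v : ℕ) < m → τ 16 v = φ v) (by decide) ?_ ?_ ?_ ?_ ?_
  · simpa only [eval, hσ.n] using hY.n
  · intro m σ₁ σ₂ h; simp only [h 16 (by decide)]; exact id
  · intro φ _ v hv; omega
  · intro m hm τ h24 hf hJ
    simp only [eval, hσ.n] at hm
    refine Runs.write fun φ hφ v hv => ?_
    simp only [eval, h24, Function.update_self, hf 15 (by decide) (by decide)]
    have h5 : (φ (φ.symm ⟨m, hm⟩) : ℕ) = m := by simp
    have h6 := hφ (φ.symm ⟨m, hm⟩)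
    rw [h5] at h6
    rw [h6, Function.update_apply]
    split_ifs with h7
    · rw [Fin.ext h7, h5]
    · refine hJ φ hφ v (lt_of_le_of_ne (Nat.lt_succ_iff.1 hv) fun h8 => h7 ?_)
      have : v = φ.symm ⟨m, hm⟩ := φ.injective (Fin.ext (by rw [h8, h5]))
      rw [this]
  · intro τ _ hJ φ hφ v
    refine hJ φ hφ v ?_
    simp only [eval, hσ.n]
    exact Fin.isLt _

/-- Collect the positions close to terminals. -/
def buildCandidates : RAMProgram :=
  .forLoop 24 (var 4) (.forLoop 25 (var 5)
    (.seq (.write 17 (.add (.read 12 (var 24)) (var 25))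
        (.sub (.add (.read 16 (.read 0 (.add (.add (.const 3) (var 24)) (var 24)))) (var 25))
          (var 4)))
      (.write 17 (.add (var 6) (.add (.read 12 (var 24)) (var 25)))
        (.sub (.add (.read 16 (.read 0 (.add (.add (.const 4) (var 24)) (var 24)))) (var 25))
          (var 4)))))

/-- The candidates with numbers less than `m` are correct. -/
def CandidatesUpTo (I : TDWInstance) (σ : RAMState) (cand : ℕ → ℕ) (m : ℕ) : Prop :=
  ∀ i < I.k, ∀ o < 2 * I.k + 1, i * (2 * I.k + 1) + o < m →
    cand (i * (2 * I.k + 1) + o) = σ 16 (I.sourceNat i) + o - I.k ∧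
    cand (I.numLegs + (i * (2 * I.k + 1) + o)) = σ 16 (I.sinkNat i) + o - I.k

theorem buildCandidates_spec {I : TDWInstance} {Y : ℕ} {σ : RAMState} (hσ : HoldsInstance I σ)
    (hY : LoopBound I Y) :
    Runs Y buildCandidates σ fun σ' => CandidatesUpTo I σ (σ' 17) I.numLegs := by
  refine Runs.forLoop (fun i τ => CandidatesUpTo I σ (τ 17) (i * (2 * I.k + 1)))
    (by decide) ?_ ?_ ?_ ?_ ?_
  · simpa only [eval, hσ.k] using hY.k
  · intro m σ₁ σ₂ h; simp only [h 17 (by decide)]; exact id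
  · intro i _ o _ h; omega
  · intro i hi τ h24 hf hJ
    simp only [eval, hσ.k] at hi
    have e5 := hf 5 (by decide) (by decide)
    refine Runs.forLoop (fun o τ => CandidatesUpTo I σ (τ 17) (i * (2 * I.k + 1) + o))
      (by decide) ?_ ?_ ?_ ?_ ?_
    · simpa only [eval, e5, hσ.A] using hY.A
    · intro m σ₁ σ₂ h; simp only [h 17 (by decide)]; exact id
    · exact hJ
    · intro o ho τ₂ h25 hf2 hJ2
      simp only [eval, e5, hσ.A] at ho
      have hf3 : ∀ a, a ≠ 24 ∧ a ≠ 25 ∧ a ≠ 17 → τ₂ a = σ a := fun a h => by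
        rw [hf2 a h.2.1 (by simpa [targets] using h.2.2), hf a h.1 (by
          simp only [targets, RAMProgram.forLoop]
          simp
          omega)]
      have e0 := hf3 0 (by decide)
      have e4 := hf3 4 (by decide)
      have e6 := hf3 6 (by decide)
      have e12 := hf3 12 (by decide)
      have e16 := hf3 16 (by decide)
      have e24 : τ₂ 24 0 = i := by rw [hf2 24 (by decide) (by decide), h24]
      refine Runs.writeSeq fun σ₃ f3 g3 => Runs.write ?_
      have hC := hσ.C
      simp only [eval, f3 24 (by decide), e24, f3 25 (by decide), h25, f3 16 (by decide), e16,
        f3 0 (by decide), e0, f3 4 (by decide), e4, hσ.k, f3 6 (by decide), e6, hσ.C,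
        f3 12 (by decide), e12, hσ.mulA i hi.le, hσ.source i hi, hσ.sink i hi, g3,
        Function.update_self]
      intro i' hi' o' ho' hlt
      have h1 := I.leg_lt hi ho
      have h2 := I.leg_lt hi' ho'
      rcases eq_or_ne (i' * (2 * I.k + 1) + o') (i * (2 * I.k + 1) + o) with heq | hne
      · have h3 : i' = i := by
          have h4 := congrArg (· / (2 * I.k + 1)) heq
          simpa [Nat.mul_comm _ (2 * I.k + 1), Nat.mul_add_div, Nat.div_eq_of_lt, ho, ho'] using h4
        subst h3
        obtain rfl : o' = o := by omega
        refine ⟨?_, ?_⟩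
        · rw [Function.update_of_ne (by unfold TDWInstance.numLegs at *; omega),
            Function.update_self]
        · exact Function.update_self _ _ _
      · obtain ⟨h5, h6⟩ := hJ2 i' hi' o' ho' (by omega)
        rw [Function.update_of_ne (by unfold TDWInstance.numLegs at *; omega),
          Function.update_of_ne (by omega),
          Function.update_of_ne (by unfold TDWInstance.numLegs at *; omega),
          Function.update_of_ne (by unfold TDWInstance.numLegs at *; omega)]
        exact ⟨h5, h6⟩
    · intro τ₂ _ hJ2
      simp only [eval, e5, hσ.A] at hJ2
      rwa [Nat.succ_mul]
  · intro τ _ hJ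
    simpa only [eval, hσ.k] using hJ

/-- The offsets from `-k` to `k` are shifted by `k` to natural numbers. Each of the `2 * k` source
and sink slots has `2 * k + 1` of them, which gives `2 * numLegs` candidates, the base of the
digits. Candidates truncated at `0` are superfluous but harmless. -/
theorem CandidatesUpTo.exists_digit {I : TDWInstance} {σ : RAMState} {cand : ℕ → ℕ}
    (h : CandidatesUpTo I σ cand I.numLegs) {v : Fin I.n} (hv : v ∈ I.terminals) {w : ℕ}
    (h1 : w ≤ σ 16 v + I.k) (h2 : σ 16 v ≤ w + I.k) : ∃ d < 2 * I.numLegs, cand d = w := by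
  have ho : w + I.k - σ 16 v < 2 * I.k + 1 := by omega
  rcases hv with ⟨i, rfl⟩ | ⟨i, rfl⟩
  · have h3 := I.leg_lt i.2 ho
    refine ⟨_, by omega, (h i i.2 _ ho h3).1.trans ?_⟩
    rw [TDWInstance.sourceNat, dif_pos i.2]
    simp only [Fin.eta]
    omega
  · have h3 := I.leg_lt i.2 ho
    refine ⟨_, by omega, (h i i.2 _ ho h3).2.trans ?_⟩
    rw [TDWInstance.sinkNat, dif_pos i.2]
    simp only [Fin.eta]
    omega

theorem exists_digits {B : ℕ} (L : ℕ) (d : ℕ → ℕ) (hd : ∀ j, d j < B) :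
    ∃ g < B ^ L, ∀ j < L, g / B ^ j % B = d j := by
  induction L generalizing d with
  | zero => exact ⟨0, by simp, fun j hj => by omega⟩
  | succ L ih =>
    obtain ⟨g, h1, h2⟩ := ih (fun j => d (j + 1)) fun j => hd _
    have hB : 0 < B := (Nat.zero_le _).trans_lt (hd 0)
    refine ⟨d 0 + B * g, ?_, fun j hj => ?_⟩
    · have := Nat.mul_le_mul_left B (Nat.succ_le_of_lt h1)
      rw [Nat.mul_succ] at this
      rw [pow_succ']
      have := hd 0
      omega
    · cases j with
      | zero => rw [pow_zero, Nat.div_one, Nat.add_mul_mod_self_left, Nat.mod_eq_of_lt (hd 0)]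
      | succ j =>
        rw [pow_succ', ← Nat.div_div_eq_div_mul, Nat.add_mul_div_left _ _ hB,
          Nat.div_eq_of_lt (hd 0), zero_add]
        exact h2 j (by omega)

/-- If there is a solution, then there is a good guess. -/
theorem exists_isGoodGuess {I : TDWInstance} (hk : 0 < I.k) (hsol : ∃ W, I.IsSolution W)
    {σ : RAMState} {cand : ℕ → ℕ} (φ : I.graph.underlying ≃g SimpleGraph.pathGraph I.n)
    (hord : ∀ v, σ 15 (φ v) = v) (hpos : ∀ v : Fin I.n, σ 16 v = φ v)
    (hcand : CandidatesUpTo I σ cand I.numLegs) :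
    ∃ g < (2 * I.numLegs) ^ I.numDigits, IsGoodGuess I (σ 15) (σ 16) cand g := by
  obtain ⟨ws, bit, hlen, hws, hbit, hreach⟩ := I.exists_waypoints_and_order φ hsol
  have hC : 0 < I.numLegs := Nat.mul_pos hk (Nat.succ_pos _)
  -- A digit is chosen for every `j`; beyond the waypoint digits the requirement is vacuous and `0`
  -- will do.
  have hex : ∀ j, ∃ d < 2 * I.numLegs, ∀ i : Fin I.k, ∀ a < 2 * I.k + 1,
      j = i * (2 * I.k + 1) + a → cand d = (ws i).getD a 0 := by
    intro j
    rcases Nat.lt_or_ge j I.numLegs with hj | hj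
    · have hi : j / (2 * I.k + 1) < I.k := Nat.div_lt_of_lt_mul (by rwa [mul_comm])
      have ha : j % (2 * I.k + 1) < 2 * I.k + 1 := Nat.mod_lt _ (Nat.succ_pos _)
      obtain ⟨v, hv, h1, h2⟩ := hws ⟨_, hi⟩ ((ws ⟨_, hi⟩).getD (j % (2 * I.k + 1)) 0) (by
        rw [List.getD_eq_getElem _ _ (by rw [hlen]; exact ha)]
        exact List.getElem_mem _)
      rw [← hpos] at h1 h2
      obtain ⟨d, hd, h3⟩ := hcand.exists_digit hv h1 h2
      refine ⟨d, hd, fun i a ha' hja => ?_⟩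
      have h4 : j / (2 * I.k + 1) = i := by
        rw [hja, mul_comm, Nat.mul_add_div (Nat.succ_pos _), Nat.div_eq_of_lt ha', add_zero]
      have h5 : j % (2 * I.k + 1) = a := by
        rw [hja, mul_comm, Nat.mul_add_mod, Nat.mod_eq_of_lt ha']
      have h6 : (⟨_, hi⟩ : Fin I.k) = i := Fin.ext h4
      rw [h3, h6, h5]
    · refine ⟨0, by omega, fun i a ha hja => ?_⟩
      have := I.leg_lt i.2 ha
      omega
  choose d hd hd' using hex
  -- The order bits are at most `1` and hence admissible digits, because the base is at least `2`.
  obtain ⟨g, hg, hdig⟩ := exists_digits (B := 2 * I.numLegs) I.numDigits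
    (fun j => if j < I.numLegs then d j else bit (j / I.numLegs - 1) (j % I.numLegs))
    (fun j => by
      split_ifs
      · exact hd j
      · have := hbit (j / I.numLegs - 1) (j % I.numLegs)
        omega)
  refine ⟨g, hg, φ, ws, bit, hreach, hlen, hord, hpos, fun i a ha => ?_, fun x hx y hy => ?_⟩
  · have h1 := I.leg_lt i.2 ha
    rw [hdig _ (by simpa using I.digit_lt (x := 0) (by omega) h1), if_pos h1]
    exact hd' _ i a ha rfl
  · rw [hdig _ (I.digit_lt (by omega) hy), if_neg, mul_comm, Nat.mul_add_div hC,
      Nat.div_eq_of_lt hy, Nat.mul_add_mod, Nat.mod_eq_of_lt hy]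
    · simp
    · rw [Nat.succ_mul]
      omega

/-! ### Trying all orders -/

/-- Try all guesses for the order that starts with the vertex in `23`. -/
def tryOrder : RAMProgram :=
  .seq buildOrder (.seq buildPositions (.seq buildCandidates (.forLoop 27 (var 9) tryGuess)))

/-- A wrong first vertex cannot cause a wrong acceptance, since accepted guesses yield solutions
regardless of the order. Only completeness needs `v₀` to be an end of the line. -/
theorem tryOrder_spec {I : TDWInstance} {Y v₀ : ℕ} {σ : RAMState} (hσ : HoldsInstance I σ)
    (hσ' : HoldsGuessing I σ) (hY : LoopBound I Y) (hv₀ : σ 23 0 = v₀) (hv₀n : v₀ < I.n)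
    (hord : ∀ p, σ 15 p < I.n) (hR : ∀ y, σ 30 y < I.n) :
    Runs Y tryOrder σ fun σ' => (∀ p, σ' 15 p < I.n) ∧ (∀ y, σ' 30 y < I.n) ∧
      (σ' 1 0 ≠ 0 → σ 1 0 ≠ 0 ∨ ∃ W, I.IsSolution W) ∧ (σ 1 0 ≠ 0 → σ' 1 0 ≠ 0) ∧
      ((∃ φ : I.graph.underlying ≃g SimpleGraph.pathGraph I.n, (φ ⟨v₀, hv₀n⟩ : ℕ) = 0) →
        (∃ W, I.IsSolution W) → σ' 1 0 ≠ 0) := by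
  refine Runs.seq ((buildOrder_spec hσ hY hv₀ hv₀n hord).conseq fun σ₁ f1 ⟨hord₁, hφ₁⟩ => ?_)
  have hσ₁ : HoldsInstance I σ₁ := hσ.congr fun a ha => f1 a (by revert a; decide)
  refine Runs.seq ((buildPositions_spec hσ₁ hY).conseq fun σ₂ f2 hpos => ?_)
  have hσ₂ : HoldsInstance I σ₂ := hσ₁.congr fun a ha => f2 a (by revert a; decide)
  refine Runs.seq ((buildCandidates_spec hσ₂ hY).conseq fun σ₃ f3 hcand => ?_)
  have hσ₃ : HoldsInstance I σ₃ := hσ₂.congr fun a ha => f3 a (by revert a; decide)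
  have keep : ∀ a ∈ [1, 7, 8, 9, 30], σ₃ a = σ a := fun a ha => by
    rw [f3 a (by revert a; decide), f2 a (by revert a; decide), f1 a (by revert a; decide)]
  have g9 : σ₃ 9 0 = (2 * I.numLegs) ^ I.numDigits := by rw [keep 9 (by decide), hσ'.guesses]
  have g15 : σ₃ 15 = σ₁ 15 := by rw [f3 15 (by decide), f2 15 (by decide)]
  refine Runs.forLoop (fun g τ => (∀ y, τ 30 y < I.n) ∧
    (τ 1 0 ≠ 0 → σ 1 0 ≠ 0 ∨ ∃ W, I.IsSolution W) ∧ (σ 1 0 ≠ 0 → τ 1 0 ≠ 0) ∧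
    ∀ g' < g, IsGoodGuess I (σ₃ 15) (σ₃ 16) (σ₃ 17) g' → τ 1 0 ≠ 0) (by decide) ?_ ?_ ?_ ?_ ?_
  · simpa only [eval, g9] using hY.guesses
  · intro g σ₁ σ₂ h; simp only [h 30 (by decide), h 1 (by decide)]; exact id
  · rw [keep 30 (by decide), keep 1 (by decide)]
    exact ⟨hR, Or.inl, id, fun g hg => absurd hg (by simp)⟩
  · rintro g hg τ h27 hf ⟨h1, h2, h3, h4⟩
    simp only [eval, g9] at hg
    have hfr : ∀ a ∈ [0, 2, 3, 4, 5, 6, 7, 8, 9, 10, 11, 12, 13, 15, 16, 17], τ a = σ₃ a :=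
      fun a ha => by
        have : a ≠ 27 ∧ a ∉ tryGuess.targets := by revert a; decide
        exact hf a this.1 this.2
    have hτ : HoldsInstance I τ := hσ₃.congr fun a ha => hfr a (by revert a; decide)
    have hτ' : HoldsGuessing I τ := by
      constructor
      · rw [hfr 7 (by decide), keep 7 (by decide), hσ'.base]
      · rw [hfr 8 (by decide), keep 8 (by decide), hσ'.digits]
      · rw [hfr 9 (by decide), g9]
    refine (tryGuess_spec hτ hτ' hY (by rw [hfr 15 (by decide), g15]; exact hord₁) h1 h27
      (hg.le.trans hY.guesses)).conseq ?_
    rintro τ' - ⟨k1, k2, k3, k4⟩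
    rw [hfr 15 (by decide), hfr 16 (by decide), hfr 17 (by decide)] at k4
    refine ⟨k1, fun h => (k2 h).elim h2 Or.inr, fun h => k3 (h3 h), fun g' hg' hgood => ?_⟩
    rcases Nat.lt_succ_iff_lt_or_eq.1 hg' with h | rfl
    · exact k3 (h4 g' h hgood)
    · exact k4 hgood
  · rintro τ hf ⟨h1, h2, h3, h4⟩
    simp only [eval, g9] at h4
    refine ⟨by rw [hf 15 (by decide) (by decide), g15]; exact hord₁, h1, h2, h3, ?_⟩
    rintro ⟨φ, hφ⟩ hsol
    have k1 : ∀ v, σ₁ 15 (φ v) = v := fun v =>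
      (hφ₁ φ fun v hv => by rwa [← Fin.ext (a := v) (b := ⟨v₀, hv₀n⟩) hv] at hφ).1 v (φ v).2.le
    have k2 := hpos φ k1
    obtain ⟨g, hg, hgood⟩ := exists_isGoodGuess hY.pos hsol (σ := σ₂) φ
      (by rwa [f2 15 (by decide)]) k2 hcand
    rw [← f3 15 (by decide), ← f3 16 (by decide)] at hgood
    exact h4 g hg hgood

/-- Try all orders. -/
def search : RAMProgram := .forLoop 23 (var 2) tryOrder

theorem search_spec {I : TDWInstance} {Y : ℕ} {σ : RAMState} (hI : I.graph.IsLine)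
    (hσ : HoldsInstance I σ) (hσ' : HoldsGuessing I σ) (hY : LoopBound I Y) (h1 : σ 1 0 = 0)
    (hord : ∀ p, σ 15 p < I.n) (hR : ∀ y, σ 30 y < I.n) :
    Runs Y search σ fun σ' => σ' 1 0 ≠ 0 ↔ ∃ W, I.IsSolution W := by
  obtain ⟨φ⟩ := hI
  refine Runs.forLoop (fun m τ => (∀ p, τ 15 p < I.n) ∧ (∀ y, τ 30 y < I.n) ∧
    (τ 1 0 ≠ 0 → ∃ W, I.IsSolution W) ∧
    ∀ v : Fin I.n, (φ v : ℕ) = 0 → (v : ℕ) < m → (∃ W, I.IsSolution W) → τ 1 0 ≠ 0)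
    (by decide) ?_ ?_ ?_ ?_ ?_
  · simpa only [eval, hσ.n] using hY.n
  · intro g σ₁ σ₂ h
    simp only [h 15 (by decide), h 30 (by decide), h 1 (by decide)]
    exact id
  · exact ⟨hord, hR, fun h => absurd h1 h, fun v _ hv => absurd hv (by simp)⟩
  · rintro v₀ hv₀ τ h23 hf ⟨h1, h2, h3, h4⟩
    simp only [eval, hσ.n] at hv₀
    have hfr : ∀ a ∈ [0, 2, 3, 4, 5, 6, 7, 8, 9, 10, 11, 12, 13], τ a = σ a := fun a ha => by
      have : a ≠ 23 ∧ a ∉ tryOrder.targets := by revert a; decide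
      exact hf a this.1 this.2
    have hτ : HoldsInstance I τ := hσ.congr fun a ha => hfr a (by revert a; decide)
    have hτ' : HoldsGuessing I τ := by
      constructor
      · rw [hfr 7 (by decide), hσ'.base]
      · rw [hfr 8 (by decide), hσ'.digits]
      · rw [hfr 9 (by decide), hσ'.guesses]
    refine (tryOrder_spec hτ hτ' hY h23 hv₀ h1 h2).conseq ?_
    rintro τ' - ⟨k1, k2, k3, k4, k5⟩
    refine ⟨k1, k2, fun h => (k3 h).elim h3 id, fun v hv hvm hsol => ?_⟩
    rcases Nat.lt_succ_iff_lt_or_eq.1 hvm with h | rfl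
    · exact k4 (h4 v hv h hsol)
    · exact k5 ⟨φ, hv⟩ hsol
  · rintro τ - ⟨-, -, h3, h4⟩
    refine ⟨h3, fun hsol => ?_⟩
    have hn : 0 < I.n := (Nat.zero_le _).trans_lt (I.source ⟨0, hY.pos⟩).2
    refine h4 (φ.symm ⟨0, hn⟩) (by simp) ?_ hsol
    simp only [eval, hσ.n]
    exact Fin.isLt _

/-! ### Preparing the memory -/

/-- Fill the array `a` with an arithmetic progression. -/
def multiples (a : ℕ) (count start step : RAMExpr) : RAMProgram :=
  .seq (.write a (.const 0) start)
    (.forLoop 20 count (.write a (.add (var 20) (.const 1)) (.add (.read a (var 20)) step)))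

/-- In the absence of multiplication, products are tabulated by repeated addition. The expression
`step` is evaluated anew in each round, so its value must not depend on the table or the counter. -/
theorem multiples_spec {Y a m s d : ℕ} {count start step : RAMExpr} {σ : RAMState} (ha : a ≠ 20)
    (hcount : ∀ τ : RAMState, (∀ b, b ≠ a → τ b = σ b) → count.eval τ = m)
    (hstart : start.eval σ = s) (hm : m ≤ Y)
    (hstep : ∀ τ : RAMState, (∀ b, b ≠ a → b ≠ 20 → τ b = σ b) → step.eval τ = d) :
    Runs Y (multiples a count start step) σ fun σ' => ∀ j ≤ m, σ' a j = s + j * d := by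
  refine Runs.writeSeq fun σ₁ f1 g1 => ?_
  refine Runs.forLoop (fun m τ => ∀ j ≤ m, τ a j = s + j * d) (by simpa [targets] using ha.symm)
    (by rwa [hcount σ₁ f1]) ?_ ?_ ?_ ?_
  · intro m σ₁ σ₂ h; simp only [h a ha]; exact id
  · rintro j hj
    obtain rfl : j = 0 := by omega
    simp [g1, hstart]
  · intro i hi τ h20 hf hJ
    refine Runs.write fun j hj => ?_
    have h1 := hstep τ fun b hb hb' => by
      rw [hf b hb' (by simpa [targets] using hb), f1 b hb]
    simp only [eval, h20, h1, hJ i le_rfl, Function.update_self]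
    rcases Nat.le_succ_iff.1 hj with h | rfl
    · rw [Function.update_of_ne (by omega), hJ j h]
    · rw [Function.update_self, Nat.succ_mul, add_assoc]
  · intro τ _ hJ
    rwa [hcount σ₁ f1] at hJ

/-- Compute a power by repeated addition. -/
def power : RAMProgram :=
  .seq (.write 9 (.const 0) (.const 1))
    (.forLoop 20 (var 8) (.seq (.write 46 (.const 0) (.const 0))
      (.seq (.forLoop 21 (var 7) (.write 46 (.const 0) (.add (var 46) (var 9))))
        (.write 9 (.const 0) (var 46)))))

theorem power_spec {Y : ℕ} {σ : RAMState} (h7 : σ 7 0 ≤ Y) (h8 : σ 8 0 ≤ Y) :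
    Runs Y power σ fun σ' => σ' 9 0 = σ 7 0 ^ σ 8 0 := by
  refine Runs.writeSeq fun σ₁ f1 g1 => ?_
  refine Runs.forLoop (fun m τ => τ 9 0 = σ 7 0 ^ m) (by decide) ?_ ?_ ?_ ?_ ?_
  · simpa only [eval, f1 8 (by decide)] using h8
  · intro m σ₁ σ₂ h; simp only [h 9 (by decide)]; exact id
  · simp [g1]
  · intro i _ τ _ hf hJ
    refine Runs.writeSeq fun σ₂ f2 g2 => Runs.seq ?_
    have e7 : σ₂ 7 = σ 7 := by
      rw [f2 7 (by decide), hf 7 (by decide) (by decide), f1 7 (by decide)]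
    refine Runs.forLoop (fun m τ' => τ' 46 0 = m * σ 7 0 ^ i) (by decide) ?_ ?_ ?_ ?_ ?_
    · simpa only [eval, e7] using h7
    · intro m σ₁ σ₂ h; simp only [h 46 (by decide)]; exact id
    · simp [g2]
    · intro j _ τ' _ hf' hJ'
      refine Runs.write ?_
      simp only [eval, Function.update_self, hJ', hf' 9 (by decide) (by decide),
        f2 9 (by decide), hJ, Nat.succ_mul]
    · intro τ' _ hJ'
      refine Runs.write ?_
      simp only [eval, Function.update_self, e7] at hJ' ⊢
      rw [hJ', pow_succ']
  · intro τ _ hJ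
    simpa only [eval, f1 8 (by decide)] using hJ

/-- The word `x` represents the instance `I`. -/
structure Represents (x : ℕ → ℕ) (I : TDWInstance) : Prop where
  n : x 0 = I.n
  T : x 1 = I.T
  k : x 2 = I.k
  adj : ∀ t < I.T, ∀ u < I.n, ∀ v < I.n,
    x (3 + I.k + I.k + t * (I.n * I.n) + u * I.n + v) ≠ 0 ↔ I.NatAdj t u v
  source : ∀ i < I.k, x (3 + i + i) = I.sourceNat i
  sink : ∀ i < I.k, x (4 + i + i) = I.sinkNat i

/-- Compute the tables that depend on the instance. -/
def prepare : RAMProgram :=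
  .seq (.write 5 (.const 0) (.add (.add (var 4) (var 4)) (.const 1)))
    (.seq (multiples 10 (var 2) (.const 0) (var 2))
    (.seq (multiples 11 (var 3) (.add (.add (.const 3) (var 4)) (var 4)) (.read 10 (var 2)))
    (.seq (multiples 12 (var 4) (.const 0) (var 5))
    (.seq (.write 6 (.const 0) (.read 12 (var 4)))
    (.seq (.write 7 (.const 0) (.add (var 6) (var 6)))
    (.seq (multiples 13 (.add (var 6) (.const 1)) (.const 0) (var 6))
    (.seq (.write 8 (.const 0) (.read 13 (.add (var 6) (.const 1)))) power)))))))

/-- Products are read off at the ends of tables: `n * n` from array `10`, `numLegs` from array `12`,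
and `numDigits` from array `13`. -/
theorem prepare_spec {I : TDWInstance} {Y : ℕ} {σ : RAMState} (hx : Represents (σ 0) I)
    (hY : LoopBound I Y) (hn : σ 2 0 = I.n) (hT : σ 3 0 = I.T) (hk : σ 4 0 = I.k) :
    Runs Y prepare σ fun σ' => HoldsInstance I σ' ∧ HoldsGuessing I σ' := by
  refine Runs.writeSeq fun σ₁ f1 g1 => Runs.seq ?_
  refine (multiples_spec (m := I.n) (s := 0) (d := I.n) (by decide)
    (fun τ h => by rw [eval, h 2 (by decide), eval, f1 2 (by decide), hn]) rfl hY.n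
    (fun τ h => by rw [eval, h 2 (by decide) (by decide), eval, f1 2 (by decide), hn])).conseq
    fun σ₂ f2 g2 => Runs.seq ?_
  have k2 : σ₂ 2 0 = I.n := by rw [f2 2 (by decide), f1 2 (by decide), hn]
  have k3 : σ₂ 3 0 = I.T := by rw [f2 3 (by decide), f1 3 (by decide), hT]
  have k4 : σ₂ 4 0 = I.k := by rw [f2 4 (by decide), f1 4 (by decide), hk]
  have k5 : σ₂ 5 0 = 2 * I.k + 1 := by
    rw [f2 5 (by decide), g1]
    simp only [eval, Function.update_self, hk]
    omega
  refine (multiples_spec (m := I.T) (s := 3 + I.k + I.k) (d := I.n * I.n) (by decide)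
    (fun τ h => by rw [eval, h 3 (by decide), eval, k3]) (by simp only [eval, k4]) hY.T
    (fun τ h => by
      simp only [eval, h 2 (by decide) (by decide), h 10 (by decide) (by decide), k2,
        g2 I.n le_rfl, zero_add])).conseq
    fun σ₃ f3 g3 => Runs.seq ?_
  refine (multiples_spec (m := I.k) (s := 0) (d := 2 * I.k + 1) (by decide)
    (fun τ h => by rw [eval, h 4 (by decide), eval, f3 4 (by decide), k4]) rfl hY.k
    (fun τ h => by
      rw [eval, h 5 (by decide) (by decide), eval, f3 5 (by decide), k5])).conseq
    fun σ₄ f4 g4 => ?_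
  refine Runs.writeSeq fun σ₅ f5 g5 => Runs.writeSeq fun σ₆ f6 g6 => Runs.seq ?_
  have k6 : σ₆ 6 0 = I.k * (2 * I.k + 1) := by
    rw [f6 6 (by decide), g5]
    simp only [eval, Function.update_self, f4 4 (by decide), f3 4 (by decide), k4,
      g4 I.k le_rfl, zero_add]
  refine (multiples_spec (m := I.numLegs + 1) (s := 0) (d := I.numLegs) (by decide)
    (fun τ h => by simp only [eval, h 6 (by decide), k6]) rfl hY.C
    (fun τ h => by simp only [eval, h 6 (by decide) (by decide), k6])).conseq
    fun σ₇ f7 g7 => ?_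
  refine Runs.writeSeq fun σ₈ f8 g8 => ?_
  have m7 : σ₈ 7 0 = 2 * I.numLegs := by
    rw [f8 7 (by decide), f7 7 (by decide), g6]
    have : σ₅ 6 0 = I.numLegs := by rw [← f6 6 (by decide), k6]
    simp only [eval, Function.update_self, this]
    omega
  have m8 : σ₈ 8 0 = I.numDigits := by
    have : σ₇ 6 0 = I.numLegs := by rw [f7 6 (by decide), k6]
    rw [g8]
    simp only [eval, Function.update_self, this, g7 _ le_rfl, zero_add]
  refine (power_spec (by rw [m7]; exact hY.B) (by rw [m8]; exact hY.L)).conseq fun σ₉ f9 g9 => ?_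
  have low : ∀ a ∈ [0, 2, 3, 4, 5, 10], σ₉ a = σ₂ a := fun a ha => by
    rw [f9 a (by revert a; decide), f8 a (by revert a; decide), f7 a (by revert a; decide),
      f6 a (by revert a; decide), f5 a (by revert a; decide), f4 a (by revert a; decide),
      f3 a (by revert a; decide)]
  have l0 : σ₉ 0 = σ 0 := by rw [low 0 (by decide), f2 0 (by decide), f1 0 (by decide)]
  have l11 : σ₉ 11 = σ₃ 11 := by
    rw [f9 11 (by decide), f8 11 (by decide), f7 11 (by decide), f6 11 (by decide),
      f5 11 (by decide), f4 11 (by decide)]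
  have l12 : σ₉ 12 = σ₄ 12 := by
    rw [f9 12 (by decide), f8 12 (by decide), f7 12 (by decide), f6 12 (by decide),
      f5 12 (by decide)]
  have l13 : σ₉ 13 = σ₇ 13 := by rw [f9 13 (by decide), f8 13 (by decide)]
  refine ⟨⟨?_, ?_, ?_, ?_, ?_, ?_, ?_, ?_, ?_, ?_⟩, ?_, ?_, ?_⟩
  · rw [low 2 (by decide), k2]
  · rw [low 3 (by decide), k3]
  · rw [low 4 (by decide), k4]
  · rw [low 5 (by decide), k5]
  · rw [f9 6 (by decide), f8 6 (by decide), f7 6 (by decide), k6]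
  · intro t ht u hu v hv
    rw [l0, l11, low 10 (by decide), g3 t ht.le, g2 u hu.le, zero_add]
    exact hx.adj t ht u hu v hv
  · rw [l0]; exact hx.source
  · rw [l0]; exact hx.sink
  · intro i hi
    rw [l12, g4 i hi, zero_add]
  · intro y hy
    rw [l13, g7 y hy, zero_add]
  · rw [f9 7 (by decide), m7]
  · rw [f9 8 (by decide), m8]
  · rw [g9, m7, m8]

/-- The program that decides Temporally Disjoint Walks on temporal lines. -/
def solveLine : RAMProgram :=
  .seq (.write 2 (.const 0) (.read 0 (.const 0)))
    (.seq (.write 3 (.const 0) (.read 0 (.const 1)))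
    (.seq (.write 4 (.const 0) (.read 0 (.const 2)))
      (.cond (var 4) (.seq prepare search) (.write 1 (.const 0) (.const 1)))))

theorem solveLine_spec {I : TDWInstance} {Y : ℕ} {x : List ℕ} (hI : I.graph.IsLine)
    (hx : Represents (x.getD · 0) I) (hY : 0 < I.k → LoopBound I Y) :
    Runs Y solveLine (RAMState.init x) fun σ' => σ' 1 0 ≠ 0 ↔ ∃ W, I.IsSolution W := by
  refine Runs.writeSeq fun σ₁ f1 g1 => Runs.writeSeq fun σ₂ f2 g2 =>
    Runs.writeSeq fun σ₃ f3 g3 => ?_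
  have hfr : ∀ a, a ≠ 2 → a ≠ 3 → a ≠ 4 → σ₃ a = RAMState.init x a := fun a h2 h3 h4 => by
    rw [f3 a h4, f2 a h3, f1 a h2]
  have hi : RAMState.init x 0 = fun i => x.getD i 0 := by
    funext i; simp [RAMState.init]
  have e2 : σ₃ 2 0 = I.n := by
    rw [f3 2 (by decide), f2 2 (by decide), g1]
    simpa [hi] using hx.n
  have e3 : σ₃ 3 0 = I.T := by
    rw [f3 3 (by decide), g2]
    simpa [hi, f1 0 (by decide)] using hx.T
  have e4 : σ₃ 4 0 = I.k := by
    rw [g3]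
    simpa [hi, f2 0 (by decide), f1 0 (by decide)] using hx.k
  have zero : ∀ a, a ≠ 0 → a ≠ 2 → a ≠ 3 → a ≠ 4 → ∀ j, σ₃ a j = 0 := fun a h0 h2 h3 h4 j => by
    rw [hfr a h2 h3 h4]
    simp [RAMState.init, h0]
  refine Runs.cond (fun hb => ?_) (fun hb => Runs.write ?_)
  · simp only [eval, e4] at hb
    have hk := Nat.pos_of_ne_zero hb
    -- A source exists, so `0` is a vertex. The zeros that initially fill arrays `15` and `30` are
    -- therefore names of vertices.
    have hn : 0 < I.n := (Nat.zero_le _).trans_lt (I.source ⟨0, hk⟩).2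
    refine Runs.seq ((prepare_spec (by
      rw [hfr 0 (by decide) (by decide) (by decide), hi]; exact hx) (hY hk) e2 e3 e4).conseq
      fun σ₄ f4 ⟨h1, h2⟩ => ?_)
    refine search_spec hI h1 h2 (hY hk) ?_ (fun p => ?_) (fun p => ?_)
    · rw [f4 1 (by decide), zero 1 (by decide) (by decide) (by decide) (by decide)]
    · rwa [f4 15 (by decide), zero 15 (by decide) (by decide) (by decide) (by decide)]
    · rwa [f4 30 (by decide), zero 30 (by decide) (by decide) (by decide) (by decide)]
  · simp only [eval, e4] at hb
    simp only [eval, Function.update_self, ne_eq, one_ne_zero, not_false_eq_true, true_iff]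
    have : IsEmpty (Fin I.k) := by rw [hb]; infer_instance
    exact ⟨isEmptyElim, isEmptyElim, isEmptyElim⟩

/-! ### The input word -/

theorem List.length_flatMap_of_forall {α β : Type*} {c : ℕ} {f : α → List β} (l : List α)
    (h : ∀ a ∈ l, (f a).length = c) : (l.flatMap f).length = l.length * c := by
  induction l with
  | nil => simp
  | cons a l ih =>
    rw [List.flatMap_cons, List.length_append, h a (by simp), ih fun b hb => h b (by simp [hb]),
      List.length_cons, Nat.succ_mul, add_comm]

theorem List.getD_flatMap_of_forall {α β : Type*} {c : ℕ} {f : α → List β} (l : List α)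
    (h : ∀ a ∈ l, (f a).length = c) (d : β) {i j : ℕ} (hi : i < l.length) (hj : j < c) :
    (l.flatMap f).getD (i * c + j) d = (f l[i]).getD j d := by
  induction l generalizing i with
  | nil => simp at hi
  | cons a l ih =>
    have ha := h a (by simp)
    rw [List.flatMap_cons]
    cases i with
    | zero =>
      rw [List.getD_append _ _ _ _ (by omega)]
      simp
    | succ i =>
      rw [List.getD_append_right _ _ _ _ (by rw [ha, Nat.succ_mul]; omega), ha,
        show (i + 1) * c + j - c = i * c + j by rw [Nat.succ_mul]; omega]
      exact ih (fun b hb => h b (by simp [hb])) (by simpa using hi)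

theorem TDWInstance.length_encode (I : TDWInstance) :
    I.encode.length = 3 + I.k * 2 + I.T * (I.n * I.n) := by
  rw [TDWInstance.encode, List.length_append, List.length_append,
    List.length_flatMap_of_forall (c := 2) _ (by simp),
    List.length_flatMap_of_forall (c := I.n * I.n)]
  · simp
  · intro t _
    rw [List.length_flatMap_of_forall (c := I.n) _ (by simp)]
    simp

theorem TDWInstance.represents_encode (I : TDWInstance) : Represents (I.encode.getD · 0) I := by
  have hlen : ((List.finRange I.k).flatMap
      fun i => [(I.source i : ℕ), (I.sink i : ℕ)]).length = I.k * 2 := by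
    rw [List.length_flatMap_of_forall (c := 2) _ (by simp)]
    simp
  have hpair : ∀ i (hi : i < I.k) j, j < 2 → I.encode.getD (3 + (i * 2 + j)) 0 =
      [(I.source ⟨i, hi⟩ : ℕ), (I.sink ⟨i, hi⟩ : ℕ)].getD j 0 := by
    intro i hi j hj
    rw [TDWInstance.encode, List.append_assoc, List.getD_append_right _ _ _ _ (by simp),
      List.getD_append _ _ _ _ (by rw [hlen]; simp; omega)]
    simp only [List.length_cons, List.length_nil, zero_add, Nat.reduceAdd, Nat.add_sub_cancel_left]
    rw [List.getD_flatMap_of_forall _ (by simp) _ (by simpa using hi) hj]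
    simp
  refine ⟨rfl, rfl, rfl, fun t ht u hu v hv => ?_, fun i hi => ?_, fun i hi => ?_⟩
  · have h1 : u * I.n + v < I.n * I.n := by
      have := Nat.mul_le_mul_right I.n (Nat.succ_le_of_lt hu)
      rw [Nat.succ_mul] at this
      omega
    have h2 : I.encode.getD (3 + I.k + I.k + t * (I.n * I.n) + u * I.n + v) 0 =
        open Classical in
        if (I.graph.layer ⟨t, ht⟩).Adj ⟨u, hu⟩ ⟨v, hv⟩ then 1 else 0 := by
      have h3 : ([I.n, I.T, I.k] ++ ((List.finRange I.k).flatMap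
          fun i => [(I.source i : ℕ), (I.sink i : ℕ)])).length = 3 + I.k * 2 := by
        rw [List.length_append, hlen]
        simp
      rw [TDWInstance.encode, List.getD_append_right _ _ _ _ (by rw [h3]; omega), h3,
        show 3 + I.k + I.k + t * (I.n * I.n) + u * I.n + v - (3 + I.k * 2) =
          t * (I.n * I.n) + (u * I.n + v) by omega,
        List.getD_flatMap_of_forall _ (fun t _ => by
          rw [List.length_flatMap_of_forall (c := I.n) _ (by simp)]
          simp) _ (by simpa using ht) h1,
        List.getD_flatMap_of_forall _ (by simp) _ (by simpa using hu) hv,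
        List.getD_eq_getElem _ _ (by simpa using hv), List.getElem_map]
      have et : ∀ h, (List.finRange I.T)[t]'h = ⟨t, ht⟩ := fun _ => by simp
      have eu : ∀ h, (List.finRange I.n)[u]'h = ⟨u, hu⟩ := fun _ => by simp
      have ev : ∀ h, (List.finRange I.n)[v]'h = ⟨v, hv⟩ := fun _ => by simp
      rw [et, eu, ev]
    simp only [h2, TDWInstance.NatAdj, ht, hu, hv, exists_true_left]
    simp
  · have := hpair i hi 0 (by omega)
    simp only [List.getD_cons_zero] at this
    rw [TDWInstance.sourceNat, dif_pos hi, ← this]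
    congr 1
    omega
  · have := hpair i hi 1 (by omega)
    simp only [List.getD_cons_succ, List.getD_cons_zero] at this
    rw [TDWInstance.sinkNat, dif_pos hi, ← this]
    congr 1
    omega

/-- The number of loop iterations is bounded by the number of guesses and a polynomial. -/
theorem TDWInstance.loopBound (I : TDWInstance) (hI : I.graph.IsLine) (hk : 0 < I.k) :
    LoopBound I ((2 * I.numLegs) ^ I.numDigits * I.encode.length ^ 4) := by
  have hm := I.length_encode
  set m := I.encode.length
  have hn : 0 < I.n := (Nat.zero_le _).trans_lt (I.source ⟨0, hk⟩).2
  -- For `T > 0` the input contains matrices with `n * n` entries. For `T = 0` there are none, but a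
  -- path without edges has a single vertex.
  have hnT : I.n ≤ m ∧ I.T ≤ m := by
    rcases Nat.eq_zero_or_pos I.T with hT | hT
    · refine ⟨?_, by omega⟩
      by_contra! hn2
      obtain ⟨φ⟩ := hI
      have h1 : (SimpleGraph.pathGraph I.n).Adj (φ (φ.symm ⟨0, hn⟩))
          (φ (φ.symm ⟨1, by omega⟩)) := by
        rw [SimpleGraph.pathGraph_adj]
        simp
      rw [φ.map_adj_iff] at h1
      obtain ⟨t, -⟩ := SimpleGraph.iSup_adj.1 h1
      exact absurd t.2 (by omega)
    · have h1 := Nat.le_mul_of_pos_right I.T (Nat.mul_pos hn hn)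
      have h2 := Nat.le_mul_of_pos_right I.n hn
      have h3 := Nat.le_mul_of_pos_left (I.n * I.n) hT
      omega
  have hkm : 2 * I.k + 1 ≤ m := by omega
  have hm3 : 3 ≤ m := by omega
  have hC : 0 < I.numLegs := Nat.mul_pos hk (Nat.succ_pos _)
  have hCm : 2 * I.numLegs + 1 ≤ m * m := by
    have := Nat.mul_le_mul hkm hkm
    unfold TDWInstance.numLegs
    nlinarith
  have hG : 0 < (2 * I.numLegs) ^ I.numDigits := pow_pos (by omega) _
  -- The exponent `4` is chosen for the number of digits `(C + 1) * C` with `C + 1 ≤ m ^ 2`, where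
  -- `C` is the number of legs; it also covers the number of visits.
  have e4 : m ^ 4 = m * m * (m * m) := by ring
  have h2 : m ≤ m * m := Nat.le_mul_of_pos_left _ (by omega)
  have h4 : m * m ≤ m ^ 4 := by rw [e4]; exact Nat.le_mul_of_pos_left _ (by omega)
  have key : ∀ {a}, a ≤ m ^ 4 → a ≤ (2 * I.numLegs) ^ I.numDigits * m ^ 4 := fun h =>
    h.trans (Nat.le_mul_of_pos_left _ hG)
  refine ⟨hk, key (by omega), key (by omega), key (by omega), key (by omega), key (by omega),
    key (by omega), key ?_, Nat.le_mul_of_pos_right _ (by omega), key ?_⟩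
  · rw [e4]
    exact Nat.mul_le_mul (by omega) (by omega)
  · have h5 := Nat.mul_le_mul hkm hnT.1
    have h6 := Nat.mul_le_mul (show I.k ≤ m by omega)
      (show (2 * I.k + 1) * I.n + 1 ≤ m * m + m by omega)
    have h7 : m * (m * m + m) ≤ m ^ 4 := by
      rw [e4, show m * (m * m + m) = m * m * (m + 1) by ring]
      exact Nat.mul_le_mul_left _ (by nlinarith)
    omega

/-- The running time in terms of the number of walks. -/
theorem exists_time_le (c : ℕ) : ∃ d, ∀ k m : ℕ, 0 < m →
    (k = 0 → c ≤ d * k ^ (d * k ^ 4) * m ^ d) ∧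
    (0 < k → c * ((2 * (k * (2 * k + 1))) ^ ((k * (2 * k + 1) + 1) * (k * (2 * k + 1))) *
      m ^ 4 + 1) ^ c ≤ d * k ^ (d * k ^ 4) * m ^ d) := by
  -- With `C = k * (2 * k + 1)`, the base `2 * C` is at most `6 * k ^ 2` and the exponent, with one
  -- more factor to absorb the `+ 1`, is at most `13 * k ^ 4`. For `k ≥ 2` one has `6 * k ^ 2 ≤ k ^
  -- 5`, whence `65 = 5 * 13`. For `k = 1` powers of `k` contribute nothing, so the factor `6 ^ (13
  -- * c)` is needed. For `k = 0` the power of `k` is `0 ^ 0 = 1`.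
  refine ⟨c * 6 ^ (13 * c) + 65 * c, fun k m hm => ⟨?_, fun hk => ?_⟩⟩
  · rintro rfl
    have h1 : c ≤ c * 6 ^ (13 * c) := Nat.le_mul_of_pos_right _ (pow_pos (by norm_num) _)
    simp only [ne_eq, OfNat.ofNat_ne_zero, not_false_eq_true, zero_pow, mul_zero, pow_zero, mul_one]
    exact h1.trans ((Nat.le_add_right _ _).trans (Nat.le_mul_of_pos_right _ (pow_pos hm _)))
  · set C := k * (2 * k + 1) with hC
    have hkk : k ≤ k * k := Nat.le_mul_of_pos_left _ hk
    have hC0 : 0 < C := Nat.mul_pos hk (Nat.succ_pos _)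
    have hC1 : 2 * C ≤ 6 * k ^ 2 := by rw [hC]; nlinarith
    have h1 : (2 * C) ^ ((C + 1) * C) * m ^ 4 + 1 ≤ (2 * C) ^ ((C + 1) * C + 1) * m ^ 4 := by
      have h2 : 1 ≤ (2 * C) ^ ((C + 1) * C) * m ^ 4 :=
        Nat.mul_pos (pow_pos (by omega) _) (pow_pos hm _)
      have h3 := Nat.mul_le_mul_left ((2 * C) ^ ((C + 1) * C) * m ^ 4) (show 2 ≤ 2 * C by omega)
      calc _ ≤ (2 * C) ^ ((C + 1) * C) * m ^ 4 * 2 := by omega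
        _ ≤ _ := h3
        _ = _ := by ring
    have hC2 : (C + 1) * C + 1 ≤ 13 * k ^ 4 := by
      have h4 : C ≤ 3 * (k * k) := by rw [hC]; nlinarith
      have h5 : 1 ≤ k * k := Nat.mul_pos hk hk
      calc (C + 1) * C + 1 ≤ (3 * (k * k) + 1) * (3 * (k * k)) + 1 :=
            Nat.add_le_add_right (Nat.mul_le_mul (by omega) h4) _
        _ ≤ 13 * ((k * k) * (k * k)) := by nlinarith
        _ = _ := by ring
    have h6 : (6 * k ^ 2) ^ (13 * k ^ 4 * c) ≤ 6 ^ (13 * c) * k ^ (65 * c * k ^ 4) := by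
      rcases Nat.lt_or_ge k 2 with hk2 | hk2
      · obtain rfl : k = 1 := by omega
        simp
      · have h7 : 6 * k ^ 2 ≤ k ^ 5 := by
          have h8 : 2 ^ 3 ≤ k ^ 3 := Nat.pow_le_pow_left hk2 3
          calc 6 * k ^ 2 ≤ k ^ 3 * k ^ 2 := Nat.mul_le_mul_right _ (by omega)
            _ = _ := by ring
        calc (6 * k ^ 2) ^ (13 * k ^ 4 * c) ≤ (k ^ 5) ^ (13 * k ^ 4 * c) :=
              Nat.pow_le_pow_left h7 _
          _ = k ^ (65 * c * k ^ 4) := by rw [← pow_mul]; congr 1; ring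
          _ ≤ _ := Nat.le_mul_of_pos_left _ (pow_pos (by norm_num) _)
    calc c * ((2 * C) ^ ((C + 1) * C) * m ^ 4 + 1) ^ c
        ≤ c * ((6 * k ^ 2) ^ (13 * k ^ 4) * m ^ 4) ^ c := by
          refine Nat.mul_le_mul_left _ (Nat.pow_le_pow_left (h1.trans ?_) _)
          exact Nat.mul_le_mul_right _ ((Nat.pow_le_pow_left hC1 _).trans
            (Nat.pow_le_pow_right (by positivity) hC2))
      _ = c * ((6 * k ^ 2) ^ (13 * k ^ 4 * c) * m ^ (4 * c)) := by
          rw [mul_pow, ← pow_mul, ← pow_mul]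
      _ ≤ c * (6 ^ (13 * c) * k ^ (65 * c * k ^ 4) * m ^ (4 * c)) := by gcongr
      _ = c * 6 ^ (13 * c) * k ^ (65 * c * k ^ 4) * m ^ (4 * c) := by ring
      _ ≤ _ := by
          gcongr
          · exact Nat.le_add_right _ _
          · exact Nat.le_add_left _ _
          · omega

/-- The program does not depend on the instance, so the polynomial that bounds its time in terms of
`Y` is fixed. It remains to insert the admissible `Y` for each instance. -/
theorem temporallyDisjointWalksOnLines_decidableInTime :
    ∃ c : ℕ, temporallyDisjointWalksOnLines.DecidableInTime
      (fun k m => c * k ^ (c * k ^ 4) * m ^ c) := by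
  obtain ⟨c, hc⟩ := solveLine.exists_bound_le
  obtain ⟨d, hd⟩ := exists_time_le c
  refine ⟨d, solveLine, fun ⟨I, hI⟩ => ?_⟩
  have hm : 0 < I.encode.length := by
    rw [I.length_encode]
    omega
  obtain ⟨h1, h2⟩ := hd I.k _ hm
  rcases Nat.eq_zero_or_pos I.k with hk | hk
  -- Without walks the program accepts before it reaches any loop, so `Y = 0` is admissible and the
  -- time is constant.
  · obtain ⟨t, σ, h3, h4, h5⟩ := solveLine_spec (Y := 0) hI I.represents_encode
      fun h => absurd h (by omega)
    refine ⟨t, σ, h3, (h4.trans (hc 0)).trans ?_, h5⟩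
    rw [zero_add, one_pow, mul_one]
    exact h1 hk
  · obtain ⟨t, σ, h3, h4, h5⟩ := solveLine_spec hI I.represents_encode fun h => I.loopBound hI h
    exact ⟨t, σ, h3, (h4.trans (hc _)).trans (h2 hk), h5⟩

/-- This provides the computability of `f` in the definition of fixed-parameter tractability. -/
theorem primrec_bound (c : ℕ) : Primrec fun k : ℕ => c * k ^ (c * k ^ 4) := by
  have hpow : Primrec₂ fun a b : ℕ => a ^ b :=
    Primrec₂.unpaired'.1 Nat.Primrec.pow
  exact Primrec.nat_mul.comp (Primrec.const c) (hpow.comp Primrec.id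
    (Primrec.nat_mul.comp (Primrec.const c) (hpow.comp Primrec.id (Primrec.const 4))))

/-- Fixed-parameter tractability is the explicit time bound with `f k = c * k ^ (c * k ^ 4)`. The
bound on distances follows from that on the length of a walk to a terminal. -/
theorem mainTheorem4 :
    temporallyDisjointWalksOnLines.IsFPT ∧
    (∃ c : ℕ, temporallyDisjointWalksOnLines.DecidableInTime
      (fun k m => c * k ^ (c * k ^ 4) * m ^ c)) ∧
    (∀ (I : TDWInstance) (W : Fin I.k → List (Transition (Fin I.n) I.T)),
      I.graph.IsLine → I.IsMinimalSolution W → ∀ i : Fin I.k,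
        (directionChanges (W i)).length ≤ 2 * I.k ∧
        ∀ b ∈ directionChanges (W i), ∃ v ∈ I.terminals,
          I.graph.underlying.dist b v ≤ I.k) := by
  obtain ⟨c, hc⟩ := temporallyDisjointWalksOnLines_decidableInTime
  refine ⟨⟨_, (primrec_bound c).to_comp, c, hc⟩, ⟨c, hc⟩, fun I W hG hW i =>
    ⟨hW.length_directionChanges_le hG i, fun b hb => ?_⟩⟩
  obtain ⟨v, hv, q, hq⟩ := hW.exists_walk_terminal hG i hb
  exact ⟨v, hv, (SimpleGraph.dist_le q).trans hq⟩
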